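/- **Setting.** Write $[5]=\{1,\dots,5\}$ and $d_{ij}=dx_i\wedge dx_j$. Let $L=E(5,10)$ be the Lie superalgebra whose even part consists of the divergence-free vector fields $X=\sum_i X_i\partial_i$ with $X_i\in\mathbb{C}[[x_1,\dots,x_5]]$, and whose odd part consists of the closed two-forms with coefficients in $\mathbb{C}[[x_1,\dots,x_5]]$. The bracket of two vector fields is the commutator, $[X,\omega]=L_X\omega$ is the Lie derivative, and $[f\,d_{ij},g\,d_{kl}]=\varepsilon_{ijkl}\,fg\,\partial_{t_{ijkl}}$. Here, if $i,j,k,l$ are distinct, $t_{ijkl}$ is the remaining index and $\varepsilon_{ijkl}$ is the sign of the permutation $(i,j,k,l,t_{ijkl})$; otherwise $\varepsilon_{ijkl}=0$. Let $L_{\ge 0}$ be the subalgebra of the elements all of whose coefficients have zero constant term. Its degree-zero part is $L_0\cong\mathfrak{sl}_5$, with $x_i\partial_j\leftrightarrow E_{ij}$. Let $U=U(L)$, and let $U_-\subset U$ be the subalgebra generated by $L_-=\langle\partial_t,\,d_{ij}\rangle$. For an $\mathfrak{sl}_5$-module $V$ let $M(V)=U\otimes_{U(L_{\ge0})}V$,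 where $L_{\ge 0}$ acts on $V$ through its projection to $L_0$. An element $\Phi=\sum_i u_i\otimes\theta_i\in U_-\otimes\operatorname{Hom}_{\mathbb C}(V,W)$ is associated with the linear map $M(V)\to M(W)$, $u\otimes v\mapsto \sum_i u\,u_i\otimes\theta_i(v)$ for $u\in U_-$, $v\in V$. For a dominant weight $\lambda=(a,b,c,d)\in\mathbb N^4$ (coordinates with respect to the fundamental weights, and the Borel subalgebra spanned by the $x_i\partial_j$ and $x_i\partial_i-x_j\partial_j$ with $i<j$) let $F(\lambda)$ be the finite-dimensional irreducible $\mathfrak{sl}_5$-module of highest weight $\lambda$, let $M(\lambda)=M(F(\lambda))$, and let $\lambda^*=(d,c,b,a)$. **The elements $\omega_I$.** Let $\mathcal I_d$ be the set of sequences $I=(I_1,\dots,I_d)$ of ordered pairs $I_l=(i_l,j_l)\in[5]^2$. The group $B_d$ of signed permutations acts on $\mathcal I_d$ by permuting the pairs and reversing those at which the sign is $-1$. For $I\in\mathcal I_d$ put $$\omega_I=\sum_{S}(-1)^{c(S)}\Big(\prod_{\{k,l\}\in S}\tfrac12(-1)^{k+l}\varepsilon_{I_k,I_l}\,\partial_{t_{I_k,I_l}}\Big)\,d_{C_S(I)}\in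 U_-,$$ where $S$ runs over the sets of pairwise disjoint two-element subsets of $\{1,\dots,d\}$, $c(S)$ is the number of crossing pairs of elements of $S$, and $d_{C_S(I)}$ is the product, in increasing order of $k$, of the $d_{I_k}$ with $k$ in no element of $S$. In particular $\omega_I=d_I$ for $d=1$. Sums over $\mathcal I_d/B_d$ below run over a fixed set of representatives of the orbits. **Statement.** Let $V$ and $W$ be arbitrary $\mathfrak{sl}_5$-modules over $\mathbb C$, let $\theta_I\in\operatorname{Hom}_{\mathbb C}(V,W)$ for $I\in\mathcal I_3$ and $\theta^t_I\in\operatorname{Hom}_{\mathbb C}(V,W)$ for $t\in[5]$, $I\in\mathcal I_1$, and suppose that $\varphi:M(V)\to M(W)$ is a morphism of $L$-modules associated with $$\Phi=\sum_{I\in\mathcal I_3/B_3}\omega_I\otimes\theta_I+\sum_{t\in[5]}\sum_{I\in\mathcal I_1/B_1}\partial_t\omega_I\otimes\theta^t_I .$$ For $\theta\in\operatorname{Hom}_{\mathbb C}(V,W)$ let $\theta^*\in\operatorname{Hom}_{\mathbb C}(W^*,V^*)$, $\theta^*(f)=f\circ\theta$. Then there is a morphism of $L$-modules $\psi:M(W^*)\to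 M(V^*)$, necessarily unique, which is associated with $$\Psi=\sum_{I\in\mathcal I_3/B_3}\omega_I\otimes\theta_I^*+\sum_{t\in[5]}\sum_{I\in\mathcal I_1/B_1}\partial_t\omega_I\otimes(-\theta^t_I)^* .$$ Moreover, if $V=F(\lambda)$ and $W=F(\mu)$ for dominant weights $\lambda,\mu$, then $V^*$ and $W^*$ are finite-dimensional irreducible of highest weights $\lambda^*$ and $\mu^*$; so a degree-3 morphism $\varphi:M(\lambda)\to M(\mu)$ yields the morphism $\psi:M(\mu^*)\to M(\lambda^*)$ associated with $\Psi$. -/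

import Mathlib

open scoped TensorProduct

noncomputable section

namespace E510

/-! ### The exceptional Lie superalgebra `E(5,10)`

Indices run over `Fin 5 = {0,1,2,3,4}`, which stands for the index set `{1,2,3,4,5}`. -/

/-- The algebra `ℂ[[x₁,…,x₅]]` of formal power series. -/
abbrev PS := MvPowerSeries (Fin 5) ℂ

/-- The formal partial derivative `∂/∂xᵢ` on power series. -/
abbrev pd (i : Fin 5) : Derivation ℂ PS PS := MvPowerSeries.pderiv ℂ i

/-- For a sequence `f` of five indices: the sign of `f` if `f` is a permutation, and `0` otherwise
(see `eps_perm` and `eps_of_not_injective`). -/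
def eps (f : Fin 5 → Fin 5) : ℤ := ((1 : Matrix (Fin 5) (Fin 5) ℤ).submatrix f id).det

theorem eps_comp (f : Fin 5 → Fin 5) (σ : Equiv.Perm (Fin 5)) :
    eps (f ∘ σ) = Equiv.Perm.sign σ * eps f := by
  have h := Matrix.det_permute σ ((1 : Matrix (Fin 5) (Fin 5) ℤ).submatrix f id)
  simpa [eps, Matrix.submatrix_submatrix] using h

theorem eps_perm (σ : Equiv.Perm (Fin 5)) : eps σ = Equiv.Perm.sign σ := by
  have h := eps_comp id σ
  simpa [eps] using h

theorem eps_of_not_injective (f : Fin 5 → Fin 5) (hf : ¬ Function.Injective f) : eps f = 0 := by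
  simp only [Function.Injective, not_forall] at hf
  obtain ⟨i, j, hij, hne⟩ := hf
  exact Matrix.det_zero_of_row_eq hne (by funext k; exact congrArg (fun a => (1 : Matrix (Fin 5) (Fin 5) ℤ) a k) hij)

/-- `L₀̄ = S₅`: the vector fields `X = ∑ᵢ Xᵢ ∂ᵢ` with formal power series coefficients and zero
divergence. -/
def evenPart : Submodule ℂ (Fin 5 → PS) where
  carrier := {X | ∑ i, pd i (X i) = 0}
  add_mem' := by
    intro X Y hX hY
    simp only [Set.mem_ofPred_eq, Pi.add_apply, map_add, Finset.sum_add_distrib] at *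
    rw [hX, hY, add_zero]
  zero_mem' := by simp
  smul_mem' := by
    intro c X hX
    simp only [Set.mem_ofPred_eq, Pi.smul_apply, Derivation.map_smul, ← Finset.smul_sum] at *
    rw [hX, smul_zero]

/-- `L₁̄ = Ω²_cl`: the closed two-forms `ω = ½ ∑_{i,j} ω_{ij} dxᵢ ∧ dxⱼ = ∑_{i<j} ω_{ij} dxᵢ ∧ dxⱼ`,
given by their skew-symmetric coefficient matrices. -/
def oddPart : Submodule ℂ (Fin 5 → Fin 5 → PS) where
  carrier := {w | (∀ i j, w j i = - w i j) ∧
    ∀ i j k, pd i (w j k) + pd j (w k i) + pd k (w i j) = 0}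
  add_mem' := by
    rintro w z ⟨hw, hw'⟩ ⟨hz, hz'⟩
    refine ⟨fun i j => ?_, fun i j k => ?_⟩
    · simp only [Pi.add_apply]; rw [hw i j, hz i j]; ring
    · simp only [Pi.add_apply, map_add]; linear_combination hw' i j k + hz' i j k
  zero_mem' := by simp
  smul_mem' := by
    rintro c w ⟨hw, hw'⟩
    refine ⟨fun i j => ?_, fun i j k => ?_⟩
    · simp only [Pi.smul_apply]; rw [hw i j, smul_neg]
    · simp only [Pi.smul_apply, Derivation.map_smul, ← smul_add]; rw [hw' i j k, smul_zero]

theorem pd_comm (i j : Fin 5) (f : PS) : pd i (pd j f) = pd j (pd i f) := by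
  ext n
  simp only [MvPowerSeries.coeff_pderiv]
  rw [add_right_comm]
  by_cases h : i = j
  · subst h; rfl
  · simp [h, Ne.symm h, mul_right_comm]

/-- The commutator of vector fields. -/
def vectorBracketFun (X Y : Fin 5 → PS) : Fin 5 → PS := fun j =>
  ∑ i, (X i * pd i (Y j) - Y i * pd i (X j))

theorem vectorBracket_mem (X Y : evenPart) : vectorBracketFun X Y ∈ evenPart := by
  obtain ⟨X, hX⟩ := X
  obtain ⟨Y, hY⟩ := Y
  have hX' : ∑ i, pd i (X i) = 0 := hX
  have hY' : ∑ i, pd i (Y i) = 0 := hY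
  have key : ∀ A B : Fin 5 → PS, ∑ i, pd i (B i) = 0 →
      ∑ j, ∑ i, A i * pd j (pd i (B j)) = 0 := by
    intro A B hB
    rw [Finset.sum_comm]
    refine Finset.sum_eq_zero fun i _ => ?_
    rw [← Finset.mul_sum]
    have : ∑ j, pd j (pd i (B j)) = pd i (∑ j, pd j (B j)) := by
      rw [map_sum]; exact Finset.sum_congr rfl fun j _ => pd_comm j i _
    rw [this, hB, map_zero, mul_zero]
  change ∑ j, pd j (∑ i, (X i * pd i (Y j) - Y i * pd i (X j))) = 0
  simp only [map_sum, map_sub, Derivation.leibniz, smul_eq_mul, Finset.sum_sub_distrib,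
    Finset.sum_add_distrib]
  rw [key X Y hY', key Y X hX']
  have : ∑ j, ∑ i, pd i (Y j) * pd j (X i) = ∑ j, ∑ i, pd i (X j) * pd j (Y i) := by
    rw [Finset.sum_comm]
    exact Finset.sum_congr rfl fun i _ => Finset.sum_congr rfl fun j _ => mul_comm _ _
  rw [this]; ring

/-- The bracket `[X, Y]` of two even elements. -/
def vectorBracket (X Y : evenPart) : evenPart := ⟨vectorBracketFun X Y, vectorBracket_mem X Y⟩

/-- The coefficients of the Lie derivative `L_X w`. -/
def lieDerivFun (X : Fin 5 → PS) (w : Fin 5 → Fin 5 → PS) : Fin 5 → Fin 5 → PS := fun j k =>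
  ∑ i, (X i * pd i (w j k) + pd j (X i) * w i k + pd k (X i) * w j i)

theorem lieDeriv_mem (X : evenPart) (w : oddPart) : lieDerivFun X w ∈ oddPart := by
  obtain ⟨X, -⟩ := X
  obtain ⟨w, hw, hw'⟩ := w
  refine ⟨fun j k => ?_, fun l j k => ?_⟩
  · simp only [lieDerivFun, ← Finset.sum_neg_distrib]
    refine Finset.sum_congr rfl fun i _ => ?_
    rw [hw j k, hw i k, hw j i, map_neg]
    ring
  · simp only [lieDerivFun, map_sum, ← Finset.sum_add_distrib]
    refine Finset.sum_eq_zero fun i _ => ?_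
    simp only [map_add, Derivation.leibniz, smul_eq_mul]
    have e1 : X i * (pd i (pd l (w j k)) + pd i (pd j (w k l)) + pd i (pd k (w l j))) = 0 := by
      rw [← map_add, ← map_add, hw' l j k, map_zero, mul_zero]
    have hl := hw' i j k
    have hj := hw' i k l
    have hk := hw' i l j
    have a1 := hw i l
    have a2 := hw i j
    have a3 := hw i k
    rw [pd_comm l i, pd_comm j i, pd_comm k i, pd_comm k l (X i), pd_comm j l (X i),
      pd_comm k j (X i)]
    have b1 : ∀ m, pd m (w l i) = - pd m (w i l) := fun m => by rw [a1, map_neg]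
    have b2 : ∀ m, pd m (w j i) = - pd m (w i j) := fun m => by rw [a2, map_neg]
    have b3 : ∀ m, pd m (w k i) = - pd m (w i k) := fun m => by rw [a3, map_neg]
    simp only [b1, b2, b3] at *
    rw [a1, a2, a3]
    linear_combination e1 + pd l (X i) * hl + pd j (X i) * hj + pd k (X i) * hk

/-- The bracket `[X, w] = L_X w` of an even and an odd element. -/
def lieDeriv (X : evenPart) (w : oddPart) : oddPart := ⟨lieDerivFun X w, lieDeriv_mem X w⟩

/-- The bilinear extension of `[f dxᵢ∧dxⱼ, g dxₖ∧dxₗ] = ε_{ijkl} f g ∂_t`, where `t` is the fifth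
index and `ε_{ijkl}` is the sign of `(i,j,k,l,t)` (zero if `i,j,k,l` are not distinct). The factor
`1/4` is there because each `dxᵢ∧dxⱼ` is counted twice in a sum over all ordered pairs. -/
def formBracketFun (w z : Fin 5 → Fin 5 → PS) : Fin 5 → PS := fun t =>
  (1 / 4 : ℂ) • ∑ i, ∑ j, ∑ k, ∑ l, eps ![i, j, k, l, t] • (w i j * z k l)

theorem sum_swap_pairs (f : Fin 5 → Fin 5 → Fin 5 → Fin 5 → PS) :
    ∑ i, ∑ j, ∑ k, ∑ l, f i j k l = ∑ k, ∑ l, ∑ i, ∑ j, f i j k l := by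
  have h := Finset.sum_comm (s := (Finset.univ : Finset (Fin 5 × Fin 5)))
    (t := (Finset.univ : Finset (Fin 5 × Fin 5))) (f := fun p q => f p.1 p.2 q.1 q.2)
  simpa only [Fintype.sum_prod_type] using h

theorem sum_swap (f : Fin 5 → Fin 5 → Fin 5 → Fin 5 → Fin 5 → PS) :
    ∑ t, ∑ i, ∑ j, ∑ k, ∑ l, f t i j k l = ∑ k, ∑ l, ∑ t, ∑ i, ∑ j, f t i j k l := by
  have h := Finset.sum_comm (s := (Finset.univ : Finset (Fin 5 × Fin 5 × Fin 5)))
    (t := (Finset.univ : Finset (Fin 5 × Fin 5))) (f := fun p q => f p.1 p.2.1 p.2.2 q.1 q.2)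
  simpa only [Fintype.sum_prod_type] using h

theorem eps_cycle_left (i j k l t : Fin 5) : eps ![j, t, k, l, i] = eps ![i, j, k, l, t] := by
  have h := eps_comp ![i, j, k, l, t] (Equiv.swap 0 1 * Equiv.swap 1 4)
  have hs : Equiv.Perm.sign (Equiv.swap (0 : Fin 5) 1 * Equiv.swap 1 4) = 1 := by decide
  rw [hs, Units.val_one, one_mul] at h
  rw [← h]
  congr 1
  funext a
  fin_cases a <;> rfl

theorem eps_swap_pairs (i j k l t : Fin 5) : eps ![k, l, i, j, t] = eps ![i, j, k, l, t] := by
  have h := eps_comp ![i, j, k, l, t] (Equiv.swap 0 2 * Equiv.swap 1 3)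
  have hs : Equiv.Perm.sign (Equiv.swap (0 : Fin 5) 2 * Equiv.swap 1 3) = 1 := by decide
  rw [hs, Units.val_one, one_mul] at h
  rw [← h]
  congr 1
  funext a
  fin_cases a <;> rfl

theorem sum_eps_closed (w : oddPart) (k l : Fin 5) :
    ∑ t, ∑ i, ∑ j, eps ![i, j, k, l, t] • pd t (w.1 i j) = 0 := by
  have h1 : ∑ t, ∑ i, ∑ j, eps ![i, j, k, l, t] • pd t (w.1 i j) =
      ∑ t, ∑ i, ∑ j, eps ![i, j, k, l, t] • pd i (w.1 j t) := by
    calc _ = ∑ i, ∑ j, ∑ t, eps ![j, t, k, l, i] • pd i (w.1 j t) := rfl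
      _ = ∑ i, ∑ j, ∑ t, eps ![i, j, k, l, t] • pd i (w.1 j t) := by simp only [eps_cycle_left]
      _ = ∑ i, ∑ t, ∑ j, eps ![i, j, k, l, t] • pd i (w.1 j t) :=
        Finset.sum_congr rfl fun i _ => Finset.sum_comm
      _ = _ := Finset.sum_comm
  have h2 : ∑ t, ∑ i, ∑ j, eps ![i, j, k, l, t] • pd i (w.1 j t) =
      ∑ t, ∑ i, ∑ j, eps ![i, j, k, l, t] • pd j (w.1 t i) := by
    calc _ = ∑ i, ∑ j, ∑ t, eps ![j, t, k, l, i] • pd j (w.1 t i) := rfl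
      _ = ∑ i, ∑ j, ∑ t, eps ![i, j, k, l, t] • pd j (w.1 t i) := by simp only [eps_cycle_left]
      _ = ∑ i, ∑ t, ∑ j, eps ![i, j, k, l, t] • pd j (w.1 t i) :=
        Finset.sum_congr rfl fun i _ => Finset.sum_comm
      _ = _ := Finset.sum_comm
  have h3 : ∑ t, ∑ i, ∑ j, eps ![i, j, k, l, t] • pd t (w.1 i j) +
      ∑ t, ∑ i, ∑ j, eps ![i, j, k, l, t] • pd i (w.1 j t) +
      ∑ t, ∑ i, ∑ j, eps ![i, j, k, l, t] • pd j (w.1 t i) = 0 := by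
    simp only [← Finset.sum_add_distrib, ← smul_add]
    refine Finset.sum_eq_zero fun t _ => Finset.sum_eq_zero fun i _ =>
      Finset.sum_eq_zero fun j _ => ?_
    rw [w.2.2 t i j, smul_zero]
  rw [← h2, ← h1] at h3
  have h4 : (3 : ℂ) • ∑ t, ∑ i, ∑ j, eps ![i, j, k, l, t] • pd t (w.1 i j) = 0 := by
    rw [← h3]; module
  exact (smul_eq_zero.mp h4).resolve_left (by norm_num)

theorem formBracket_mem (w z : oddPart) : formBracketFun w z ∈ evenPart := by
  have key : ∀ w z : oddPart,
      ∑ t, ∑ i, ∑ j, ∑ k, ∑ l, eps ![i, j, k, l, t] • (z.1 k l * pd t (w.1 i j)) = 0 := by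
    intro w z
    calc _ = ∑ k, ∑ l, z.1 k l * ∑ t, ∑ i, ∑ j, eps ![i, j, k, l, t] • pd t (w.1 i j) := by
          simp only [Finset.mul_sum, mul_smul_comm]
          exact sum_swap fun t i j k l => eps ![i, j, k, l, t] • (z.1 k l * pd t (w.1 i j))
      _ = 0 := by simp only [sum_eps_closed, mul_zero, Finset.sum_const_zero]
  have key' : ∑ t, ∑ i, ∑ j, ∑ k, ∑ l, eps ![i, j, k, l, t] • (w.1 i j * pd t (z.1 k l)) = 0 := by
    rw [← key z w]
    refine Finset.sum_congr rfl fun t _ => ?_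
    rw [sum_swap_pairs fun i j k l => eps ![i, j, k, l, t] • (w.1 i j * pd t (z.1 k l))]
    simp only [eps_swap_pairs]
  change ∑ t, pd t ((1 / 4 : ℂ) • ∑ i, ∑ j, ∑ k, ∑ l, eps ![i, j, k, l, t] • (w.1 i j * z.1 k l)) = 0
  simp only [Derivation.map_smul, map_sum, ← Finset.smul_sum, map_zsmul, Derivation.leibniz,
    smul_eq_mul, smul_add, Finset.sum_add_distrib]
  rw [key w z, key', smul_zero, add_zero]

/-- The bracket `[w, z]` of two odd elements. -/
def formBracket (w z : oddPart) : evenPart := ⟨formBracketFun w z, formBracket_mem w z⟩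

/-- The underlying vector space of `L = E(5,10)`. -/
abbrev L := evenPart × oddPart

/-! ### The universal enveloping algebra -/

/-- The defining relations `xy - (-1)^{|x||y|} yx = [x,y]` (`x`, `y` homogeneous) of the universal
enveloping algebra of the Lie superalgebra `L`. -/
inductive EnvRel : TensorAlgebra ℂ L → TensorAlgebra ℂ L → Prop
  | even_even (X Y : evenPart) :
      EnvRel (TensorAlgebra.ι ℂ ((X, 0) : L) * TensorAlgebra.ι ℂ ((Y, 0) : L) -
          TensorAlgebra.ι ℂ ((Y, 0) : L) * TensorAlgebra.ι ℂ ((X, 0) : L))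
        (TensorAlgebra.ι ℂ ((vectorBracket X Y, 0) : L))
  | even_odd (X : evenPart) (w : oddPart) :
      EnvRel (TensorAlgebra.ι ℂ ((X, 0) : L) * TensorAlgebra.ι ℂ ((0, w) : L) -
          TensorAlgebra.ι ℂ ((0, w) : L) * TensorAlgebra.ι ℂ ((X, 0) : L))
        (TensorAlgebra.ι ℂ ((0, lieDeriv X w) : L))
  | odd_odd (w z : oddPart) :
      EnvRel (TensorAlgebra.ι ℂ ((0, w) : L) * TensorAlgebra.ι ℂ ((0, z) : L) +
          TensorAlgebra.ι ℂ ((0, z) : L) * TensorAlgebra.ι ℂ ((0, w) : L))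
        (TensorAlgebra.ι ℂ ((formBracket w z, 0) : L))

/-- The universal enveloping algebra `U = U(L)`. A left `L`-module is a left `U`-module, and a
morphism of `L`-modules is a `U`-linear map. -/
def U := RingQuot EnvRel

instance : Ring U := inferInstanceAs (Ring (RingQuot EnvRel))

instance : Algebra ℂ U := inferInstanceAs (Algebra ℂ (RingQuot EnvRel))

/-- The canonical map `L → U`. -/
def toU : L →ₗ[ℂ] U :=
  (show TensorAlgebra ℂ L →ₐ[ℂ] U from RingQuot.mkAlgHom ℂ EnvRel).toLinearMap ∘ₗ
    TensorAlgebra.ι ℂ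

/-- The constant vector field `∂_t`. -/
def partialField (t : Fin 5) : evenPart :=
  ⟨Pi.single t 1, by
    refine Finset.sum_eq_zero fun i _ => ?_
    by_cases h : i = t
    · subst h; simp
    · simp [Pi.single_eq_of_ne h]⟩

/-- The constant two-form `d_{ij} = dxᵢ ∧ dxⱼ`. -/
def constForm (i j : Fin 5) : oddPart :=
  ⟨fun a b => MvPowerSeries.C
      ((if a = i ∧ b = j then 1 else 0) - (if a = j ∧ b = i then 1 else 0) : ℂ), by
    refine ⟨fun a b => ?_, fun a b c => by simp only [MvPowerSeries.pderiv_C, add_zero]⟩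
    rw [← map_neg]
    simp only [and_comm (a := b = i), and_comm (a := b = j), neg_sub]⟩

/-- `U₋ = U(L₋)`, the subalgebra of `U` generated by `L₋ = L₋₂ ⊕ L₋₁`, where
`L₋₂ = ⟨∂₁,…,∂₅⟩` and `L₋₁ = ⟨d_{ij}⟩`. -/
def Uminus : Subalgebra ℂ U :=
  Algebra.adjoin ℂ (Set.range (fun t : Fin 5 => toU (partialField t, 0)) ∪
    Set.range (fun p : Fin 5 × Fin 5 => toU (0, constForm p.1 p.2)))

/-- `∂_t` as an element of `U₋`. -/
def del (t : Fin 5) : Uminus :=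
  ⟨toU (partialField t, 0), Algebra.subset_adjoin (Or.inl ⟨t, rfl⟩)⟩

/-- `d_{ij}` as an element of `U₋`, where `p = (i,j)`. -/
def dd (p : Fin 5 × Fin 5) : Uminus :=
  ⟨toU (0, constForm p.1 p.2), Algebra.subset_adjoin (Or.inr ⟨p, rfl⟩)⟩

/-! ### The elements `ω_I` -/

/-- `𝓘_d`: sequences `I = (I₁,…,I_d)` of ordered pairs `I_l = (i_l, j_l)` of indices. -/
abbrev Seq (d : ℕ) := Fin d → Fin 5 × Fin 5

/-- The two-element subsets `{k,l}` of the set of positions, written with `k < l`. -/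
abbrev Pair (d : ℕ) := {p : Fin d × Fin d // p.1 < p.2}

/-- Two pairs of positions are disjoint as two-element sets. -/
def Pair.Disj {d : ℕ} (p q : Pair d) : Prop :=
  p.1.1 ≠ q.1.1 ∧ p.1.1 ≠ q.1.2 ∧ p.1.2 ≠ q.1.1 ∧ p.1.2 ≠ q.1.2

/-- `p` begins first, `q` begins inside `p` and ends outside `p`. Two disjoint pairs cross if
this holds for them in one of the two orders. -/
def Pair.CrossesRight {d : ℕ} (p q : Pair d) : Prop :=
  p.1.1 < q.1.1 ∧ q.1.1 < p.1.2 ∧ p.1.2 < q.1.2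

open scoped Classical in
/-- The set `SIF_d` of self-intersection free sets of pairs of positions. -/
def SIF (d : ℕ) : Finset (Finset (Pair d)) :=
  Finset.univ.filter fun S => ∀ p ∈ S, ∀ q ∈ S, p ≠ q → p.Disj q

open scoped Classical in
/-- The crossing number `c(S)`: the number of (unordered) pairs of crossing elements of `S`. -/
def crossing {d : ℕ} (S : Finset (Pair d)) : ℕ :=
  ((S ×ˢ S).filter fun pq => pq.1.CrossesRight pq.2).card

/-- `D_{{k,l}}(I) = ½ (-1)^{k+l} ε_{I_k,I_l} ∂_{t_{I_k,I_l}}`. In the sum over `t` only the fifth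
index `t = t_{I_k,I_l}` can contribute. -/
def DPair {d : ℕ} (I : Seq d) (p : Pair d) : Uminus :=
  ((1 / 2 : ℂ) * (-1) ^ (p.1.1.val + p.1.2.val)) •
    ∑ t : Fin 5, eps ![(I p.1.1).1, (I p.1.1).2, (I p.1.2).1, (I p.1.2).2, t] • del t

open scoped Classical in
/-- `D_S(I) = ∏_{s ∈ S} D_s(I)`; the factors commute, and they are multiplied here in the
lexicographic order of the positions. -/
def DSet {d : ℕ} (I : Seq d) (S : Finset (Pair d)) : Uminus :=
  ((List.finRange d).map fun k => ((List.finRange d).map fun l =>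
    if h : k < l then
      (if (⟨(k, l), h⟩ : Pair d) ∈ S then DPair I ⟨(k, l), h⟩ else 1)
    else 1).prod).prod

open scoped Classical in
/-- `d_{C_S(I)}`: the ordered product of the `d_{I_k}` over the positions `k` which do not occur
in `S`. -/
def dRest {d : ℕ} (I : Seq d) (S : Finset (Pair d)) : Uminus :=
  ((List.finRange d).map fun k =>
    if ∃ p ∈ S, p.1.1 = k ∨ p.1.2 = k then 1 else dd (I k)).prod

/-- `ω_I = ∑_{S ∈ SIF_d} (-1)^{c(S)} D_S(I) d_{C_S(I)} ∈ (U₋)_d`. -/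
def omega {d : ℕ} (I : Seq d) : Uminus :=
  ∑ S ∈ SIF d, (-1 : ℂ) ^ crossing S • (DSet I S * dRest I S)

/-- The action of a signed permutation (an element of the Weyl group `B_d`) on `𝓘_d`: permute the
pairs, and reverse those at which the sign is `-1` (encoded by `true`). -/
def signedAct {d : ℕ} (σ : Equiv.Perm (Fin d)) (η : Fin d → Bool) (I : Seq d) : Seq d :=
  fun j => if η j then (I (σ j)).swap else I (σ j)

/-- Two sequences are equivalent if they lie in the same `B_d`-orbit. -/
def orbitSetoid (d : ℕ) : Setoid (Seq d) where
  r I J := ∃ σ η, J = signedAct σ η I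
  iseqv :=
    { refl := fun I => ⟨1, fun _ => false, by funext j; simp [signedAct]⟩
      symm := by
        rintro I J ⟨σ, η, rfl⟩
        refine ⟨σ⁻¹, fun j => η (σ⁻¹ j), ?_⟩
        funext j
        by_cases h : η ((Equiv.symm σ) j) <;> simp [signedAct, h]
      trans := by
        rintro I J K ⟨σ, η, rfl⟩ ⟨τ, ζ, rfl⟩
        refine ⟨σ * τ, fun j => xor (ζ j) (η (τ j)), ?_⟩
        funext j
        by_cases h : ζ j <;> by_cases h' : η (τ j) <;> simp [signedAct, h, h'] }

/-- The set of orbits `𝓘_d / B_d`. -/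
abbrev Orbit (d : ℕ) := Quotient (orbitSetoid d)

instance (d : ℕ) : Fintype (Orbit d) := Fintype.ofFinite _

/-! ### Generalized Verma modules -/

/-- `L₀ ≅ 𝔰𝔩₅`; the vector field `xᵢ ∂ⱼ` corresponds to the elementary matrix `E_{ij}`. -/
abbrev sl5 := LieAlgebra.SpecialLinear.sl (Fin 5) ℂ

/-- The degree zero (linear) part of a vector field `X = ∑ⱼ Xⱼ ∂ⱼ`, as an element of `𝔰𝔩₅`: if
`Xⱼ = cⱼ + ∑ᵢ a_{ij} xᵢ + …`, it is the matrix `(a_{ij})`, that is `∑ a_{ij} xᵢ ∂ⱼ`. -/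
def linearPart (X : evenPart) : sl5 :=
  ⟨Matrix.of fun i j => MvPowerSeries.coeff (Finsupp.single i 1) (X.1 j), by
    have hX : ∑ i, pd i (X.1 i) = 0 := X.2
    have h := congrArg (MvPowerSeries.coeff (R := ℂ) (0 : Fin 5 →₀ ℕ)) hX
    rw [map_sum] at h
    have h' : Matrix.trace (Matrix.of fun i j =>
        MvPowerSeries.coeff (Finsupp.single i 1) (X.1 j) : Matrix (Fin 5) (Fin 5) ℂ) = 0 := by
      simpa [Matrix.trace, MvPowerSeries.coeff_pderiv] using h
    exact h'⟩

section Verma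

variable (V : Type*) [AddCommGroup V] [Module ℂ V] [LieRingModule sl5 V] [LieModule ℂ sl5 V]

/-- The relations `ux ⊗ v = u ⊗ xv` for `x ∈ L_{≥0}`, where `L_{≥0} = L₀ ⊕ L₊` consists of the
vector fields and closed two-forms without constant term and acts on `V` through `L₀ = 𝔰𝔩₅` (that
is, `L₊` acts trivially). -/
def vermaRelations : Submodule U (U ⊗[ℂ] V) :=
  Submodule.span U
    ({m | ∃ (u : U) (X : evenPart) (v : V), (∀ i, MvPowerSeries.constantCoeff (X.1 i) = 0) ∧
        m = (u * toU (X, 0)) ⊗ₜ[ℂ] v - u ⊗ₜ[ℂ] ⁅linearPart X, v⁆} ∪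
      {m | ∃ (u : U) (w : oddPart) (v : V), (∀ i j, MvPowerSeries.constantCoeff (w.1 i j) = 0) ∧
        m = (u * toU (0, w)) ⊗ₜ[ℂ] v})

/-- The generalized Verma module `M(V) = U ⊗_{U(L_{≥0})} V`. -/
abbrev Verma := (U ⊗[ℂ] V) ⧸ vermaRelations V

variable {V}

/-- The element `u ⊗ v` of `M(V)`. -/
def vtensor (u : U) (v : V) : Verma V := (vermaRelations V).mkQ (u ⊗ₜ[ℂ] v)

variable {W : Type*} [AddCommGroup W] [Module ℂ W] [LieRingModule sl5 W] [LieModule ℂ sl5 W]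

/-- For `Φ = ∑ᵢ uᵢ ⊗ θᵢ ∈ U₋ ⊗ Hom(V,W)` and `v ∈ V`, the element
`Φ(v) = ∑ᵢ uᵢ ⊗ θᵢ(v)` of `M(W)`. -/
def evalAt (Φ : Uminus ⊗[ℂ] (V →ₗ[ℂ] W)) (v : V) : Verma W :=
  (vermaRelations W).mkQ
    (TensorProduct.map Uminus.val.toLinearMap (LinearMap.applyₗ v) Φ)

/-- The map `φ : M(V) → M(W)` is the one associated with `Φ ∈ U₋ ⊗ Hom(V,W)`:
`φ(u ⊗ v) = u Φ(v)` for all `u ∈ U₋` and `v ∈ V`. -/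
def IsAssociated (φ : Verma V → Verma W) (Φ : Uminus ⊗[ℂ] (V →ₗ[ℂ] W)) : Prop :=
  ∀ (u : Uminus) (v : V), φ (vtensor (u : U) v) = (u : U) • evalAt Φ v

/-- The element `∑_{I ∈ 𝓘₃/B₃} ω_I ⊗ θ_I + ∑_t ∑_{I ∈ 𝓘₁/B₁} ∂_t ω_I ⊗ θ^t_I` of
`U₋ ⊗ Hom(V,W)`. The sums run over a fixed set of representatives of the orbits; for families that
satisfy `θ_{g(I)} = (-1)^{ℓ(g)} θ_I`, as `ω_I` does, the choice does not matter. That symmetry is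
not needed to form the sum, so it is not imposed. -/
def degreeThree (θ : Seq 3 → (V →ₗ[ℂ] W)) (θ' : Fin 5 → Seq 1 → (V →ₗ[ℂ] W)) :
    Uminus ⊗[ℂ] (V →ₗ[ℂ] W) :=
  ∑ o : Orbit 3, omega o.out ⊗ₜ[ℂ] θ o.out +
    ∑ t : Fin 5, ∑ o : Orbit 1, (del t * omega o.out) ⊗ₜ[ℂ] θ' t o.out

end Verma

/-! ### Highest weight modules -/

/-- `V` is the finite-dimensional irreducible `𝔰𝔩₅`-module `F(lam)` of highest weight
`lam = (lam₁₂, lam₂₃, lam₃₄, lam₄₅)` (coordinates with respect to the fundamental weights) for the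
Borel subalgebra spanned by the `xᵢ∂ⱼ` and `h_{ij} = xᵢ∂ᵢ - xⱼ∂ⱼ`, `i < j`. -/
structure IsF (lam : Fin 4 → ℕ) (V : Type*) [AddCommGroup V] [Module ℂ V]
    [LieRingModule sl5 V] [LieModule ℂ sl5 V] : Prop where
  finite : FiniteDimensional ℂ V
  irreducible : LieModule.IsIrreducible ℂ sl5 V
  highest : ∃ v : V, v ≠ 0 ∧
    (∀ (i j : Fin 5) (h : i < j), ⁅LieAlgebra.SpecialLinear.single i j h.ne (1 : ℂ), v⁆ = 0) ∧
    ∀ k : Fin 4, ⁅LieAlgebra.SpecialLinear.singleSubSingle k.castSucc k.succ (1 : ℂ), v⁆ =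
      (lam k : ℂ) • v

/-- `(a,b,c,d)* = (d,c,b,a)`. -/
def starWeight (lam : Fin 4 → ℕ) : Fin 4 → ℕ := fun k => lam k.rev

end E510

end

open scoped TensorProduct

noncomputable section

namespace E510

set_option linter.unusedSectionVars false

/-! ### Jacobi identities -/

/-! By Frobenius reciprocity a morphism M(V) → M(W) is a linear map v ↦ Φ(v) into M(W) which
intertwines the action of L_{≥0}: degree zero acts through 𝔰𝔩₅, and positive degree annihilates
Φ(v). By Poincaré–Birkhoff–Witt, M(W) is U(L₋) ⊗ W, so these conditions are identities in U(L₋) ⊗ W.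
Here U(L₋) is presented by generators and relations as `Neg`, and L acts on `Neg ⊗ W`. That this is
an action (`rho_relations`) rests on the Jacobi identities of E(5,10); `toModel_ofModel` and
`ofModel_rho` then carry statements between the two pictures.

The duality comes from the antiautomorphism `Neg.anti` of U(L₋), d_p ↦ i d_p, ∂_t ↦ -∂_t. It
multiplies ω_I (three pairs) by i and ∂_t ω_I (one pair) by -i. Up to the factor i, Ψ is therefore Φ
with the antiautomorphism applied to the first factor and transposition to the second
(`dualVec_degreeThree`); this explains the sign at θ^t. It remains to see that this transform
preserves the singularity conditions.

For a linear field X this holds because X acts on U(L₋) by a derivation commuting with the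
antiautomorphism (`IsLinField.pairM_rho0`). For a closed form z with linear coefficients, put X_a =
[z, d_a] and let ι_a be the contraction with the coordinate a. Up to -i and the antiautomorphism, z
applied to the dual vector is zΦ(v) - ½ ∑_a (X_a ι_a Φ(v) - ι_a Φ(X_a v)) (`IsLinForm.pairM_rho1`).
Since Φ(X_a v) = X_a Φ(v), the sum is a sum of commutators of X_a and ι_a. It vanishes because it
reduces to a trace which is zero for closed z (`IsLinForm.sum_contrM_comm`).

All of L_{≥0} is then reached by generation. Elements vanishing to third order kill vectors of
degree three by degree, and brackets of linear fields and linear forms supply the quadratic parts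
(`IsSubalgebra.mem_even`, `IsSubalgebra.mem_odd`). The argument uses no finiteness of V or W.

For the highest weights, a highest weight vector is moved along simple reflections to a lowest
weight vector u. The functional which is nonzero on u and vanishes on all higher eigenspaces of a
grading element is a highest weight vector of the dual. -/

theorem eps_update_of_injective (f : Fin 5 → Fin 5) (hf : Function.Injective f) (s m : Fin 5)
    (h : m ≠ f s) : eps (Function.update f s m) = 0 := by
  obtain ⟨r, hr⟩ := (Finite.injective_iff_surjective.mp hf) m
  refine eps_of_not_injective _ fun hinj => ?_
  have hrs : r ≠ s := by rintro rfl; exact h hr.symm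
  exact hrs (hinj (by simp [hrs, hr]))

/-- A matrix acts on the alternating symbol through its trace. -/
theorem sum_eps_update {M : Type*} [AddCommGroup M] (A : Fin 5 → Fin 5 → M) (f : Fin 5 → Fin 5) :
    ∑ s, ∑ m, eps (Function.update f s m) • A m (f s) = eps f • ∑ s, A s s := by
  by_cases hf : Function.Injective f
  · have h1 : ∀ s, ∑ m, eps (Function.update f s m) • A m (f s) = eps f • A (f s) (f s) := by
      intro s
      rw [Finset.sum_eq_single (f s)]
      · rw [Function.update_eq_self]
      · intro m _ hm
        rw [eps_update_of_injective f hf s m hm, zero_smul]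
      · simp
    simp only [h1, ← Finset.smul_sum]
    congr 1
    exact (Equiv.ofBijective f (Finite.injective_iff_bijective.mp hf)).sum_comp fun s => A s s
  · rw [eps_of_not_injective f hf, zero_smul]
    simp only [Function.Injective, not_forall] at hf
    obtain ⟨a, b, hab, hne⟩ := hf
    have h0 : ∀ s, s ≠ a → s ≠ b → ∑ m, eps (Function.update f s m) • A m (f s) = 0 := by
      intro s ha hb
      refine Finset.sum_eq_zero fun m _ => ?_
      rw [eps_of_not_injective, zero_smul]
      intro hinj
      exact hne (hinj (by simp [Ne.symm ha, Ne.symm hb, hab]))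
    rw [← Finset.sum_subset (Finset.subset_univ {a, b})
      (fun s _ hs => by
        simp only [Finset.mem_insert, Finset.mem_singleton, not_or] at hs
        exact h0 s hs.1 hs.2),
      Finset.sum_pair hne, ← Finset.sum_add_distrib]
    refine Finset.sum_eq_zero fun m _ => ?_
    -- As f a = f b, replacing the value at b and replacing it at a differ by the transposition of a
    -- and b, so the two surviving terms cancel.
    have h : Function.update f b m = Function.update f a m ∘ Equiv.swap a b := by
      funext x
      by_cases hxa : x = a
      · subst hxa; simp [hne, Ne.symm hne, hab]
      · by_cases hxb : x = b
        · subst hxb; simp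
        · simp [Equiv.swap_apply_of_ne_of_ne hxa hxb, hxa, hxb]
    rw [h, eps_comp, Equiv.Perm.sign_swap hne, hab]
    simp

/-- The five-slot form of the trace identity. It enters twice: for the Jacobian matrix of a vector
field, whose trace is the divergence, and for a rank one matrix in the odd Jacobi identity. -/
theorem sum_eps_vec {M : Type*} [AddCommGroup M] (A : Fin 5 → Fin 5 → M) (i j k l t : Fin 5) :
    ∑ m, (eps ![m, j, k, l, t] • A m i + eps ![i, m, k, l, t] • A m j +
      eps ![i, j, m, l, t] • A m k + eps ![i, j, k, m, t] • A m l +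
      eps ![i, j, k, l, m] • A m t) = eps ![i, j, k, l, t] • ∑ s, A s s := by
  have h := sum_eps_update A ![i, j, k, l, t]
  rw [Fin.sum_univ_five] at h
  have h0 : ∀ m, Function.update ![i, j, k, l, t] 0 m = ![m, j, k, l, t] := fun m => by
    funext a; fin_cases a <;> rfl
  have h1 : ∀ m, Function.update ![i, j, k, l, t] 1 m = ![i, m, k, l, t] := fun m => by
    funext a; fin_cases a <;> rfl
  have h2 : ∀ m, Function.update ![i, j, k, l, t] 2 m = ![i, j, m, l, t] := fun m => by
    funext a; fin_cases a <;> rfl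
  have h3 : ∀ m, Function.update ![i, j, k, l, t] 3 m = ![i, j, k, m, t] := fun m => by
    funext a; fin_cases a <;> rfl
  have h4 : ∀ m, Function.update ![i, j, k, l, t] 4 m = ![i, j, k, l, m] := fun m => by
    funext a; fin_cases a <;> rfl
  simp only [h0, h1, h2, h3, h4] at h
  simp only [Finset.sum_add_distrib]
  exact h

theorem lieDeriv_vectorBracket (X Y : evenPart) (w : oddPart) :
    lieDeriv (vectorBracket X Y) w = lieDeriv X (lieDeriv Y w) - lieDeriv Y (lieDeriv X w) := by
  ext1
  funext j k
  obtain ⟨X, -⟩ := X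
  obtain ⟨Y, -⟩ := Y
  obtain ⟨w, -⟩ := w
  change lieDerivFun (vectorBracketFun X Y) w j k =
    lieDerivFun X (lieDerivFun Y w) j k - lieDerivFun Y (lieDerivFun X w) j k
  have key : ∀ X Y : Fin 5 → PS, lieDerivFun X (lieDerivFun Y w) j k =
      ∑ i, ∑ m, (X i * pd i (Y m * pd m (w j k) + pd j (Y m) * w m k + pd k (Y m) * w j m)
        + pd j (X i) * (Y m * pd m (w i k) + pd i (Y m) * w m k + pd k (Y m) * w i m)
        + pd k (X i) * (Y m * pd m (w j i) + pd j (Y m) * w m i + pd i (Y m) * w j m)) := by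
    intro X Y
    simp only [lieDerivFun]
    refine Finset.sum_congr rfl fun i _ => ?_
    simp only [map_sum, Finset.mul_sum, ← Finset.sum_add_distrib]
  have key2 : lieDerivFun (vectorBracketFun X Y) w j k =
      ∑ i, ∑ m, (X i * pd i (Y m) * pd m (w j k)
        + pd j (X i * pd i (Y m)) * w m k + pd k (X i * pd i (Y m)) * w j m) -
      ∑ i, ∑ m, (Y i * pd i (X m) * pd m (w j k)
        + pd j (Y i * pd i (X m)) * w m k + pd k (Y i * pd i (X m)) * w j m) := by
    rw [Finset.sum_comm, Finset.sum_comm (f := fun i m => (Y i * pd i (X m) * pd m (w j k)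
        + pd j (Y i * pd i (X m)) * w m k + pd k (Y i * pd i (X m)) * w j m)),
        ← Finset.sum_sub_distrib]
    refine Finset.sum_congr rfl fun i _ => ?_
    simp only [vectorBracketFun, map_sum, Finset.sum_mul, ← Finset.sum_add_distrib,
      ← Finset.sum_sub_distrib, map_sub]
    exact Finset.sum_congr rfl fun m _ => by ring
  -- In the subtracted sums the outer index belongs to Y. Exchanging the order there attaches i to X
  -- and m to Y throughout, and the identity becomes termwise.
  rw [key2, key, key, Finset.sum_comm (f := fun i m => (Y i * pd i (X m) * pd m (w j k)
        + pd j (Y i * pd i (X m)) * w m k + pd k (Y i * pd i (X m)) * w j m)),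
    Finset.sum_comm (f := fun i m =>
      (Y i * pd i (X m * pd m (w j k) + pd j (X m) * w m k + pd k (X m) * w j m)
        + pd j (Y i) * (X m * pd m (w i k) + pd i (X m) * w m k + pd k (X m) * w i m)
        + pd k (Y i) * (X m * pd m (w j i) + pd j (X m) * w m i + pd i (X m) * w j m)))]
  simp only [← Finset.sum_sub_distrib]
  refine Finset.sum_congr rfl fun i _ => Finset.sum_congr rfl fun m _ => ?_
  simp only [map_add, Derivation.leibniz, smul_eq_mul]
  rw [pd_comm j i (Y m), pd_comm k i (Y m), pd_comm j m (X i), pd_comm k m (X i), pd_comm m i (w j k)]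
  ring

theorem sum_fun_five {M : Type*} [AddCommMonoid M] (f : (Fin 5 → Fin 5) → M) :
    ∑ x, f x = ∑ i, ∑ j, ∑ k, ∑ l, ∑ m, f ![i, j, k, l, m] := by
  simp only [← (Fin.consEquiv fun _ => Fin 5).sum_comp, Fintype.sum_prod_type,
    Fintype.sum_unique]
  rfl

/-- Renaming the bound variables of a fivefold sum. -/
theorem sum_rename {M : Type*} [AddCommMonoid M] (σ : Equiv.Perm (Fin 5))
    (f : Fin 5 → Fin 5 → Fin 5 → Fin 5 → Fin 5 → M) :
    ∑ i, ∑ j, ∑ k, ∑ l, ∑ m, f i j k l m = ∑ i, ∑ j, ∑ k, ∑ l, ∑ m,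
      f (![i, j, k, l, m] (σ 0)) (![i, j, k, l, m] (σ 1)) (![i, j, k, l, m] (σ 2))
        (![i, j, k, l, m] (σ 3)) (![i, j, k, l, m] (σ 4)) := by
  have h1 := sum_fun_five fun x => f (x 0) (x 1) (x 2) (x 3) (x 4)
  have h2 := sum_fun_five fun x => f (x (σ 0)) (x (σ 1)) (x (σ 2)) (x (σ 3)) (x (σ 4))
  rw [← h2]
  refine Eq.trans h1.symm ((σ.arrowCongr (Equiv.refl _)).symm.sum_comp _).symm

/-- The bracket of two forms, multiplied by four. -/
def pairSum (w z : Fin 5 → Fin 5 → PS) (t : Fin 5) : PS :=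
  ∑ i, ∑ j, ∑ k, ∑ l, eps ![i, j, k, l, t] • (w i j * z k l)

/-- Terms differentiating w and z match by the Leibniz rule. Those containing a derivative of X form
the action of the Jacobian matrix on the alternating symbol, which is multiplication by the
divergence, hence zero. -/
theorem sum_pairSum_lieDeriv (X : Fin 5 → PS) (hX : ∑ i, pd i (X i) = 0)
    (w z : Fin 5 → Fin 5 → PS) (t : Fin 5) :
    ∑ m, (X m * pd m (pairSum w z t) - pairSum w z m * pd m (X t)) =
      pairSum (lieDerivFun X w) z t + pairSum w (lieDerivFun X z) t := by
  have e1 : ∑ m, X m * pd m (pairSum w z t) = ∑ i, ∑ j, ∑ k, ∑ l, ∑ m,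
      eps ![i, j, k, l, t] • (X m * pd m (w i j) * z k l + w i j * (X m * pd m (z k l))) := by
    rw [sum_rename (finRotate 5)]
    refine Finset.sum_congr rfl fun m _ => ?_
    simp only [pairSum, map_sum, Finset.mul_sum]
    refine Finset.sum_congr rfl fun i _ => Finset.sum_congr rfl fun j _ =>
      Finset.sum_congr rfl fun k _ => Finset.sum_congr rfl fun l _ => ?_
    rw [map_zsmul, mul_smul_comm, Derivation.leibniz]
    change _ = eps ![i, j, k, l, t] • _
    congr 1
    simp only [smul_eq_mul]
    change _ = X m * pd m (w i j) * z k l + w i j * (X m * pd m (z k l))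
    ring
  have e2 : ∑ m, pairSum w z m * pd m (X t) = ∑ i, ∑ j, ∑ k, ∑ l, ∑ m,
      eps ![i, j, k, l, m] • (w i j * z k l * pd m (X t)) := by
    rw [sum_rename (finRotate 5)]
    refine Finset.sum_congr rfl fun m _ => ?_
    simp only [pairSum, Finset.sum_mul, smul_mul_assoc]
    rfl
  have e3 : pairSum (lieDerivFun X w) z t = ∑ i, ∑ j, ∑ k, ∑ l, ∑ m,
        eps ![i, j, k, l, t] • (X m * pd m (w i j) * z k l) +
      ∑ i, ∑ j, ∑ k, ∑ l, ∑ m, eps ![m, j, k, l, t] • (w i j * z k l * pd m (X i)) +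
      ∑ i, ∑ j, ∑ k, ∑ l, ∑ m, eps ![i, m, k, l, t] • (w i j * z k l * pd m (X j)) := by
    rw [sum_rename (Equiv.swap 0 4) fun i j k l m =>
        eps ![m, j, k, l, t] • (w i j * z k l * pd m (X i)),
      sum_rename (Equiv.swap 1 4) fun i j k l m =>
        eps ![i, m, k, l, t] • (w i j * z k l * pd m (X j))]
    simp only [← Finset.sum_add_distrib]
    refine Finset.sum_congr rfl fun i _ => Finset.sum_congr rfl fun j _ =>
      Finset.sum_congr rfl fun k _ => Finset.sum_congr rfl fun l _ => ?_
    rw [lieDerivFun, Finset.sum_mul, Finset.smul_sum]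
    refine Finset.sum_congr rfl fun m _ => ?_
    change _ = eps ![i, j, k, l, t] • _ + eps ![i, j, k, l, t] • (w m j * z k l * pd i (X m)) +
      eps ![i, j, k, l, t] • (w i m * z k l * pd j (X m))
    rw [← smul_add, ← smul_add]
    congr 1
    ring
  have e4 : pairSum w (lieDerivFun X z) t = ∑ i, ∑ j, ∑ k, ∑ l, ∑ m,
        eps ![i, j, k, l, t] • (w i j * (X m * pd m (z k l))) +
      ∑ i, ∑ j, ∑ k, ∑ l, ∑ m, eps ![i, j, m, l, t] • (w i j * z k l * pd m (X k)) +
      ∑ i, ∑ j, ∑ k, ∑ l, ∑ m, eps ![i, j, k, m, t] • (w i j * z k l * pd m (X l)) := by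
    rw [sum_rename (Equiv.swap 2 4) fun i j k l m =>
        eps ![i, j, m, l, t] • (w i j * z k l * pd m (X k)),
      sum_rename (Equiv.swap 3 4) fun i j k l m =>
        eps ![i, j, k, m, t] • (w i j * z k l * pd m (X l))]
    simp only [← Finset.sum_add_distrib]
    refine Finset.sum_congr rfl fun i _ => Finset.sum_congr rfl fun j _ =>
      Finset.sum_congr rfl fun k _ => Finset.sum_congr rfl fun l _ => ?_
    rw [lieDerivFun, Finset.mul_sum, Finset.smul_sum]
    refine Finset.sum_congr rfl fun m _ => ?_
    change _ = eps ![i, j, k, l, t] • _ + eps ![i, j, k, l, t] • (w i j * z m l * pd k (X m)) +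
      eps ![i, j, k, l, t] • (w i j * z k m * pd l (X m))
    rw [← smul_add, ← smul_add]
    congr 1
    ring
  have e5 : ∑ i, ∑ j, ∑ k, ∑ l, ∑ m, (eps ![m, j, k, l, t] • (w i j * z k l * pd m (X i)) +
      eps ![i, m, k, l, t] • (w i j * z k l * pd m (X j)) +
      eps ![i, j, m, l, t] • (w i j * z k l * pd m (X k)) +
      eps ![i, j, k, m, t] • (w i j * z k l * pd m (X l)) +
      eps ![i, j, k, l, m] • (w i j * z k l * pd m (X t))) = 0 := by
    refine Finset.sum_eq_zero fun i _ => Finset.sum_eq_zero fun j _ =>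
      Finset.sum_eq_zero fun k _ => Finset.sum_eq_zero fun l _ => ?_
    rw [sum_eps_vec fun m q => w i j * z k l * pd m (X q), ← Finset.mul_sum, hX, mul_zero,
      smul_zero]
  rw [Finset.sum_sub_distrib, e1, e2, e3, e4]
  simp only [smul_add, Finset.sum_add_distrib] at e5 ⊢
  rw [eq_neg_of_add_eq_zero_right e5]
  abel

theorem formBracket_val (w z : oddPart) (t : Fin 5) :
    (formBracket w z).1 t = (1 / 4 : ℂ) • pairSum w.1 z.1 t := rfl

theorem vectorBracket_formBracket (X : evenPart) (w z : oddPart) :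
    vectorBracket X (formBracket w z) =
      formBracket (lieDeriv X w) z + formBracket w (lieDeriv X z) := by
  ext1
  funext t
  change ∑ i, (X.1 i * pd i ((1 / 4 : ℂ) • pairSum w.1 z.1 t) -
    ((1 / 4 : ℂ) • pairSum w.1 z.1 i) * pd i (X.1 t)) =
    (1 / 4 : ℂ) • pairSum (lieDerivFun X.1 w.1) z.1 t +
      (1 / 4 : ℂ) • pairSum w.1 (lieDerivFun X.1 z.1) t
  rw [← smul_add, ← sum_pairSum_lieDeriv X.1 X.2 w.1 z.1 t, Finset.smul_sum]
  refine Finset.sum_congr rfl fun i _ => ?_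
  rw [Derivation.map_smul, mul_smul_comm, smul_mul_assoc, smul_sub]

/-- The contraction of a vector field with a two-form. -/
def contract (X : Fin 5 → PS) (w : Fin 5 → Fin 5 → PS) (m : Fin 5) : PS := ∑ t, X t * w t m

/-- Cartan's formula L_X = dι_X + ι_X d, in which the second term drops out for closed w. -/
theorem lieDeriv_eq_contract (X : evenPart) (w : oddPart) (j k : Fin 5) :
    (lieDeriv X w).1 j k = pd j (contract X.1 w.1 k) - pd k (contract X.1 w.1 j) := by
  obtain ⟨w, hw, hw'⟩ := w
  change lieDerivFun X.1 w j k = _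
  simp only [lieDerivFun, contract, map_sum, ← Finset.sum_sub_distrib]
  refine Finset.sum_congr rfl fun i _ => ?_
  simp only [Derivation.leibniz, smul_eq_mul]
  have h := hw' i j k
  rw [hw i k, hw i j, map_neg] at *
  rw [hw j i] at *
  simp only [map_neg] at *
  linear_combination X.1 i * h

theorem eps_swap_first (i j k l t : Fin 5) : eps ![j, i, k, l, t] = -eps ![i, j, k, l, t] := by
  have h := eps_comp ![i, j, k, l, t] (Equiv.swap 0 1)
  rw [Equiv.Perm.sign_swap (by decide)] at h
  rw [← neg_one_mul, show (-1 : ℤ) = ((-1 : ℤˣ) : ℤ) from rfl, ← h]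
  congr 1
  funext a
  fin_cases a <;> rfl

theorem pairSum_comm (w z : Fin 5 → Fin 5 → PS) : pairSum w z = pairSum z w := by
  funext t
  rw [pairSum, sum_swap_pairs, pairSum]
  simp only [mul_comm (w _ _), fun i j k l => eps_swap_pairs i j k l t]

/-- Evaluates one of the five terms produced by `sum_eps_vec` for the matrix y_{tp} v_q, namely the
one replacing the first index of w. The other replacements of an index of w or z reduce to it by
symmetry. -/
theorem sum_contract_eps (w z y : Fin 5 → Fin 5 → PS) (hw : ∀ i j, w j i = -w i j)
    (v : Fin 5 → PS) :
    ∑ i, ∑ j, ∑ k, ∑ l, ∑ t, ∑ p, eps ![p, j, k, l, t] • (w i j * z k l * y t p * v i) =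
      -∑ m, contract (pairSum y z) w m * v m := by
  rw [← Finset.sum_neg_distrib]
  refine Finset.sum_congr rfl fun i _ => ?_
  have h : contract (pairSum y z) w i * v i = ∑ t, ∑ p, ∑ k, ∑ l, ∑ j,
      eps ![t, p, k, l, j] • (y t p * z k l * w j i * v i) := by
    rw [sum_rename (finRotate 5)]
    simp only [contract, pairSum, Finset.sum_mul, smul_mul_assoc]
    rfl
  rw [h, sum_rename ⟨![3, 4, 1, 2, 0], ![4, 2, 3, 0, 1], by decide, by decide⟩ fun t p k l j =>
    eps ![t, p, k, l, j] • (y t p * z k l * w j i * v i)]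
  simp only [← Finset.sum_neg_distrib]
  refine Finset.sum_congr rfl fun j _ => Finset.sum_congr rfl fun k _ =>
    Finset.sum_congr rfl fun l _ => Finset.sum_congr rfl fun t _ =>
    Finset.sum_congr rfl fun p _ => ?_
  change _ = -(eps ![t, p, k, l, j] • (y t p * z k l * w j i * v i))
  rw [← eps_cycle_left t p k l j, hw i j, ← smul_neg]
  congr 1
  ring

/-- The cyclic sum of the contractions `ι_{[w,z]} y` vanishes. -/
theorem sum_contract_cyclic (w z y : oddPart) (m : Fin 5) :
    contract (pairSum w.1 z.1) y.1 m + contract (pairSum z.1 y.1) w.1 m +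
      contract (pairSum y.1 w.1) z.1 m = 0 := by
  obtain ⟨w, hw, -⟩ := w
  obtain ⟨z, hz, -⟩ := z
  obtain ⟨y, hy, -⟩ := y
  change contract (pairSum w z) y m + contract (pairSum z y) w m + contract (pairSum y w) z m = 0
  -- Pairing with the m-th unit vector extracts the m-th component at the end.
  set v : Fin 5 → PS := Pi.single m 1 with hv
  have t1 := sum_contract_eps w z y hw v
  have t3' := sum_contract_eps z w y hz v
  have t2 : ∑ i, ∑ j, ∑ k, ∑ l, ∑ t, ∑ p, eps ![i, p, k, l, t] • (w i j * z k l * y t p * v j) =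
      -∑ m, contract (pairSum y z) w m * v m := by
    rw [← t1, Finset.sum_comm]
    refine Finset.sum_congr rfl fun j _ => Finset.sum_congr rfl fun i _ =>
      Finset.sum_congr rfl fun k _ => Finset.sum_congr rfl fun l _ =>
      Finset.sum_congr rfl fun t _ => Finset.sum_congr rfl fun p _ => ?_
    rw [eps_swap_first p i k l t, hw j i, neg_smul, ← smul_neg]
    congr 1
    ring
  have t3 : ∑ i, ∑ j, ∑ k, ∑ l, ∑ t, ∑ p, eps ![i, j, p, l, t] • (w i j * z k l * y t p * v k) =
      -∑ m, contract (pairSum y w) z m * v m := by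
    rw [← t3', sum_rename ⟨![2, 3, 0, 1, 4], ![2, 3, 0, 1, 4], by decide, by decide⟩]
    refine Finset.sum_congr rfl fun i _ => Finset.sum_congr rfl fun j _ =>
      Finset.sum_congr rfl fun k _ => Finset.sum_congr rfl fun l _ =>
      Finset.sum_congr rfl fun t _ => Finset.sum_congr rfl fun p _ => ?_
    change eps ![k, l, p, j, t] • (w k l * z i j * y t p * v i) = _
    rw [eps_swap_pairs p j k l t]
    congr 1
    ring
  have t4 : ∑ i, ∑ j, ∑ k, ∑ l, ∑ t, ∑ p, eps ![i, j, k, p, t] • (w i j * z k l * y t p * v l) =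
      -∑ m, contract (pairSum y w) z m * v m := by
    rw [← t3', sum_rename ⟨![2, 3, 1, 0, 4], ![3, 2, 0, 1, 4], by decide, by decide⟩]
    refine Finset.sum_congr rfl fun i _ => Finset.sum_congr rfl fun j _ =>
      Finset.sum_congr rfl fun k _ => Finset.sum_congr rfl fun l _ =>
      Finset.sum_congr rfl fun t _ => Finset.sum_congr rfl fun p _ => ?_
    change eps ![k, l, j, p, t] • (w k l * z j i * y t p * v i) = _
    rw [eps_swap_pairs j p k l t, eps_swap_first p j k l t, hz i j, neg_smul, ← smul_neg]
    congr 1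
    ring
  have t5 : ∑ i, ∑ j, ∑ k, ∑ l, ∑ t, ∑ p, eps ![i, j, k, l, p] • (w i j * z k l * y t p * v t) =
      -∑ m, contract (pairSum w z) y m * v m := by
    rw [sum_rename (finRotate 5), ← Finset.sum_neg_distrib]
    refine Finset.sum_congr rfl fun t _ => ?_
    have h : contract (pairSum w z) y t * v t = ∑ i, ∑ j, ∑ k, ∑ l, ∑ p,
        eps ![i, j, k, l, p] • (w i j * z k l * y p t * v t) := by
      rw [sum_rename (finRotate 5)]
      simp only [contract, pairSum, Finset.sum_mul, smul_mul_assoc]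
      rfl
    rw [h]
    simp only [← Finset.sum_neg_distrib]
    refine Finset.sum_congr rfl fun i _ => Finset.sum_congr rfl fun j _ =>
      Finset.sum_congr rfl fun k _ => Finset.sum_congr rfl fun l _ =>
      Finset.sum_congr rfl fun p _ => ?_
    change eps ![i, j, k, l, p] • (w i j * z k l * y t p * v t) = _
    rw [hy p t, ← smul_neg]
    congr 1
    ring
  have t6 : ∑ i, ∑ j, ∑ k, ∑ l, ∑ t, eps ![i, j, k, l, t] •
      ∑ s, (w i j * z k l * y t s * v s) = ∑ m, contract (pairSum w z) y m * v m := by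
    have h : ∀ m, contract (pairSum w z) y m * v m = ∑ i, ∑ j, ∑ k, ∑ l, ∑ p,
        eps ![i, j, k, l, p] • (w i j * z k l * y p m * v m) := by
      intro m
      rw [sum_rename (finRotate 5)]
      simp only [contract, pairSum, Finset.sum_mul, smul_mul_assoc]
      rfl
    have h' := sum_rename (finRotate 5) fun i j k l t => eps ![i, j, k, l, t] •
      ∑ s, (w i j * z k l * y t s * v s)
    simp only [h, Finset.smul_sum]
    simp only [fun i j k l => Finset.sum_comm (s := Finset.univ (α := Fin 5))
      (t := Finset.univ (α := Fin 5))
      (f := fun t s => eps ![i, j, k, l, t] • (w i j * z k l * y t s * v s))]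
    rw [sum_rename (finRotate 5)]
    rfl
  -- The trace identity for the matrix y_{tp} v_q. Its left side is -2, -2 and -1 times the three
  -- contractions ι_{[y,z]} w, ι_{[y,w]} z and ι_{[w,z]} y (each bracket scaled by 4). The trace
  -- term on the right is +1 times the last one. Hence twice the cyclic sum is zero.
  have hs : ∑ i, ∑ j, ∑ k, ∑ l, ∑ t, (∑ p, (eps ![p, j, k, l, t] • (w i j * z k l * y t p * v i) +
      eps ![i, p, k, l, t] • (w i j * z k l * y t p * v j) +
      eps ![i, j, p, l, t] • (w i j * z k l * y t p * v k) +
      eps ![i, j, k, p, t] • (w i j * z k l * y t p * v l) +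
      eps ![i, j, k, l, p] • (w i j * z k l * y t p * v t))) =
      ∑ i, ∑ j, ∑ k, ∑ l, ∑ t, eps ![i, j, k, l, t] • ∑ s, (w i j * z k l * y t s * v s) := by
    refine Finset.sum_congr rfl fun i _ => Finset.sum_congr rfl fun j _ =>
      Finset.sum_congr rfl fun k _ => Finset.sum_congr rfl fun l _ =>
      Finset.sum_congr rfl fun t _ => ?_
    exact sum_eps_vec (fun p q => w i j * z k l * y t p * v q) i j k l t
  simp only [Finset.sum_add_distrib] at hs
  rw [t1, t2, t3, t4, t5, t6] at hs
  have hv' : ∀ f : Fin 5 → PS, ∑ m, f m * v m = f m := by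
    intro f
    rw [Finset.sum_eq_single m]
    · simp [hv]
    · intro b _ hb; simp [hv, hb]
    · simp
  simp only [hv'] at hs
  rw [pairSum_comm y z] at hs
  have h2 : (2 : ℂ) • (contract (pairSum w z) y m + contract (pairSum z y) w m +
      contract (pairSum y w) z m) = 0 := by
    rw [two_smul]
    linear_combination -hs
  exact (smul_eq_zero.mp h2).resolve_left two_ne_zero

/-- By Cartan's formula each term is the differential of a contraction, so this Jacobi identity for
three odd elements follows from the vanishing of the cyclic sum of contractions. -/
theorem lieDeriv_formBracket (w z y : oddPart) :
    lieDeriv (formBracket w z) y + lieDeriv (formBracket z y) w +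
      lieDeriv (formBracket y w) z = 0 := by
  ext1
  funext j k
  change (lieDeriv (formBracket w z) y).1 j k + (lieDeriv (formBracket z y) w).1 j k +
      (lieDeriv (formBracket y w) z).1 j k = 0
  have h : ∀ (w z y : oddPart) (m : Fin 5), contract (formBracket w z).1 y.1 m =
      (1 / 4 : ℂ) • contract (pairSum w.1 z.1) y.1 m := by
    intro w z y m
    simp only [contract, formBracket_val, Finset.smul_sum, smul_mul_assoc]
  simp only [lieDeriv_eq_contract, h, Derivation.map_smul, ← smul_sub, ← smul_add]
  have e := fun m => sum_contract_cyclic w z y m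
  have e1 := congrArg (pd j) (e k)
  have e2 := congrArg (pd k) (e j)
  simp only [map_add, map_zero] at e1 e2
  rw [show ∀ a b c a' b' c' : PS, a - a' + (b - b') + (c - c') = (a + b + c) - (a' + b' + c') from
    fun _ _ _ _ _ _ => by ring, e1, e2, sub_zero, smul_zero]

theorem formBracket_comm (w z : oddPart) : formBracket w z = formBracket z w := by
  ext1
  funext t
  rw [formBracket_val, formBracket_val, pairSum_comm]

theorem vectorBracket_skew (X Y : evenPart) : vectorBracket X Y = -vectorBracket Y X := by
  ext1
  funext t
  change ∑ i, (X.1 i * pd i (Y.1 t) - Y.1 i * pd i (X.1 t)) =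
    -∑ i, (Y.1 i * pd i (X.1 t) - X.1 i * pd i (Y.1 t))
  rw [← Finset.sum_neg_distrib]
  exact Finset.sum_congr rfl fun i _ => by ring

/-! ### The brackets as bilinear maps -/

def vectorBracketₗ : evenPart →ₗ[ℂ] evenPart →ₗ[ℂ] evenPart :=
  LinearMap.mk₂ ℂ vectorBracket
    (fun X X' Y => by
      ext1; funext j
      change ∑ i, ((X.1 i + X'.1 i) * pd i (Y.1 j) - Y.1 i * pd i (X.1 j + X'.1 j)) =
        ∑ i, (X.1 i * pd i (Y.1 j) - Y.1 i * pd i (X.1 j)) +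
        ∑ i, (X'.1 i * pd i (Y.1 j) - Y.1 i * pd i (X'.1 j))
      rw [← Finset.sum_add_distrib]
      exact Finset.sum_congr rfl fun i _ => by rw [map_add]; ring)
    (fun c X Y => by
      ext1; funext j
      change ∑ i, ((c • X.1 i) * pd i (Y.1 j) - Y.1 i * pd i (c • X.1 j)) =
        c • ∑ i, (X.1 i * pd i (Y.1 j) - Y.1 i * pd i (X.1 j))
      rw [Finset.smul_sum]
      exact Finset.sum_congr rfl fun i _ => by
        rw [Derivation.map_smul, mul_smul_comm, smul_mul_assoc, smul_sub])
    (fun X Y Y' => by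
      ext1; funext j
      change ∑ i, (X.1 i * pd i (Y.1 j + Y'.1 j) - (Y.1 i + Y'.1 i) * pd i (X.1 j)) =
        ∑ i, (X.1 i * pd i (Y.1 j) - Y.1 i * pd i (X.1 j)) +
        ∑ i, (X.1 i * pd i (Y'.1 j) - Y'.1 i * pd i (X.1 j))
      rw [← Finset.sum_add_distrib]
      exact Finset.sum_congr rfl fun i _ => by rw [map_add]; ring)
    (fun c X Y => by
      ext1; funext j
      change ∑ i, (X.1 i * pd i (c • Y.1 j) - (c • Y.1 i) * pd i (X.1 j)) =
        c • ∑ i, (X.1 i * pd i (Y.1 j) - Y.1 i * pd i (X.1 j))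
      rw [Finset.smul_sum]
      exact Finset.sum_congr rfl fun i _ => by
        rw [Derivation.map_smul, mul_smul_comm, smul_mul_assoc, smul_sub])

def lieDerivₗ : evenPart →ₗ[ℂ] oddPart →ₗ[ℂ] oddPart :=
  LinearMap.mk₂ ℂ lieDeriv
    (fun X X' w => by
      ext1; funext j k
      change ∑ i, ((X.1 i + X'.1 i) * pd i (w.1 j k) + pd j (X.1 i + X'.1 i) * w.1 i k +
          pd k (X.1 i + X'.1 i) * w.1 j i) =
        ∑ i, (X.1 i * pd i (w.1 j k) + pd j (X.1 i) * w.1 i k + pd k (X.1 i) * w.1 j i) +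
        ∑ i, (X'.1 i * pd i (w.1 j k) + pd j (X'.1 i) * w.1 i k + pd k (X'.1 i) * w.1 j i)
      rw [← Finset.sum_add_distrib]
      exact Finset.sum_congr rfl fun i _ => by simp only [map_add]; ring)
    (fun c X w => by
      ext1; funext j k
      change ∑ i, ((c • X.1 i) * pd i (w.1 j k) + pd j (c • X.1 i) * w.1 i k +
          pd k (c • X.1 i) * w.1 j i) =
        c • ∑ i, (X.1 i * pd i (w.1 j k) + pd j (X.1 i) * w.1 i k + pd k (X.1 i) * w.1 j i)
      rw [Finset.smul_sum]
      exact Finset.sum_congr rfl fun i _ => by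
        simp only [Derivation.map_smul, smul_mul_assoc, smul_add])
    (fun X w w' => by
      ext1; funext j k
      change ∑ i, (X.1 i * pd i (w.1 j k + w'.1 j k) + pd j (X.1 i) * (w.1 i k + w'.1 i k) +
          pd k (X.1 i) * (w.1 j i + w'.1 j i)) =
        ∑ i, (X.1 i * pd i (w.1 j k) + pd j (X.1 i) * w.1 i k + pd k (X.1 i) * w.1 j i) +
        ∑ i, (X.1 i * pd i (w'.1 j k) + pd j (X.1 i) * w'.1 i k + pd k (X.1 i) * w'.1 j i)
      rw [← Finset.sum_add_distrib]
      exact Finset.sum_congr rfl fun i _ => by simp only [map_add]; ring)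
    (fun c X w => by
      ext1; funext j k
      change ∑ i, (X.1 i * pd i (c • w.1 j k) + pd j (X.1 i) * (c • w.1 i k) +
          pd k (X.1 i) * (c • w.1 j i)) =
        c • ∑ i, (X.1 i * pd i (w.1 j k) + pd j (X.1 i) * w.1 i k + pd k (X.1 i) * w.1 j i)
      rw [Finset.smul_sum]
      exact Finset.sum_congr rfl fun i _ => by
        simp only [Derivation.map_smul, mul_smul_comm, smul_add])

theorem pairSum_add_left (w w' z : Fin 5 → Fin 5 → PS) (t : Fin 5) :
    pairSum (w + w') z t = pairSum w z t + pairSum w' z t := by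
  simp only [pairSum, Pi.add_apply, add_mul, smul_add, Finset.sum_add_distrib]

theorem pairSum_smul_left (c : ℂ) (w z : Fin 5 → Fin 5 → PS) (t : Fin 5) :
    pairSum (c • w) z t = c • pairSum w z t := by
  simp only [pairSum, Pi.smul_apply, smul_mul_assoc, Finset.smul_sum, smul_comm c]

theorem formBracket_add_left (w w' z : oddPart) :
    formBracket (w + w') z = formBracket w z + formBracket w' z := by
  ext1; funext t
  change (1 / 4 : ℂ) • pairSum (w.1 + w'.1) z.1 t =
    (1 / 4 : ℂ) • pairSum w.1 z.1 t + (1 / 4 : ℂ) • pairSum w'.1 z.1 t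
  rw [pairSum_add_left, smul_add]

theorem formBracket_smul_left (c : ℂ) (w z : oddPart) :
    formBracket (c • w) z = c • formBracket w z := by
  ext1; funext t
  change (1 / 4 : ℂ) • pairSum (c • w.1) z.1 t = c • (1 / 4 : ℂ) • pairSum w.1 z.1 t
  rw [pairSum_smul_left, smul_comm]

def formBracketₗ : oddPart →ₗ[ℂ] oddPart →ₗ[ℂ] evenPart :=
  LinearMap.mk₂ ℂ formBracket formBracket_add_left formBracket_smul_left
    (fun w z z' => by
      rw [formBracket_comm, formBracket_add_left, formBracket_comm z, formBracket_comm z'])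
    (fun c w z => by rw [formBracket_comm, formBracket_smul_left, formBracket_comm z])

@[simp] theorem vectorBracketₗ_apply (X Y : evenPart) :
    vectorBracketₗ X Y = vectorBracket X Y := rfl

@[simp] theorem lieDerivₗ_apply (X : evenPart) (w : oddPart) : lieDerivₗ X w = lieDeriv X w := rfl

@[simp] theorem formBracketₗ_apply (w z : oddPart) : formBracketₗ w z = formBracket w z := rfl

/-! ### Brackets with constant elements -/

/-- The constant two-form `d_p`. -/
abbrev cform (p : Fin 5 × Fin 5) : oddPart := constForm p.1 p.2

theorem partialField_val (t i : Fin 5) :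
    (partialField t).1 i = MvPowerSeries.C (if i = t then 1 else 0) := by
  change (Pi.single t 1 : Fin 5 → PS) i = _
  by_cases h : i = t
  · subst h; simp
  · simp [h]

theorem constForm_val (i j a b : Fin 5) : (constForm i j).1 a b = MvPowerSeries.C
    ((if a = i ∧ b = j then 1 else 0) - (if a = j ∧ b = i then 1 else 0) : ℂ) := rfl

theorem cform_swap (p : Fin 5 × Fin 5) : cform p.swap = -cform p := by
  ext1; funext a b
  change _ = -(constForm p.1 p.2).1 a b
  rw [constForm_val, constForm_val, ← map_neg]
  simp

theorem lieDeriv_partialField_val (t : Fin 5) (w : oddPart) (i j : Fin 5) :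
    (lieDeriv (partialField t) w).1 i j = pd t (w.1 i j) := by
  change ∑ m, ((partialField t).1 m * pd m (w.1 i j) + pd i ((partialField t).1 m) * w.1 m j +
    pd j ((partialField t).1 m) * w.1 i m) = _
  simp only [partialField_val, MvPowerSeries.pderiv_C, zero_mul, add_zero]
  rw [Finset.sum_eq_single t]
  · simp
  · intro b _ hb; simp [hb]
  · simp

theorem vectorBracket_partialField_val (X : evenPart) (t i : Fin 5) :
    (vectorBracket X (partialField t)).1 i = -pd t (X.1 i) := by
  change ∑ m, (X.1 m * pd m ((partialField t).1 i) - (partialField t).1 m * pd m (X.1 i)) = _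
  simp only [partialField_val, MvPowerSeries.pderiv_C, mul_zero, zero_sub]
  rw [Finset.sum_eq_single t]
  · simp
  · intro b _ hb; simp [hb]
  · simp

theorem lieDeriv_partialField_cform (t : Fin 5) (p : Fin 5 × Fin 5) :
    lieDeriv (partialField t) (cform p) = 0 := by
  ext1; funext i j
  rw [lieDeriv_partialField_val, constForm_val, MvPowerSeries.pderiv_C]
  rfl

theorem eps_swap_second (i j k l t : Fin 5) : eps ![i, j, l, k, t] = -eps ![i, j, k, l, t] := by
  rw [eps_swap_pairs l k i j t, eps_swap_first k l i j t, eps_swap_pairs i j k l t]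

theorem sum_cform_mul (r : Fin 5 × Fin 5) (g : Fin 5 → Fin 5 → PS) :
    ∑ i, ∑ j, (cform r).1 i j * g i j = g r.1 r.2 - g r.2 r.1 := by
  simp only [constForm_val, map_sub, sub_mul, Finset.sum_sub_distrib, ite_and]
  congr 1
  · rw [Finset.sum_eq_single r.1, Finset.sum_eq_single r.2] <;> simp +contextual
  · rw [Finset.sum_eq_single r.2, Finset.sum_eq_single r.1] <;> simp +contextual

theorem pairSum_cform (z : Fin 5 → Fin 5 → PS) (q : Fin 5 × Fin 5) (t : Fin 5) :
    pairSum z (cform q).1 t = (2 : ℂ) • ∑ i, ∑ j, eps ![i, j, q.1, q.2, t] • z i j := by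
  have h : pairSum z (cform q).1 t = ∑ i, ∑ j, ∑ k, ∑ l,
      (cform q).1 k l * (eps ![i, j, k, l, t] • z i j) := by
    refine Finset.sum_congr rfl fun i _ => Finset.sum_congr rfl fun j _ =>
      Finset.sum_congr rfl fun k _ => Finset.sum_congr rfl fun l _ => ?_
    rw [mul_smul_comm, mul_comm]
  rw [h, Finset.smul_sum]
  refine Finset.sum_congr rfl fun i _ => ?_
  rw [Finset.smul_sum]
  refine Finset.sum_congr rfl fun j _ => ?_
  rw [sum_cform_mul, eps_swap_second i j q.1 q.2 t]
  module

theorem formBracket_cform (p q : Fin 5 × Fin 5) : formBracket (cform p) (cform q) =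
    ∑ t, eps ![p.1, p.2, q.1, q.2, t] • partialField t := by
  ext1; funext s
  rw [formBracket_val]
  have h : (∑ t, eps ![p.1, p.2, q.1, q.2, t] • partialField t : evenPart).1 s =
      eps ![p.1, p.2, q.1, q.2, s] • (1 : PS) := by
    rw [Submodule.coe_sum, Finset.sum_apply, Finset.sum_eq_single s]
    · change eps _ • (partialField s).1 s = _
      rw [partialField_val]; simp
    · intro b _ hb
      change eps _ • (partialField b).1 s = _
      rw [partialField_val]; simp [Ne.symm hb]
    · simp
  have h2 : pairSum (cform p).1 (cform q).1 s =
      (4 : ℂ) • (eps ![p.1, p.2, q.1, q.2, s] • (1 : PS)) := by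
    rw [pairSum_cform]
    rw [show ∀ g : Fin 5 → Fin 5 → ℤ, ∑ i, ∑ j, g i j • (cform p).1 i j =
      ∑ i, ∑ j, (cform p).1 i j * (g i j • (1 : PS)) from fun g => by
        simp only [mul_smul_comm, mul_one], sum_cform_mul,
      eps_swap_first p.1 p.2 q.1 q.2 s]
    module
  rw [h, h2, smul_smul]
  norm_num

/-! ### The algebra `U(L₋)` by generators and relations -/

/-- The defining relations of `U(L₋)` between the generators `d_p` and `∂_t`. -/
inductive NegRel : FreeAlgebra ℂ ((Fin 5 × Fin 5) ⊕ Fin 5) →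
    FreeAlgebra ℂ ((Fin 5 × Fin 5) ⊕ Fin 5) → Prop
  | swap (p : Fin 5 × Fin 5) :
      NegRel (FreeAlgebra.ι ℂ (Sum.inl p.swap)) (-FreeAlgebra.ι ℂ (Sum.inl p))
  | odd_odd (p q : Fin 5 × Fin 5) :
      NegRel (FreeAlgebra.ι ℂ (Sum.inl p) * FreeAlgebra.ι ℂ (Sum.inl q) +
          FreeAlgebra.ι ℂ (Sum.inl q) * FreeAlgebra.ι ℂ (Sum.inl p))
        (∑ t, eps ![p.1, p.2, q.1, q.2, t] • FreeAlgebra.ι ℂ (Sum.inr t))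
  | even_odd (t : Fin 5) (p : Fin 5 × Fin 5) :
      NegRel (FreeAlgebra.ι ℂ (Sum.inr t) * FreeAlgebra.ι ℂ (Sum.inl p))
        (FreeAlgebra.ι ℂ (Sum.inl p) * FreeAlgebra.ι ℂ (Sum.inr t))
  | even_even (s t : Fin 5) :
      NegRel (FreeAlgebra.ι ℂ (Sum.inr s) * FreeAlgebra.ι ℂ (Sum.inr t))
        (FreeAlgebra.ι ℂ (Sum.inr t) * FreeAlgebra.ι ℂ (Sum.inr s))

/-- The enveloping algebra of `L₋`, by generators and relations. -/
def Neg := RingQuot NegRel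

instance : Ring Neg := inferInstanceAs (Ring (RingQuot NegRel))

instance : Algebra ℂ Neg := inferInstanceAs (Algebra ℂ (RingQuot NegRel))

namespace Neg

def mk : FreeAlgebra ℂ ((Fin 5 × Fin 5) ⊕ Fin 5) →ₐ[ℂ] Neg := RingQuot.mkAlgHom ℂ NegRel

def d (p : Fin 5 × Fin 5) : Neg := mk (FreeAlgebra.ι ℂ (Sum.inl p))

def del (t : Fin 5) : Neg := mk (FreeAlgebra.ι ℂ (Sum.inr t))

theorem mk_rel {x y} (h : NegRel x y) : mk x = mk y := RingQuot.mkAlgHom_rel ℂ h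

theorem d_swap (p : Fin 5 × Fin 5) : d p.swap = -d p := by
  have h := mk_rel (NegRel.swap p)
  rwa [map_neg] at h

theorem d_mul_d (p q : Fin 5 × Fin 5) :
    d p * d q + d q * d p = ∑ t, eps ![p.1, p.2, q.1, q.2, t] • del t := by
  have h := mk_rel (NegRel.odd_odd p q)
  simp only [map_add, map_mul, map_sum, map_zsmul] at h
  exact h

theorem del_mul_d (t : Fin 5) (p : Fin 5 × Fin 5) : del t * d p = d p * del t := by
  have h := mk_rel (NegRel.even_odd t p)
  rwa [map_mul, map_mul] at h

theorem del_mul_del (s t : Fin 5) : del s * del t = del t * del s := by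
  have h := mk_rel (NegRel.even_even s t)
  rwa [map_mul, map_mul] at h

variable {B : Type*} [Ring B] [Algebra ℂ B]

/-- The universal property. -/
def lift (x : Fin 5 × Fin 5 → B) (y : Fin 5 → B) (h1 : ∀ p, x p.swap = -x p)
    (h2 : ∀ p q, x p * x q + x q * x p = ∑ t, eps ![p.1, p.2, q.1, q.2, t] • y t)
    (h3 : ∀ t p, y t * x p = x p * y t) (h4 : ∀ s t, y s * y t = y t * y s) : Neg →ₐ[ℂ] B :=
  RingQuot.liftAlgHom ℂ ⟨FreeAlgebra.lift ℂ (Sum.elim x y), by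
    rintro _ _ (p | ⟨p, q⟩ | ⟨t, p⟩ | ⟨s, t⟩)
    · simpa using h1 p
    · simpa only [map_add, map_mul, map_sum, map_zsmul, FreeAlgebra.lift_ι_apply,
        Sum.elim_inl, Sum.elim_inr] using h2 p q
    · simpa using h3 t p
    · simpa using h4 s t⟩

section Lift
variable (x : Fin 5 × Fin 5 → B) (y : Fin 5 → B) (h1 : ∀ p, x p.swap = -x p)
    (h2 : ∀ p q, x p * x q + x q * x p = ∑ t, eps ![p.1, p.2, q.1, q.2, t] • y t)
    (h3 : ∀ t p, y t * x p = x p * y t) (h4 : ∀ s t, y s * y t = y t * y s)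

theorem lift_mk (a) : lift x y h1 h2 h3 h4 (mk a) = FreeAlgebra.lift ℂ (Sum.elim x y) a :=
  RingQuot.liftAlgHom_mkAlgHom_apply ℂ _ _ _

@[simp] theorem lift_d (p : Fin 5 × Fin 5) : lift x y h1 h2 h3 h4 (d p) = x p := by
  rw [d, lift_mk]; simp

@[simp] theorem lift_del (t : Fin 5) : lift x y h1 h2 h3 h4 (del t) = y t := by
  rw [del, lift_mk]; simp

end Lift

/-- The sequence t+1, …, t+4, t is a rotation of ℤ/5, which is an even permutation. The
anticommutator of d_{t+1,t+2} and d_{t+3,t+4} is therefore exactly ∂_t. -/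
theorem eps_cyclic (t s : Fin 5) : eps ![t + 1, t + 2, t + 3, t + 4, s] =
    if s = t then 1 else 0 := by
  by_cases h : s = t
  · subst h
    have e : ![s + 1, s + 2, s + 3, s + 4, s] = (Equiv.addRight (s + 1) : Equiv.Perm (Fin 5)) := by
      funext a; revert a s; decide
    have hs : Equiv.Perm.sign (Equiv.addRight (s + 1) : Equiv.Perm (Fin 5)) = 1 := by
      revert s; decide
    rw [e, eps_perm, hs]; simp
  · rw [eps_of_not_injective, if_neg h]
    intro hinj
    have : ∃ a : Fin 5, a ≠ 4 ∧ ![t + 1, t + 2, t + 3, t + 4, s] a = s := by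
      revert t s; decide
    obtain ⟨a, ha, hs⟩ := this
    exact ha (hinj hs)

/-- The ∂_t are redundant as generators, so homomorphisms are determined by the d_p and inductions
need only treat left multiplication by d_p. -/
theorem del_eq (t : Fin 5) : del t =
    d (t + 1, t + 2) * d (t + 3, t + 4) + d (t + 3, t + 4) * d (t + 1, t + 2) := by
  rw [d_mul_d]
  simp [eps_cyclic]

@[ext] theorem hom_ext {f g : Neg →ₐ[ℂ] B} (h : ∀ p, f (d p) = g (d p)) : f = g := by
  have h' : ∀ t, f (del t) = g (del t) := fun t => by simp only [del_eq, map_add, map_mul, h]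
  refine RingQuot.ringQuot_ext' ℂ _ _ (FreeAlgebra.hom_ext ?_)
  funext a
  rcases a with p | t
  · exact h p
  · exact h' t

/-- The algebra is generated by the `d_p`. -/
theorem induction {P : Neg → Prop} (one : P 1) (add : ∀ a b, P a → P b → P (a + b))
    (smul : ∀ (c : ℂ) a, P a → P (c • a)) (d_mul : ∀ p a, P a → P (d p * a)) (a : Neg) : P a := by
  let S : Submodule ℂ Neg :=
    { carrier := {a | P a}
      add_mem' := fun {a b} => add a b
      zero_mem' := by simpa using smul 0 1 one
      smul_mem' := smul }
  -- The elements whose left multiplication preserves S form a subalgebra containing all generators.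
  -- The universal property yields a map into it which is a section of the inclusion, so it is
  -- everything.
  let A : Subalgebra ℂ Neg :=
    { carrier := {a | ∀ b ∈ S, a * b ∈ S}
      mul_mem' := fun {a b} ha hb x hx => by rw [mul_assoc]; exact ha _ (hb _ hx)
      add_mem' := fun {a b} ha hb x hx => by rw [add_mul]; exact S.add_mem (ha _ hx) (hb _ hx)
      algebraMap_mem' := fun c x hx => by
        rw [← Algebra.smul_def]; exact S.smul_mem _ hx }
  have hd : ∀ p, d p ∈ A := fun p b hb => d_mul p b hb
  have hdel : ∀ t, del t ∈ A := fun t => by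
    rw [del_eq]
    exact A.add_mem (A.mul_mem (hd _) (hd _)) (A.mul_mem (hd _) (hd _))
  let f : Neg →ₐ[ℂ] A := lift (fun p => ⟨d p, hd p⟩) (fun t => ⟨del t, hdel t⟩)
    (fun p => Subtype.ext (d_swap p))
    (fun p q => Subtype.ext (by
      change d p * d q + d q * d p = _
      rw [d_mul_d]; simp))
    (fun t p => Subtype.ext (del_mul_d t p)) (fun s t => Subtype.ext (del_mul_del s t))
  have hf : A.val.comp f = AlgHom.id ℂ Neg := by
    ext p; simp [f]
  have ha : a ∈ A := by
    have := DFunLike.congr_fun hf a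
    rw [AlgHom.id_apply] at this
    rw [← this]; exact (f a).2
  have := ha 1 one
  rwa [mul_one] at this

/-- The antiautomorphism with `d_p ↦ i d_p` and `∂_t ↦ -∂_t`. -/
def antiAlg : Neg →ₐ[ℂ] Negᵐᵒᵖ :=
  -- Reversing the order leaves an anticommutator unchanged, and i² = -1 accounts for the sign in
  -- ∂_t ↦ -∂_t.
  lift (fun p => MulOpposite.op (Complex.I • d p)) (fun t => MulOpposite.op (-del t))
    (fun p => by rw [d_swap, smul_neg]; rfl)
    (fun p q => by
      rw [← MulOpposite.op_mul, ← MulOpposite.op_mul, ← MulOpposite.op_add, smul_mul_smul_comm,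
        smul_mul_smul_comm, ← smul_add, add_comm, d_mul_d, Complex.I_mul_I]
      apply MulOpposite.unop_injective
      simp only [zsmul_eq_mul, neg_smul, one_smul, MulOpposite.op_neg, MulOpposite.unop_neg,
        MulOpposite.unop_op, Finset.unop_sum, MulOpposite.unop_mul, MulOpposite.unop_intCast,
        neg_mul, Finset.sum_neg_distrib]
      exact congrArg _ (Finset.sum_congr rfl fun x _ => Int.cast_commute _ _))
    (fun t p => by
      rw [← MulOpposite.op_mul, ← MulOpposite.op_mul, mul_neg, neg_mul, smul_mul_assoc,
        mul_smul_comm, del_mul_d])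
    (fun s t => by
      rw [← MulOpposite.op_mul, ← MulOpposite.op_mul, neg_mul_neg, neg_mul_neg, del_mul_del])

/-- The antiautomorphism with `d_p ↦ i d_p` and `∂_t ↦ -∂_t`, as a linear map. -/
def anti : Neg →ₗ[ℂ] Neg := (MulOpposite.opLinearEquiv ℂ).symm.toLinearMap ∘ₗ antiAlg.toLinearMap

theorem anti_mul (a b : Neg) : anti (a * b) = anti b * anti a := by
  simp [anti]

@[simp] theorem anti_d (p : Fin 5 × Fin 5) : anti (d p) = Complex.I • d p := by
  simp [anti, antiAlg]

@[simp] theorem anti_del (t : Fin 5) : anti (del t) = -del t := by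
  simp [anti, antiAlg]

/-- The pairing of `d_p` with the coordinate `a`. -/
def pairing (a p : Fin 5 × Fin 5) : ℂ := (if p = a then 1 else 0) - (if p = a.swap then 1 else 0)

theorem pairing_swap (a p : Fin 5 × Fin 5) : pairing a p.swap = -pairing a p := by
  have h : p.swap = a ↔ p = a.swap := ⟨fun h => by rw [← h, Prod.swap_swap],
    fun h => by rw [h, Prod.swap_swap]⟩
  have h' : p.swap = a.swap ↔ p = a := Prod.swap_injective.eq_iff
  simp only [pairing, h, h']
  ring

/-- Multiplication by `d_p`, combined with the contraction. -/
def contrOp (a p : Fin 5 × Fin 5) : Module.End ℂ (Neg × Neg) where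
  -- A pair stands for (u, ι_a u). The second component is the rule ι_a(d_p u) = ⟨a, p⟩ u - d_p ι_a
  -- u of an odd derivation, so checking the relations of `Neg` on such pairs makes the contraction
  -- well defined.
  toFun x := (d p * x.1, pairing a p • x.1 - d p * x.2)
  map_add' x y := by
    refine Prod.ext (mul_add _ _ _) ?_
    simp only [Prod.fst_add, Prod.snd_add, mul_add, smul_add]; abel
  map_smul' c x := by
    refine Prod.ext (mul_smul_comm _ _ _) ?_
    simp only [Prod.smul_fst, Prod.smul_snd, mul_smul_comm, smul_sub, RingHom.id_apply]
    rw [smul_comm]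

theorem contrOp_apply (a p : Fin 5 × Fin 5) (x : Neg × Neg) :
    contrOp a p x = (d p * x.1, pairing a p • x.1 - d p * x.2) := rfl

/-- Multiplication by `∂_t` in both components. -/
def delOp (t : Fin 5) : Module.End ℂ (Neg × Neg) :=
  (LinearMap.mulLeft ℂ (del t)).prodMap (LinearMap.mulLeft ℂ (del t))

theorem delOp_apply (t : Fin 5) (x : Neg × Neg) : delOp t x = (del t * x.1, del t * x.2) := rfl

theorem d_mul_d_mul (p q : Fin 5 × Fin 5) (u : Neg) : d p * (d q * u) + d q * (d p * u) =
    ∑ t, eps ![p.1, p.2, q.1, q.2, t] • (del t * u) := by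
  rw [← mul_assoc, ← mul_assoc, ← add_mul, d_mul_d, Finset.sum_mul]
  simp only [smul_mul_assoc]

theorem del_mul_d_mul (t : Fin 5) (p : Fin 5 × Fin 5) (u : Neg) :
    del t * (d p * u) = d p * (del t * u) := by
  rw [← mul_assoc, del_mul_d, mul_assoc]

theorem del_mul_del_mul (s t : Fin 5) (u : Neg) :
    del s * (del t * u) = del t * (del s * u) := by
  rw [← mul_assoc, del_mul_del, mul_assoc]

/-- The algebra map that defines the contraction. -/
def contrAlg (a : Fin 5 × Fin 5) : Neg →ₐ[ℂ] Module.End ℂ (Neg × Neg) :=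
  lift (contrOp a) delOp
    (fun p => by
      refine LinearMap.ext fun x => Prod.ext ?_ ?_
      · simp [contrOp_apply, d_swap]
      · simp only [contrOp_apply, d_swap, pairing_swap, LinearMap.neg_apply, Prod.snd_neg, neg_mul,
          neg_smul]
        abel)
    (fun p q => by
      refine LinearMap.ext fun x => Prod.ext ?_ ?_
      · simp only [Module.End.mul_apply, LinearMap.add_apply, contrOp_apply, delOp_apply,
          Prod.fst_add, LinearMap.sum_apply, Prod.fst_sum, LinearMap.smul_apply, Prod.smul_fst,
          d_mul_d_mul]
      · simp only [Module.End.mul_apply, LinearMap.add_apply, contrOp_apply, delOp_apply,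
          Prod.snd_add, LinearMap.sum_apply, Prod.snd_sum, LinearMap.smul_apply, Prod.smul_snd,
          ← d_mul_d_mul, mul_sub, mul_smul_comm]
        abel)
    (fun t p => by
      refine LinearMap.ext fun x => Prod.ext ?_ ?_
      · simp only [Module.End.mul_apply, contrOp_apply, delOp_apply, del_mul_d_mul]
      · simp only [Module.End.mul_apply, contrOp_apply, delOp_apply, del_mul_d_mul, mul_sub,
          mul_smul_comm])
    (fun s t => by
      refine LinearMap.ext fun x => Prod.ext ?_ ?_
      · simp only [Module.End.mul_apply, delOp_apply, del_mul_del_mul s]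
      · simp only [Module.End.mul_apply, delOp_apply, del_mul_del_mul s])

theorem contrAlg_fst (a : Fin 5 × Fin 5) (u : Neg) (x : Neg × Neg) :
    (contrAlg a u x).1 = u * x.1 := by
  induction u using Neg.induction generalizing x with
  | one => simp
  | add u v hu hv => simp [hu, hv, add_mul]
  | smul c u hu => simp [hu]
  | d_mul p u hu =>
    rw [map_mul, Module.End.mul_apply, contrAlg, lift_d, ← contrAlg]
    rw [contrOp_apply, hu, mul_assoc]

/-- The contraction with the coordinate `a`: the odd derivation with `d_p ↦ pairing a p` and
`∂_t ↦ 0`. -/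
def contr (a : Fin 5 × Fin 5) : Neg →ₗ[ℂ] Neg :=
  LinearMap.snd ℂ Neg Neg ∘ₗ LinearMap.applyₗ (1, 0) ∘ₗ (contrAlg a).toLinearMap

@[simp] theorem contr_one (a : Fin 5 × Fin 5) : contr a 1 = 0 := by
  simp [contr]

@[simp] theorem contr_d_mul (a p : Fin 5 × Fin 5) (u : Neg) :
    contr a (d p * u) = pairing a p • u - d p * contr a u := by
  have h := contrAlg_fst a u (1, 0)
  simp only [contr, LinearMap.coe_comp, Function.comp_apply, AlgHom.toLinearMap_apply, map_mul]
  rw [LinearMap.applyₗ_apply_apply, Module.End.mul_apply, contrAlg, lift_d, ← contrAlg]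
  rw [contrOp_apply, h, mul_one]
  rfl

end Neg

/-! ### The model of the generalized Verma module -/

section Model

variable (V : Type*) [AddCommGroup V] [Module ℂ V] [LieRingModule sl5 V] [LieModule ℂ sl5 V]

/-- The underlying space `U(L₋) ⊗ V` of the generalized Verma module. -/
abbrev Model := Neg ⊗[ℂ] V

/-- Candidates for the map `x ↦ x m`, for an element `m` of the model. -/
def ActSpace := (evenPart →ₗ[ℂ] Model V) × (oddPart →ₗ[ℂ] Model V)

instance : AddCommGroup (ActSpace V) :=
  inferInstanceAs (AddCommGroup ((evenPart →ₗ[ℂ] Model V) × (oddPart →ₗ[ℂ] Model V)))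

instance : Module ℂ (ActSpace V) :=
  inferInstanceAs (Module ℂ ((evenPart →ₗ[ℂ] Model V) × (oddPart →ₗ[ℂ] Model V)))

variable {V}

namespace ActSpace

def ev0 (X : evenPart) : ActSpace V →ₗ[ℂ] Model V where
  toFun a := a.1 X
  map_add' _ _ := rfl
  map_smul' _ _ := rfl

def ev1 (w : oddPart) : ActSpace V →ₗ[ℂ] Model V where
  toFun a := a.2 w
  map_add' _ _ := rfl
  map_smul' _ _ := rfl

theorem ext {a b : ActSpace V} (h0 : ∀ X, ev0 X a = ev0 X b) (h1 : ∀ w, ev1 w a = ev1 w b) :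
    a = b :=
  Prod.ext (LinearMap.ext h0) (LinearMap.ext h1)

theorem map_ev0 (a : ActSpace V) {ι : Type*} (s : Finset ι) (c : ι → ℤ) (f : ι → evenPart) :
    ev0 (∑ i ∈ s, c i • f i) a = ∑ i ∈ s, c i • ev0 (f i) a := by
  change a.1 _ = ∑ i ∈ s, c i • a.1 (f i)
  rw [map_sum]
  exact Finset.sum_congr rfl fun i _ => map_zsmul _ _ _

theorem map_ev1 (a : ActSpace V) {ι : Type*} (s : Finset ι) (c : ι → ℤ) (f : ι → oddPart) :
    ev1 (∑ i ∈ s, c i • f i) a = ∑ i ∈ s, c i • ev1 (f i) a := by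
  change a.2 _ = ∑ i ∈ s, c i • a.2 (f i)
  rw [map_sum]
  exact Finset.sum_congr rfl fun i _ => map_zsmul _ _ _

theorem ev0_add (X Y : evenPart) (a : ActSpace V) : ev0 (X + Y) a = ev0 X a + ev0 Y a :=
  map_add a.1 X Y

theorem ev0_neg (X : evenPart) (a : ActSpace V) : ev0 (-X) a = -ev0 X a := map_neg a.1 X

theorem ev0_smul (c : ℂ) (X : evenPart) (a : ActSpace V) : ev0 (c • X) a = c • ev0 X a :=
  map_smul a.1 c X

theorem ev1_add (w z : oddPart) (a : ActSpace V) : ev1 (w + z) a = ev1 w a + ev1 z a :=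
  map_add a.2 w z

theorem ev1_neg (w : oddPart) (a : ActSpace V) : ev1 (-w) a = -ev1 w a := map_neg a.2 w

theorem ev1_smul (c : ℂ) (w : oddPart) (a : ActSpace V) : ev1 (c • w) a = c • ev1 w a :=
  map_smul a.2 c w

end ActSpace

open ActSpace

/-- Turns x ↦ x m into x ↦ x (d_p m) by the rule x d_p = ± d_p x + [x, d_p], with the sign - for odd
x. Letting U(L₋) act on such families reduces the well-definedness of the action of L on U(L₋) ⊗ V
to the relations of `Neg`. -/
def actD (p : Fin 5 × Fin 5) : Module.End ℂ (ActSpace V) where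
  toFun a :=
    (Algebra.lsmul ℂ ℂ (Model V) (Neg.d p) ∘ₗ a.1 + a.2 ∘ₗ lieDerivₗ.flip (cform p),
      -(Algebra.lsmul ℂ ℂ (Model V) (Neg.d p) ∘ₗ a.2) + a.1 ∘ₗ formBracketₗ.flip (cform p))
  map_add' a b := by
    refine ActSpace.ext (fun X => ?_) (fun w => ?_)
    · change Neg.d p • (a.1 X + b.1 X) + (a.2 (lieDeriv X (cform p)) + b.2 (lieDeriv X (cform p))) =
        (Neg.d p • a.1 X + a.2 (lieDeriv X (cform p))) +
          (Neg.d p • b.1 X + b.2 (lieDeriv X (cform p)))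
      rw [smul_add]; abel
    · change -(Neg.d p • (a.2 w + b.2 w)) +
          (a.1 (formBracket w (cform p)) + b.1 (formBracket w (cform p))) =
        (-(Neg.d p • a.2 w) + a.1 (formBracket w (cform p))) +
          (-(Neg.d p • b.2 w) + b.1 (formBracket w (cform p)))
      rw [smul_add]; abel
  map_smul' c a := by
    refine ActSpace.ext (fun X => ?_) (fun w => ?_)
    · change Neg.d p • (c • a.1 X) + c • a.2 (lieDeriv X (cform p)) =
        c • (Neg.d p • a.1 X + a.2 (lieDeriv X (cform p)))
      rw [smul_add, smul_comm]
    · change -(Neg.d p • (c • a.2 w)) + c • a.1 (formBracket w (cform p)) =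
        c • (-(Neg.d p • a.2 w) + a.1 (formBracket w (cform p)))
      rw [smul_add, smul_neg, smul_comm]

theorem actD_fst (p : Fin 5 × Fin 5) (a : ActSpace V) (X : evenPart) :
    ev0 X (actD p a) = Neg.d p • ev0 X a + ev1 (lieDeriv X (cform p)) a := rfl

theorem actD_snd (p : Fin 5 × Fin 5) (a : ActSpace V) (w : oddPart) :
    ev1 w (actD p a) = -(Neg.d p • ev1 w a) + ev0 (formBracket w (cform p)) a := rfl

/-- The corresponding rule x ∂_t = ∂_t x + [x, ∂_t]. The minus sign in the odd component is [w, ∂_t]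
= -L_{∂_t} w. -/
def actDel (t : Fin 5) : Module.End ℂ (ActSpace V) where
  toFun a :=
    (Algebra.lsmul ℂ ℂ (Model V) (Neg.del t) ∘ₗ a.1 + a.1 ∘ₗ vectorBracketₗ.flip (partialField t),
      Algebra.lsmul ℂ ℂ (Model V) (Neg.del t) ∘ₗ a.2 - a.2 ∘ₗ lieDerivₗ (partialField t))
  map_add' a b := by
    refine ActSpace.ext (fun X => ?_) (fun w => ?_)
    · change Neg.del t • (a.1 X + b.1 X) + (a.1 _ + b.1 _) =
        (Neg.del t • a.1 X + a.1 _) + (Neg.del t • b.1 X + b.1 _)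
      rw [smul_add]; abel
    · change Neg.del t • (a.2 w + b.2 w) - (a.2 _ + b.2 _) =
        (Neg.del t • a.2 w - a.2 _) + (Neg.del t • b.2 w - b.2 _)
      rw [smul_add]; abel
  map_smul' c a := by
    refine ActSpace.ext (fun X => ?_) (fun w => ?_)
    · change Neg.del t • (c • a.1 X) + c • a.1 _ = c • (Neg.del t • a.1 X + a.1 _)
      rw [smul_add, smul_comm]
    · change Neg.del t • (c • a.2 w) - c • a.2 _ = c • (Neg.del t • a.2 w - a.2 _)
      rw [smul_sub, smul_comm]

theorem actDel_fst (t : Fin 5) (a : ActSpace V) (X : evenPart) :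
    ev0 X (actDel t a) = Neg.del t • ev0 X a + ev0 (vectorBracket X (partialField t)) a := rfl

theorem actDel_snd (t : Fin 5) (a : ActSpace V) (w : oddPart) :
    ev1 w (actDel t a) = Neg.del t • ev1 w a - ev1 (lieDeriv (partialField t) w) a := rfl

/-- This and the next few identities are Jacobi identities with two constant entries. They are what
the relations of `Neg` require of the operators `actD` and `actDel`. -/
theorem lieDeriv_cform_cform (X : evenPart) (p q : Fin 5 × Fin 5) :
    formBracket (lieDeriv X (cform p)) (cform q) + formBracket (lieDeriv X (cform q)) (cform p) =
      ∑ t, eps ![p.1, p.2, q.1, q.2, t] • vectorBracket X (partialField t) := by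
  have h := vectorBracket_formBracket X (cform p) (cform q)
  rw [formBracket_comm (lieDeriv X (cform q)), ← h, formBracket_cform, ← vectorBracketₗ_apply, map_sum]
  simp

theorem formBracket_cform_cform (w : oddPart) (p q : Fin 5 × Fin 5) :
    lieDeriv (formBracket w (cform p)) (cform q) + lieDeriv (formBracket w (cform q)) (cform p) =
      -∑ t, eps ![p.1, p.2, q.1, q.2, t] • lieDeriv (partialField t) w := by
  have h := lieDeriv_formBracket w (cform p) (cform q)
  have h2 : lieDeriv (formBracket (cform p) (cform q)) w =
      ∑ t, eps ![p.1, p.2, q.1, q.2, t] • lieDeriv (partialField t) w := by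
    rw [formBracket_cform, ← lieDerivₗ_apply, map_sum]
    simp
  rw [← h2, formBracket_comm w (cform q), ← add_eq_zero_iff_eq_neg, ← h]
  abel

theorem lieDeriv_vectorBracket_partialField (X : evenPart) (t : Fin 5) (p : Fin 5 × Fin 5) :
    lieDeriv (vectorBracket X (partialField t)) (cform p) =
      -lieDeriv (partialField t) (lieDeriv X (cform p)) := by
  rw [lieDeriv_vectorBracket, lieDeriv_partialField_cform, ← lieDerivₗ_apply X 0, map_zero, zero_sub]

theorem vectorBracket_formBracket_partialField (w : oddPart) (t : Fin 5) (p : Fin 5 × Fin 5) :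
    vectorBracket (formBracket w (cform p)) (partialField t) =
      -formBracket (lieDeriv (partialField t) w) (cform p) := by
  rw [vectorBracket_skew, vectorBracket_formBracket, lieDeriv_partialField_cform,
    ← formBracketₗ_apply w 0, map_zero, add_zero]

theorem vectorBracket_partialField_comm (X : evenPart) (s t : Fin 5) :
    vectorBracket (vectorBracket X (partialField s)) (partialField t) =
      vectorBracket (vectorBracket X (partialField t)) (partialField s) := by
  ext1; funext i
  simp only [vectorBracket_partialField_val, map_neg, neg_neg]
  exact pd_comm t s _

theorem lieDeriv_partialField_comm (w : oddPart) (s t : Fin 5) :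
    lieDeriv (partialField s) (lieDeriv (partialField t) w) =
      lieDeriv (partialField t) (lieDeriv (partialField s) w) := by
  ext1; funext i j
  simp only [lieDeriv_partialField_val]
  exact pd_comm s t _

theorem neg_d_smul (p : Fin 5 × Fin 5) (m : Model V) : (-Neg.d p) • m = -(Neg.d p • m) := by
  refine eq_neg_of_add_eq_zero_left ?_
  rw [← add_smul, neg_add_cancel, zero_smul]

theorem d_smul_d_smul (p q : Fin 5 × Fin 5) (m : Model V) :
    Neg.d p • Neg.d q • m + Neg.d q • Neg.d p • m =
      ∑ t, eps ![p.1, p.2, q.1, q.2, t] • Neg.del t • m := by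
  rw [← mul_smul, ← mul_smul, ← add_smul, Neg.d_mul_d, Finset.sum_smul]
  simp only [smul_assoc]

theorem del_smul_d_smul (t : Fin 5) (p : Fin 5 × Fin 5) (m : Model V) :
    Neg.del t • Neg.d p • m = Neg.d p • Neg.del t • m := by
  rw [← mul_smul, ← mul_smul, Neg.del_mul_d]

theorem del_smul_del_smul (s t : Fin 5) (m : Model V) :
    Neg.del s • Neg.del t • m = Neg.del t • Neg.del s • m := by
  rw [← mul_smul, ← mul_smul, Neg.del_mul_del]

/-- The action of `U(L₋)` on `ActSpace V`. -/
def actAlg : Neg →ₐ[ℂ] Module.End ℂ (ActSpace V) :=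
  Neg.lift (actD (V := V)) (actDel (V := V))
    (fun p => by
      refine LinearMap.ext fun a => ActSpace.ext (fun X => ?_) (fun w => ?_)
      · rw [LinearMap.neg_apply, map_neg, actD_fst, actD_fst, cform_swap,
          Neg.d_swap, ← lieDerivₗ_apply, map_neg, ev1_neg, neg_d_smul, lieDerivₗ_apply]
        abel
      · rw [LinearMap.neg_apply, map_neg, actD_snd, actD_snd, cform_swap,
          Neg.d_swap, ← formBracketₗ_apply, map_neg, ev0_neg, neg_d_smul, formBracketₗ_apply]
        abel)
    (fun p q => by
      refine LinearMap.ext fun a => ActSpace.ext (fun X => ?_) (fun w => ?_)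
      · simp only [LinearMap.add_apply, Module.End.mul_apply, LinearMap.sum_apply, map_add, map_sum,
          LinearMap.smul_apply, map_zsmul, actD_fst, actD_snd, actDel_fst,
          smul_add, Finset.sum_add_distrib]
        rw [← d_smul_d_smul, ← map_ev0, ← lieDeriv_cform_cform, ev0_add]
        abel
      · simp only [LinearMap.add_apply, Module.End.mul_apply, LinearMap.sum_apply, map_add, map_sum,
          LinearMap.smul_apply, map_zsmul, actD_fst, actD_snd, actDel_snd,
          smul_add, smul_sub, smul_neg, Finset.sum_sub_distrib]
        rw [← d_smul_d_smul, ← map_ev1, sub_eq_add_neg, ← ev1_neg, ← formBracket_cform_cform,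
          ev1_add]
        abel)
    (fun t p => by
      refine LinearMap.ext fun a => ActSpace.ext (fun X => ?_) (fun w => ?_)
      · simp only [Module.End.mul_apply, actD_fst, actDel_fst, actDel_snd, smul_add,
          lieDeriv_vectorBracket_partialField, ev1_neg]
        rw [del_smul_d_smul]
        abel
      · simp only [Module.End.mul_apply, actD_snd, actDel_fst, actDel_snd, smul_add, smul_sub,
          vectorBracket_formBracket_partialField, ev0_neg, smul_neg]
        rw [del_smul_d_smul]
        abel)
    (fun s t => by
      refine LinearMap.ext fun a => ActSpace.ext (fun X => ?_) (fun w => ?_)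
      · simp only [Module.End.mul_apply, actDel_fst, smul_add]
        rw [del_smul_del_smul, vectorBracket_partialField_comm]
        abel
      · simp only [Module.End.mul_apply, actDel_snd, smul_sub]
        rw [del_smul_del_smul, lieDeriv_partialField_comm]
        abel)

theorem actAlg_d (p : Fin 5 × Fin 5) : actAlg (V := V) (Neg.d p) = actD p := Neg.lift_d ..

/-- The constant part of a vector field. -/
def constField : evenPart →ₗ[ℂ] Neg where
  toFun X := ∑ t, MvPowerSeries.constantCoeff (X.1 t) • Neg.del t
  map_add' X Y := by simp [add_smul, Finset.sum_add_distrib]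
  map_smul' c X := by simp [Finset.smul_sum, mul_smul]

/-- The constant part of a closed two-form. -/
def constPart : oddPart →ₗ[ℂ] Neg where
  toFun w := (1 / 2 : ℂ) • ∑ i, ∑ j, MvPowerSeries.constantCoeff (w.1 i j) • Neg.d (i, j)
  map_add' X Y := by simp [add_smul, Finset.sum_add_distrib]
  map_smul' c X := by
    simp only [Finset.smul_sum, Submodule.coe_smul, Pi.smul_apply, RingHom.id_apply,
      MvPowerSeries.constantCoeff_smul, smul_eq_mul, mul_smul]
    simp only [smul_comm c]

def linearPartₗ : evenPart →ₗ[ℂ] sl5 where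
  toFun := linearPart
  map_add' X Y := by ext i j; simp [linearPart]
  map_smul' c X := by ext i j; simp [linearPart]

/-- The action on the vectors `1 ⊗ v`. -/
def actBase : V →ₗ[ℂ] ActSpace V where
  toFun v :=
    ((TensorProduct.mk ℂ Neg V).flip v ∘ₗ constField +
        TensorProduct.mk ℂ Neg V 1 ∘ₗ (LieModule.toEnd ℂ sl5 V : sl5 →ₗ[ℂ] Module.End ℂ V).flip v ∘ₗ
          linearPartₗ,
      (TensorProduct.mk ℂ Neg V).flip v ∘ₗ constPart)
  map_add' v v' := by
    refine ActSpace.ext (fun X => ?_) (fun w => ?_)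
    · change constField X ⊗ₜ[ℂ] (v + v') + (1 : Neg) ⊗ₜ[ℂ] ⁅linearPart X, v + v'⁆ =
        (constField X ⊗ₜ[ℂ] v + (1 : Neg) ⊗ₜ[ℂ] ⁅linearPart X, v⁆) +
          (constField X ⊗ₜ[ℂ] v' + (1 : Neg) ⊗ₜ[ℂ] ⁅linearPart X, v'⁆)
      rw [lie_add, TensorProduct.tmul_add, TensorProduct.tmul_add]; abel
    · exact TensorProduct.tmul_add _ _ _
  map_smul' c v := by
    refine ActSpace.ext (fun X => ?_) (fun w => ?_)
    · change constField X ⊗ₜ[ℂ] (c • v) + (1 : Neg) ⊗ₜ[ℂ] ⁅linearPart X, c • v⁆ =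
        c • (constField X ⊗ₜ[ℂ] v + (1 : Neg) ⊗ₜ[ℂ] ⁅linearPart X, v⁆)
      rw [lie_smul, TensorProduct.tmul_smul, TensorProduct.tmul_smul, smul_add]
    · exact TensorProduct.tmul_smul _ _ _

/-- Sends m to the family x ↦ x m: the family of 1 ⊗ v is prescribed by `actBase`, and that of u ⊗ v
is obtained by letting u act on it. -/
def actMap : Model V →ₗ[ℂ] ActSpace V :=
  TensorProduct.lift ((LinearMap.lcomp ℂ _ actBase) ∘ₗ (actAlg (V := V)).toLinearMap)

theorem actMap_tmul (u : Neg) (v : V) : actMap (u ⊗ₜ v) = actAlg u (actBase v) := rfl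

theorem actMap_d_smul (p : Fin 5 × Fin 5) (m : Model V) :
    actMap (Neg.d p • m) = actD p (actMap m) := by
  induction m using TensorProduct.induction_on with
  | zero => simp
  | add x y hx hy => rw [smul_add, map_add, hx, hy, map_add, map_add]
  | tmul u v =>
    rw [TensorProduct.smul_tmul', actMap_tmul, actMap_tmul, smul_eq_mul, map_mul, actAlg_d]; rfl

/-- The action of the even part of `L` on the model. -/
def rho0 : evenPart →ₗ[ℂ] Module.End ℂ (Model V) where
  toFun X := ev0 X ∘ₗ actMap
  map_add' X Y := LinearMap.ext fun m => ev0_add X Y (actMap m)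
  map_smul' c X := LinearMap.ext fun m => ev0_smul c X (actMap m)

/-- The action of the odd part of `L` on the model. -/
def rho1 : oddPart →ₗ[ℂ] Module.End ℂ (Model V) where
  toFun w := ev1 w ∘ₗ actMap
  map_add' w z := LinearMap.ext fun m => ev1_add w z (actMap m)
  map_smul' c w := LinearMap.ext fun m => ev1_smul c w (actMap m)

theorem rho0_apply (X : evenPart) (m : Model V) : rho0 X m = ev0 X (actMap m) := rfl

theorem rho1_apply (w : oddPart) (m : Model V) : rho1 w m = ev1 w (actMap m) := rfl

theorem rho0_d_smul (X : evenPart) (p : Fin 5 × Fin 5) (m : Model V) :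
    rho0 X (Neg.d p • m) = Neg.d p • rho0 X m + rho1 (lieDeriv X (cform p)) m := by
  rw [rho0_apply, actMap_d_smul, actD_fst]; rfl

theorem rho1_d_smul (w : oddPart) (p : Fin 5 × Fin 5) (m : Model V) :
    rho1 w (Neg.d p • m) = -(Neg.d p • rho1 w m) + rho0 (formBracket w (cform p)) m := by
  rw [rho1_apply, actMap_d_smul, actD_snd]; rfl

theorem rho0_one (X : evenPart) (v : V) :
    rho0 X ((1 : Neg) ⊗ₜ v) = constField X ⊗ₜ v + (1 : Neg) ⊗ₜ[ℂ] ⁅linearPart X, v⁆ := by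
  rw [rho0_apply, actMap_tmul, map_one]; rfl

theorem rho1_one (w : oddPart) (v : V) : rho1 w ((1 : Neg) ⊗ₜ v) = constPart w ⊗ₜ v := by
  rw [rho1_apply, actMap_tmul, map_one]; rfl

theorem Model.induction {P : Model V → Prop} (one : ∀ v, P ((1 : Neg) ⊗ₜ v))
    (add : ∀ m m', P m → P m' → P (m + m')) (d_smul : ∀ p m, P m → P (Neg.d p • m))
    (m : Model V) : P m := by
  induction m using TensorProduct.induction_on with
  | zero => simpa using one 0
  | add x y hx hy => exact add x y hx hy
  | tmul u v =>
    induction u using Neg.induction generalizing v with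
    | one => exact one v
    | add a b ha hb => rw [TensorProduct.add_tmul]; exact add _ _ (ha v) (hb v)
    | smul c a ha => rw [TensorProduct.smul_tmul]; exact ha _
    | d_mul p a ha => exact d_smul p _ (ha v)

end Model

/-! ### Constant and linear parts -/

/-- The value at the origin. -/
abbrev val0 : PS →+* ℂ := MvPowerSeries.constantCoeff

theorem coeff_single_one (f : PS) (i : Fin 5) :
    MvPowerSeries.coeff (Finsupp.single i 1) f = val0 (pd i f) := by
  have h := MvPowerSeries.coeff_pderiv (R := ℂ) (i := i) f 0
  simp only [zero_add, Finsupp.coe_zero, Pi.zero_apply, Nat.cast_zero, mul_one] at h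
  rw [← h]
  simp

theorem linearPart_apply (X : evenPart) (i j : Fin 5) :
    (linearPart X).1 i j = val0 (pd i (X.1 j)) := coeff_single_one _ _

theorem constField_apply (X : evenPart) : constField X = ∑ t, val0 (X.1 t) • Neg.del t := rfl

theorem constPart_apply (w : oddPart) :
    constPart w = (1 / 2 : ℂ) • ∑ i, ∑ j, val0 (w.1 i j) • Neg.d (i, j) := rfl

theorem constField_partialField (t : Fin 5) : constField (partialField t) = Neg.del t := by
  simp [constField_apply, partialField_val]

theorem constPart_cform (p : Fin 5 × Fin 5) : constPart (cform p) = Neg.d p := by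
  obtain ⟨a, b⟩ := p
  simp only [constPart_apply, constForm_val, MvPowerSeries.constantCoeff_C, sub_smul,
    Finset.sum_sub_distrib, ite_and, ite_smul, one_smul, zero_smul]
  simp only [Finset.sum_ite_eq', Finset.mem_univ, if_true, Finset.sum_ite_irrel,
    Finset.sum_const_zero]
  rw [show Neg.d (b, a) = -Neg.d (a, b) from Neg.d_swap (a, b)]
  module

theorem linearPart_partialField (t : Fin 5) : linearPart (partialField t) = 0 := by
  ext i j
  rw [linearPart_apply, partialField_val, MvPowerSeries.pderiv_C]
  simp

/-- Every field is a constant field plus one vanishing at the origin, so linear statements about the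
even part may be checked on L₋ and on L_{≥0} separately. -/
theorem evenPart.induction {P : evenPart → Prop} (add : ∀ X Y, P X → P Y → P (X + Y))
    (smul : ∀ (c : ℂ) X, P X → P (c • X)) (const : ∀ t, P (partialField t))
    (vanish : ∀ X : evenPart, (∀ i, val0 (X.1 i) = 0) → P X) (X : evenPart) : P X := by
  have h0 : P 0 := vanish 0 fun i => by simp
  have hs : ∀ s : Finset (Fin 5), P (∑ t ∈ s, val0 (X.1 t) • partialField t) := by
    intro s
    induction s using Finset.induction_on with
    | empty => simpa using h0
    | insert a s ha ih => rw [Finset.sum_insert ha]; exact add _ _ (smul _ _ (const a)) ih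
  rw [← add_sub_cancel (∑ t, val0 (X.1 t) • partialField t) X]
  refine add _ _ (hs _) (vanish _ fun i => ?_)
  simp only [Submodule.coe_sub, Submodule.coe_sum, Submodule.coe_smul, Pi.sub_apply,
    Finset.sum_apply, Pi.smul_apply, partialField_val]
  simp

theorem oddPart.induction {P : oddPart → Prop} (add : ∀ w z, P w → P z → P (w + z))
    (smul : ∀ (c : ℂ) w, P w → P (c • w)) (const : ∀ p, P (cform p))
    (vanish : ∀ w : oddPart, (∀ i j, val0 (w.1 i j) = 0) → P w) (w : oddPart) : P w := by
  have h0 : P 0 := vanish 0 fun i j => by simp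
  have hs : ∀ s : Finset (Fin 5 × Fin 5), P (∑ t ∈ s, val0 (w.1 t.1 t.2) • cform t) := by
    intro s
    induction s using Finset.induction_on with
    | empty => simpa using h0
    | insert a s ha ih => rw [Finset.sum_insert ha]; exact add _ _ (smul _ _ (const a)) ih
  -- The factor ½ compensates for the sum over ordered pairs, in which each dxᵢ ∧ dxⱼ occurs twice.
  rw [← add_sub_cancel ((1 / 2 : ℂ) • ∑ t, val0 (w.1 t.1 t.2) • cform t) w]
  refine add _ _ (smul _ _ (hs _)) (vanish _ fun i j => ?_)
  simp only [Submodule.coe_sub, Submodule.coe_sum, Submodule.coe_smul, Pi.sub_apply,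
    Finset.sum_apply, Pi.smul_apply, constForm_val, Fintype.sum_prod_type]
  have e : val0 (w.1 j i) = -val0 (w.1 i j) := by rw [w.2.1 i j, map_neg]
  simp only [map_sub, MvPowerSeries.constantCoeff_smul, map_sum, MvPowerSeries.constantCoeff_C,
    smul_eq_mul, mul_sub, Finset.sum_sub_distrib, ite_and, mul_ite, mul_one, mul_zero]
  simp [e]
  ring

theorem val0_vectorBracket (X Y : evenPart) (hX : ∀ i, val0 (X.1 i) = 0)
    (hY : ∀ i, val0 (Y.1 i) = 0) (i : Fin 5) : val0 ((vectorBracket X Y).1 i) = 0 := by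
  change val0 (∑ m, (X.1 m * pd m (Y.1 i) - Y.1 m * pd m (X.1 i))) = 0
  simp only [map_sum, map_sub, map_mul, hX, hY, zero_mul, sub_zero, Finset.sum_const_zero]

theorem linearPart_vectorBracket (X Y : evenPart) (hX : ∀ i, val0 (X.1 i) = 0)
    (hY : ∀ i, val0 (Y.1 i) = 0) : linearPart (vectorBracket X Y) = ⁅linearPart X, linearPart Y⁆ := by
  ext i j
  rw [linearPart_apply, LieAlgebra.SpecialLinear.sl_bracket, Matrix.sub_apply, Matrix.mul_apply,
    Matrix.mul_apply, ← Finset.sum_sub_distrib]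
  change val0 (pd i (∑ m, (X.1 m * pd m (Y.1 j) - Y.1 m * pd m (X.1 j)))) = _
  simp only [map_sum, map_sub, Derivation.leibniz, smul_eq_mul, map_add, map_mul, hX, hY, zero_mul,
    zero_add]
  refine Finset.sum_congr rfl fun m _ => ?_
  rw [linearPart_apply, linearPart_apply, linearPart_apply, linearPart_apply]
  ring

theorem val0_lieDeriv (X : evenPart) (w : oddPart) (hX : ∀ i, val0 (X.1 i) = 0)
    (hw : ∀ i j, val0 (w.1 i j) = 0) (i j : Fin 5) : val0 ((lieDeriv X w).1 i j) = 0 := by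
  change val0 (∑ m, (X.1 m * pd m (w.1 i j) + pd i (X.1 m) * w.1 m j + pd j (X.1 m) * w.1 i m)) = 0
  simp only [map_sum, map_add, map_mul, hX, hw, zero_mul, mul_zero, add_zero,
    Finset.sum_const_zero]

theorem val0_pairSum (w z : oddPart) (hw : ∀ i j, val0 (w.1 i j) = 0) (t : Fin 5) :
    val0 (pairSum w.1 z.1 t) = 0 := by
  simp only [pairSum, map_sum, map_zsmul, map_mul, hw, zero_mul, smul_zero, Finset.sum_const_zero]

theorem val0_formBracket (w z : oddPart) (hw : ∀ i j, val0 (w.1 i j) = 0) (t : Fin 5) :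
    val0 ((formBracket w z).1 t) = 0 := by
  rw [formBracket_val, MvPowerSeries.constantCoeff_smul, val0_pairSum w z hw, smul_zero]

theorem linearPart_formBracket (w z : oddPart) (hw : ∀ i j, val0 (w.1 i j) = 0)
    (hz : ∀ i j, val0 (z.1 i j) = 0) : linearPart (formBracket w z) = 0 := by
  ext i t
  rw [linearPart_apply, formBracket_val]
  simp only [pairSum, Derivation.map_smul, map_sum, map_zsmul, Derivation.leibniz, smul_eq_mul,
    MvPowerSeries.constantCoeff_smul, map_add, map_mul, hw, hz, zero_mul, add_zero, smul_zero,
    Finset.sum_const_zero, mul_zero]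
  rfl

theorem constField_eq_zero (X : evenPart) (hX : ∀ i, val0 (X.1 i) = 0) : constField X = 0 := by
  simp [constField_apply, hX]

theorem constPart_eq_zero (w : oddPart) (hw : ∀ i j, val0 (w.1 i j) = 0) : constPart w = 0 := by
  simp [constPart_apply, hw]

/-! ### The operators on the model form a representation of L -/

section Model

variable {V : Type*} [AddCommGroup V] [Module ℂ V] [LieRingModule sl5 V] [LieModule ℂ sl5 V]

theorem rho0_one_of_vanish (X : evenPart) (hX : ∀ i, val0 (X.1 i) = 0) (v : V) :
    rho0 X ((1 : Neg) ⊗ₜ v) = (1 : Neg) ⊗ₜ[ℂ] ⁅linearPart X, v⁆ := by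
  rw [rho0_one, constField_eq_zero X hX, TensorProduct.zero_tmul, zero_add]

theorem rho1_one_of_vanish (w : oddPart) (hw : ∀ i j, val0 (w.1 i j) = 0) (v : V) :
    rho1 w ((1 : Neg) ⊗ₜ v) = 0 := by
  rw [rho1_one, constPart_eq_zero w hw, TensorProduct.zero_tmul]

theorem rho0_partialField (t : Fin 5) (m : Model V) : rho0 (partialField t) m = Neg.del t • m := by
  induction m using Model.induction with
  | one v => rw [rho0_one, constField_partialField, linearPart_partialField, zero_lie,
      TensorProduct.tmul_zero, add_zero, TensorProduct.smul_tmul', smul_eq_mul, mul_one]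
  | add m m' h h' => rw [map_add, h, h', smul_add]
  | d_smul p m h => rw [rho0_d_smul, h, lieDeriv_partialField_cform, map_zero, LinearMap.zero_apply,
      add_zero, del_smul_d_smul]

theorem rho0_sum_partialField (c : Fin 5 → ℤ) (m : Model V) :
    rho0 (∑ t, c t • partialField t) m = ∑ t, c t • Neg.del t • m := by
  rw [map_sum, LinearMap.sum_apply]
  refine Finset.sum_congr rfl fun t _ => ?_
  rw [map_zsmul, LinearMap.smul_apply, rho0_partialField]

theorem rho1_cform (p : Fin 5 × Fin 5) (m : Model V) : rho1 (cform p) m = Neg.d p • m := by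
  induction m using Model.induction with
  | one v => rw [rho1_one, constPart_cform, TensorProduct.smul_tmul', smul_eq_mul, mul_one]
  | add m m' h h' => rw [map_add, h, h', smul_add]
  | d_smul q m h =>
    rw [rho1_d_smul, h, formBracket_cform, rho0_sum_partialField, ← d_smul_d_smul]
    abel

theorem rho0_del_smul (X : evenPart) (t : Fin 5) (m : Model V) :
    rho0 X (Neg.del t • m) = Neg.del t • rho0 X m + rho0 (vectorBracket X (partialField t)) m := by
  change _ = ActSpace.ev0 X (actDel t (actMap m))
  rw [rho0_apply]
  congr 1
  induction m using TensorProduct.induction_on with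
  | zero => simp
  | add x y hx hy => rw [smul_add, map_add, hx, hy, map_add, map_add]
  | tmul u v =>
    rw [TensorProduct.smul_tmul', actMap_tmul, actMap_tmul, smul_eq_mul, map_mul,
      show actAlg (V := V) (Neg.del t) = actDel t from Neg.lift_del ..]
    rfl

theorem rho1_del_smul (w : oddPart) (t : Fin 5) (m : Model V) :
    rho1 w (Neg.del t • m) = Neg.del t • rho1 w m - rho1 (lieDeriv (partialField t) w) m := by
  change _ = ActSpace.ev1 w (actDel t (actMap m))
  rw [rho1_apply]
  congr 1
  induction m using TensorProduct.induction_on with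
  | zero => simp
  | add x y hx hy => rw [smul_add, map_add, hx, hy, map_add, map_add]
  | tmul u v =>
    rw [TensorProduct.smul_tmul', actMap_tmul, actMap_tmul, smul_eq_mul, map_mul,
      show actAlg (V := V) (Neg.del t) = actDel t from Neg.lift_del ..]
    rfl

/-- The failure of `rho0` to respect the bracket of two vector fields. -/
theorem rho_relations_one (v : V) :
    (∀ X Y : evenPart, rho0 X (rho0 Y ((1 : Neg) ⊗ₜ v)) - rho0 Y (rho0 X ((1 : Neg) ⊗ₜ v)) =
      rho0 (vectorBracket X Y) ((1 : Neg) ⊗ₜ[ℂ] v)) ∧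
    (∀ (X : evenPart) (w : oddPart),
      rho0 X (rho1 w ((1 : Neg) ⊗ₜ v)) - rho1 w (rho0 X ((1 : Neg) ⊗ₜ v)) =
      rho1 (lieDeriv X w) ((1 : Neg) ⊗ₜ[ℂ] v)) ∧
    (∀ w z : oddPart, rho1 w (rho1 z ((1 : Neg) ⊗ₜ v)) + rho1 z (rho1 w ((1 : Neg) ⊗ₜ v)) =
      rho0 (formBracket w z) ((1 : Neg) ⊗ₜ[ℂ] v)) := by
  -- If one of the two elements is constant, it acts by left multiplication, and the relation holds
  -- on every vector by construction of the action.
  have hEE : ∀ (X : evenPart) (t : Fin 5) (m : Model V),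
      rho0 X (rho0 (partialField t) m) - rho0 (partialField t) (rho0 X m) =
        rho0 (vectorBracket X (partialField t)) m := fun X t m => by
    rw [rho0_partialField, rho0_partialField, rho0_del_smul]; abel
  have hEO : ∀ (X : evenPart) (p : Fin 5 × Fin 5) (m : Model V),
      rho0 X (rho1 (cform p) m) - rho1 (cform p) (rho0 X m) =
        rho1 (lieDeriv X (cform p)) m := fun X p m => by
    rw [rho1_cform, rho1_cform, rho0_d_smul]; abel
  have hOE : ∀ (w : oddPart) (t : Fin 5) (m : Model V),
      rho0 (partialField t) (rho1 w m) - rho1 w (rho0 (partialField t) m) =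
        rho1 (lieDeriv (partialField t) w) m := fun w t m => by
    rw [rho0_partialField, rho0_partialField, rho1_del_smul]; abel
  have hOO : ∀ (w : oddPart) (p : Fin 5 × Fin 5) (m : Model V),
      rho1 w (rho1 (cform p) m) + rho1 (cform p) (rho1 w m) =
        rho0 (formBracket w (cform p)) m := fun w p m => by
    rw [rho1_cform, rho1_cform, rho1_d_smul]; abel
  refine ⟨fun X Y => ?_, fun X w => ?_, fun w z => ?_⟩
  · induction X using evenPart.induction with
    | add X X' h h' =>
      simp only [← vectorBracketₗ_apply, map_add, LinearMap.add_apply] at h h' ⊢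
      rw [← h, ← h']; abel
    | smul c X h =>
      simp only [← vectorBracketₗ_apply, map_smul, LinearMap.smul_apply] at h ⊢
      rw [← h, smul_sub]
    | const t =>
      rw [vectorBracket_skew, map_neg, LinearMap.neg_apply, ← hEE]; abel
    | vanish X hX =>
      induction Y using evenPart.induction with
      | add Y Y' h h' =>
        simp only [← vectorBracketₗ_apply, map_add, LinearMap.add_apply] at h h' ⊢
        rw [← h, ← h']; abel
      | smul c Y h =>
        simp only [← vectorBracketₗ_apply, map_smul, LinearMap.smul_apply] at h ⊢
        rw [← h, smul_sub]
      | const t => exact hEE X t _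
      | vanish Y hY =>
        -- Fields vanishing at the origin act on 1 ⊗ v through their linear parts, so the relation
        -- is the module axiom for V.
        rw [rho0_one_of_vanish Y hY, rho0_one_of_vanish X hX, rho0_one_of_vanish X hX,
          rho0_one_of_vanish Y hY, rho0_one_of_vanish _ (val0_vectorBracket X Y hX hY),
          linearPart_vectorBracket X Y hX hY, lie_lie, TensorProduct.tmul_sub]
  · induction X using evenPart.induction with
    | add X X' h h' =>
      simp only [← lieDerivₗ_apply, map_add, LinearMap.add_apply] at h h' ⊢
      rw [← h, ← h']; abel
    | smul c X h =>
      simp only [← lieDerivₗ_apply, map_smul, LinearMap.smul_apply] at h ⊢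
      rw [← h, smul_sub]
    | const t => exact hOE w t _
    | vanish X hX =>
      induction w using oddPart.induction with
      | add Y Y' h h' =>
        simp only [← lieDerivₗ_apply, map_add, LinearMap.add_apply] at h h' ⊢
        rw [← h, ← h']; abel
      | smul c Y h =>
        simp only [← lieDerivₗ_apply, map_smul, LinearMap.smul_apply] at h ⊢
        rw [← h, smul_sub]
      | const t => exact hEO X t _
      | vanish w hw =>
        rw [rho1_one_of_vanish w hw, rho0_one_of_vanish X hX, rho1_one_of_vanish w hw,
          rho1_one_of_vanish _ (val0_lieDeriv X w hX hw), map_zero, sub_zero]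
  · induction w using oddPart.induction with
    | add X X' h h' =>
      simp only [← formBracketₗ_apply, map_add, LinearMap.add_apply] at h h' ⊢
      rw [← h, ← h']; abel
    | smul c X h =>
      simp only [← formBracketₗ_apply, map_smul, LinearMap.smul_apply] at h ⊢
      rw [← h, smul_add]
    | const t => rw [formBracket_comm, ← hOO, add_comm]
    | vanish w hw =>
      induction z using oddPart.induction with
      | add Y Y' h h' =>
        simp only [← formBracketₗ_apply, map_add, LinearMap.add_apply] at h h' ⊢
        rw [← h, ← h']; abel
      | smul c Y h =>
        simp only [← formBracketₗ_apply, map_smul, LinearMap.smul_apply] at h ⊢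
        rw [← h, smul_add]
      | const t => exact hOO w t _
      | vanish z hz =>
        rw [rho1_one_of_vanish w hw, rho1_one_of_vanish z hz, map_zero, map_zero, add_zero,
          rho0_one_of_vanish _ (val0_formBracket w z hw), linearPart_formBracket w z hw hz,
          zero_lie, TensorProduct.tmul_zero]

/-- The operators `rho0` and `rho1` satisfy the relations of the enveloping algebra. -/
theorem rho_relations (m : Model V) :
    (∀ X Y : evenPart, rho0 X (rho0 Y m) - rho0 Y (rho0 X m) = rho0 (vectorBracket X Y) m) ∧
    (∀ (X : evenPart) (w : oddPart),
      rho0 X (rho1 w m) - rho1 w (rho0 X m) = rho1 (lieDeriv X w) m) ∧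
    (∀ w z : oddPart, rho1 w (rho1 z m) + rho1 z (rho1 w m) = rho0 (formBracket w z) m) := by
  induction m using Model.induction with
  | one v => exact rho_relations_one v
  | add m m' h h' =>
    refine ⟨fun X Y => ?_, fun X w => ?_, fun w z => ?_⟩
    · simp only [map_add, ← h.1 X Y, ← h'.1 X Y]; abel
    · simp only [map_add, ← h.2.1 X w, ← h'.2.1 X w]; abel
    · simp only [map_add, ← h.2.2 w z, ← h'.2.2 w z]; abel
  | d_smul p m h =>
    -- Moving d_p to the left reduces each relation on d_p m to the relations on m and the Jacobi
    -- identity for the two elements and d_p.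
    obtain ⟨h0, h1, h2⟩ := h
    refine ⟨fun X Y => ?_, fun X w => ?_, fun w z => ?_⟩
    · simp only [rho0_d_smul, map_add]
      rw [← h0 X Y, lieDeriv_vectorBracket, map_sub, LinearMap.sub_apply,
        ← h1 X (lieDeriv Y (cform p)), ← h1 Y (lieDeriv X (cform p)), smul_sub]
      abel
    · simp only [rho0_d_smul, rho1_d_smul, map_add, map_neg]
      have e := vectorBracket_formBracket X w (cform p)
      have e2 : rho0 (formBracket (lieDeriv X w) (cform p)) m =
          rho0 (vectorBracket X (formBracket w (cform p))) m -
            rho0 (formBracket w (lieDeriv X (cform p))) m := by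
        rw [e, map_add, LinearMap.add_apply]; abel
      rw [e2, ← h0 X (formBracket w (cform p)), ← h1 X w, ← h2 w (lieDeriv X (cform p)), smul_sub]
      abel
    · simp only [rho0_d_smul, rho1_d_smul, map_add, map_neg]
      have e := lieDeriv_formBracket w z (cform p)
      have e2 : rho1 (lieDeriv (formBracket w z) (cform p)) m =
          -rho1 (lieDeriv (formBracket z (cform p)) w) m -
            rho1 (lieDeriv (formBracket w (cform p)) z) m := by
        rw [← sub_eq_zero, sub_sub_eq_add_sub, sub_neg_eq_add, ← LinearMap.add_apply,
          ← LinearMap.add_apply, ← map_add, ← map_add, formBracket_comm w (cform p)]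
        rw [show lieDeriv (formBracket w z) (cform p) + lieDeriv (formBracket (cform p) w) z +
          lieDeriv (formBracket z (cform p)) w = 0 by rw [← e]; abel, map_zero,
          LinearMap.zero_apply]
      rw [e2, ← h1 (formBracket z (cform p)) w, ← h1 (formBracket w (cform p)) z, ← h2 w z,
        smul_add]
      abel

end Model

/-! ### Comparison of the model with the generalized Verma module -/

section Compare

variable {V : Type*} [AddCommGroup V] [Module ℂ V] [LieRingModule sl5 V] [LieModule ℂ sl5 V]

def rhoL : L →ₗ[ℂ] Module.End ℂ (Model V) :=
  rho0 ∘ₗ LinearMap.fst ℂ evenPart oddPart + rho1 ∘ₗ LinearMap.snd ℂ evenPart oddPart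

theorem rhoL_even (X : evenPart) : rhoL (V := V) (X, 0) = rho0 X := by
  simp [rhoL]

theorem rhoL_odd (w : oddPart) : rhoL (V := V) (0, w) = rho1 w := by
  simp [rhoL]

/-- The action of `U` on the model. -/
def rhoU : U →ₐ[ℂ] Module.End ℂ (Model V) :=
  RingQuot.liftAlgHom ℂ ⟨TensorAlgebra.lift ℂ rhoL, by
    rintro _ _ (⟨X, Y⟩ | ⟨X, w⟩ | ⟨w, z⟩)
    · simp only [map_sub, map_mul, TensorAlgebra.lift_ι_apply, rhoL_even]
      exact LinearMap.ext fun m => (rho_relations m).1 X Y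
    · simp only [map_sub, map_mul, TensorAlgebra.lift_ι_apply, rhoL_even, rhoL_odd]
      exact LinearMap.ext fun m => (rho_relations m).2.1 X w
    · simp only [map_add, map_mul, TensorAlgebra.lift_ι_apply, rhoL_even, rhoL_odd]
      exact LinearMap.ext fun m => (rho_relations m).2.2 w z⟩

theorem rhoU_toU (x : L) : rhoU (V := V) (toU x) = rhoL x := by
  change RingQuot.liftAlgHom ℂ _ (RingQuot.mkAlgHom ℂ EnvRel (TensorAlgebra.ι ℂ x)) = _
  rw [RingQuot.liftAlgHom_mkAlgHom_apply, TensorAlgebra.lift_ι_apply]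

theorem rhoU_even (X : evenPart) : rhoU (V := V) (toU (X, 0)) = rho0 X := by
  rw [rhoU_toU, rhoL_even]

theorem rhoU_odd (w : oddPart) : rhoU (V := V) (toU (0, w)) = rho1 w := by
  rw [rhoU_toU, rhoL_odd]

theorem toU_even_even (X Y : evenPart) :
    toU (X, 0) * toU (Y, 0) - toU (Y, 0) * toU (X, 0) = toU (vectorBracket X Y, 0) := by
  have h := RingQuot.mkAlgHom_rel ℂ (EnvRel.even_even X Y)
  rw [map_sub, map_mul, map_mul] at h
  exact h

theorem toU_even_odd (X : evenPart) (w : oddPart) :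
    toU (X, 0) * toU (0, w) - toU (0, w) * toU (X, 0) = toU (0, lieDeriv X w) := by
  have h := RingQuot.mkAlgHom_rel ℂ (EnvRel.even_odd X w)
  rw [map_sub, map_mul, map_mul] at h
  exact h

theorem toU_odd_odd (w z : oddPart) :
    toU (0, w) * toU (0, z) + toU (0, z) * toU (0, w) = toU (formBracket w z, 0) := by
  have h := RingQuot.mkAlgHom_rel ℂ (EnvRel.odd_odd w z)
  rw [map_add, map_mul, map_mul] at h
  exact h

def toU0 : evenPart →ₗ[ℂ] U := toU ∘ₗ LinearMap.inl ℂ evenPart oddPart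

def toU1 : oddPart →ₗ[ℂ] U := toU ∘ₗ LinearMap.inr ℂ evenPart oddPart

theorem toU0_apply (X : evenPart) : toU0 X = toU (X, 0) := rfl

theorem toU1_apply (w : oddPart) : toU1 w = toU (0, w) := rfl

/-- The isomorphism from the algebra given by generators and relations onto `U₋`. -/
def Neg.toUminus : Neg →ₐ[ℂ] Uminus :=
  Neg.lift E510.dd E510.del
    (fun p => Subtype.ext (by
      change toU1 (cform p.swap) = -toU1 (cform p)
      rw [cform_swap, map_neg]))
    (fun p q => Subtype.ext (by
      change toU1 (cform p) * toU1 (cform q) + toU1 (cform q) * toU1 (cform p) = _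
      rw [toU1_apply, toU1_apply, toU_odd_odd, formBracket_cform, ← toU0_apply, map_sum]
      simp only [map_zsmul, AddSubmonoidClass.coe_finsetSum]
      rfl))
    (fun t p => Subtype.ext (by
      change toU (partialField t, 0) * toU (0, cform p) = toU (0, cform p) * toU (partialField t, 0)
      rw [← sub_eq_zero, toU_even_odd, lieDeriv_partialField_cform]
      exact map_zero toU))
    (fun s t => Subtype.ext (by
      change toU (partialField s, 0) * toU (partialField t, 0) =
        toU (partialField t, 0) * toU (partialField s, 0)
      rw [← sub_eq_zero, toU_even_even, show vectorBracket (partialField s) (partialField t) = 0 by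
        ext1; funext i
        rw [vectorBracket_partialField_val, partialField_val, MvPowerSeries.pderiv_C, neg_zero]
        rfl]
      exact map_zero toU))

@[simp] theorem Neg.toUminus_d (p : Fin 5 × Fin 5) : Neg.toUminus (Neg.d p) = E510.dd p :=
  Neg.lift_d ..

@[simp] theorem Neg.toUminus_del (t : Fin 5) : Neg.toUminus (Neg.del t) = E510.del t :=
  Neg.lift_del ..

/-- U₋ acts on the model by left multiplication, so u ⊗ v is recovered as u applied to 1 ⊗ v. This
is the source of the freeness of M(V) over U(L₋). -/
theorem rhoU_toUminus (u : Neg) (m : Model V) :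
    rhoU ((Neg.toUminus u : Uminus) : U) m = u • m := by
  induction u using Neg.induction with
  | one => simp
  | add a b ha hb => rw [map_add, add_smul, ← ha, ← hb]; simp
  | smul c a ha => rw [map_smul, smul_assoc, ← ha]; simp
  | d_mul p a ha =>
    rw [map_mul, Neg.toUminus_d, mul_smul, ← ha]
    change rhoU (toU (0, cform p) * _) m = _
    rw [map_mul, rhoU_odd, Module.End.mul_apply, rho1_cform]

/-- The map `u ⊗ v ↦ u (1 ⊗ v)` to the model. -/
def preModel : U ⊗[ℂ] V →ₗ[ℂ] Model V :=
  TensorProduct.lift ((LinearMap.lcomp ℂ _ (TensorProduct.mk ℂ Neg V 1)) ∘ₗ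
    (rhoU (V := V)).toLinearMap)

theorem preModel_tmul (u : U) (v : V) :
    preModel (u ⊗ₜ[ℂ] v) = rhoU u ((1 : Neg) ⊗ₜ[ℂ] v) := rfl

theorem preModel_smul (u : U) (x : U ⊗[ℂ] V) : preModel (u • x) = rhoU u (preModel x) := by
  induction x using TensorProduct.induction_on with
  | zero => simp
  | add x y hx hy => rw [smul_add, map_add, map_add, hx, hy, map_add]
  | tmul a v =>
    rw [TensorProduct.smul_tmul', smul_eq_mul, preModel_tmul, preModel_tmul, map_mul]; rfl

theorem preModel_eq_zero (x : U ⊗[ℂ] V) (hx : x ∈ vermaRelations V) : preModel x = 0 := by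
  rw [vermaRelations] at hx
  induction hx using Submodule.span_induction with
  | mem x h =>
    rcases h with ⟨u, X, v, hX, rfl⟩ | ⟨u, w, v, hw, rfl⟩
    · rw [map_sub, preModel_tmul, preModel_tmul, map_mul, Module.End.mul_apply, rhoU_even,
        rho0_one_of_vanish X hX, sub_self]
    · rw [preModel_tmul, map_mul, Module.End.mul_apply, rhoU_odd, rho1_one_of_vanish w hw,
        map_zero]
  | zero => exact map_zero _
  | add x y _ _ hx hy => rw [map_add, hx, hy, add_zero]
  | smul u x _ hx => rw [preModel_smul, hx, map_zero]

/-- The comparison map from the generalized Verma module to the model. -/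
def toModel : Verma V →+ Model V :=
  QuotientAddGroup.lift (vermaRelations V).toAddSubgroup (preModel (V := V)).toAddMonoidHom
    preModel_eq_zero

theorem toModel_mk (x : U ⊗[ℂ] V) : toModel ((vermaRelations V).mkQ x) = preModel x := rfl

theorem toModel_vtensor (u : U) (v : V) :
    toModel (vtensor u v) = rhoU u ((1 : Neg) ⊗ₜ[ℂ] v) := rfl

theorem toModel_smul (u : U) (m : Verma V) : toModel (u • m) = rhoU u (toModel m) := by
  obtain ⟨x, rfl⟩ := (vermaRelations V).mkQ_surjective m
  rw [← map_smul, toModel_mk, toModel_mk, preModel_smul]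

theorem smul_vtensor (u u' : U) (v : V) : u • vtensor u' v = vtensor (u * u') v := rfl

theorem vtensor_mul_even (u : U) (X : evenPart) (hX : ∀ i, val0 (X.1 i) = 0) (v : V) :
    vtensor (u * toU (X, 0)) v = vtensor u ⁅linearPart X, v⁆ := by
  rw [← sub_eq_zero]
  change (vermaRelations V).mkQ _ - (vermaRelations V).mkQ _ = 0
  rw [← map_sub]
  exact (Submodule.Quotient.mk_eq_zero _).mpr (Submodule.subset_span (Or.inl ⟨u, X, v, hX, rfl⟩))

theorem vtensor_mul_odd (u : U) (w : oddPart) (hw : ∀ i j, val0 (w.1 i j) = 0) (v : V) :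
    vtensor (u * toU (0, w)) v = 0 :=
  (Submodule.Quotient.mk_eq_zero _).mpr (Submodule.subset_span (Or.inr ⟨u, w, v, hw, rfl⟩))

/-- The comparison map from the model to the generalized Verma module. -/
def ofModel : Model V →ₗ[ℂ] Verma V :=
  ((vermaRelations V).mkQ.restrictScalars ℂ) ∘ₗ
    TensorProduct.map (Uminus.val.comp Neg.toUminus).toLinearMap LinearMap.id

theorem ofModel_tmul (u : Neg) (v : V) :
    ofModel (u ⊗ₜ v) = vtensor ((Neg.toUminus u : Uminus) : U) v := rfl

/-- The half of Poincaré–Birkhoff–Witt that is needed: `ofModel` is injective, so an identity in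
M(V) between elements with coefficients in U₋ can be read off in `Neg ⊗ V`. -/
theorem toModel_ofModel (m : Model V) : toModel (ofModel m) = m := by
  induction m using TensorProduct.induction_on with
  | zero => simp
  | add x y hx hy => rw [map_add, map_add, hx, hy]
  | tmul u v =>
    rw [ofModel_tmul, toModel_vtensor, rhoU_toUminus, TensorProduct.smul_tmul', smul_eq_mul, mul_one]

theorem ofModel_d_smul (p : Fin 5 × Fin 5) (m : Model V) :
    ofModel (Neg.d p • m) = toU (0, cform p) • ofModel m := by
  induction m using TensorProduct.induction_on with
  | zero => simp
  | add x y hx hy => rw [smul_add, map_add, hx, hy, map_add, smul_add]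
  | tmul u v =>
    rw [TensorProduct.smul_tmul', ofModel_tmul, ofModel_tmul, smul_vtensor, smul_eq_mul, map_mul,
      Neg.toUminus_d]
    rfl

theorem ofModel_one (v : V) : ofModel ((1 : Neg) ⊗ₜ v) = vtensor 1 v := by
  rw [ofModel_tmul, map_one]; rfl

theorem ofModel_del_one (t : Fin 5) (v : V) :
    ofModel (Neg.del t ⊗ₜ v) = toU (partialField t, 0) • vtensor 1 v := by
  rw [ofModel_tmul, smul_vtensor, mul_one, Neg.toUminus_del]; rfl

theorem ofModel_d_one (p : Fin 5 × Fin 5) (v : V) :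
    ofModel (Neg.d p ⊗ₜ v) = toU (0, cform p) • vtensor 1 v := by
  rw [ofModel_tmul, smul_vtensor, mul_one, Neg.toUminus_d]; rfl

/-- The comparison map from the model is compatible with the action of `L`. -/
theorem ofModel_rho (m : Model V) :
    (∀ X, ofModel (rho0 X m) = toU (X, 0) • ofModel m) ∧
    ∀ w, ofModel (rho1 w m) = toU (0, w) • ofModel m := by
  induction m using Model.induction with
  | one v =>
    constructor
    · intro X
      induction X using evenPart.induction with
      | add X Y hX hY =>
        rw [map_add, LinearMap.add_apply, map_add, hX, hY, ← toU0_apply, ← toU0_apply, ← toU0_apply,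
          map_add, add_smul]
      | smul c X hX =>
        rw [map_smul, LinearMap.smul_apply, map_smul, hX, ← toU0_apply, ← toU0_apply, map_smul,
          smul_assoc]
      | const t =>
        rw [rho0_partialField, TensorProduct.smul_tmul', smul_eq_mul, mul_one, ofModel_del_one,
          ofModel_one]
      | vanish X hX =>
        rw [rho0_one_of_vanish X hX, ofModel_one, ofModel_one, smul_vtensor, mul_one,
          ← one_mul (toU (X, 0)), vtensor_mul_even 1 X hX]
    · intro w
      induction w using oddPart.induction with
      | add X Y hX hY =>
        rw [map_add, LinearMap.add_apply, map_add, hX, hY, ← toU1_apply, ← toU1_apply, ← toU1_apply,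
          map_add, add_smul]
      | smul c X hX =>
        rw [map_smul, LinearMap.smul_apply, map_smul, hX, ← toU1_apply, ← toU1_apply, map_smul,
          smul_assoc]
      | const t =>
        rw [rho1_cform, TensorProduct.smul_tmul', smul_eq_mul, mul_one, ofModel_d_one,
          ofModel_one]
      | vanish w hw =>
        rw [rho1_one_of_vanish w hw, map_zero, ofModel_one, smul_vtensor, mul_one,
          ← one_mul (toU (0, w)), vtensor_mul_odd 1 w hw]
  | add m m' h h' =>
    refine ⟨fun X => ?_, fun w => ?_⟩
    · rw [map_add, map_add, h.1, h'.1, map_add, smul_add]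
    · rw [map_add, map_add, h.2, h'.2, map_add, smul_add]
  | d_smul p m h =>
    refine ⟨fun X => ?_, fun w => ?_⟩
    · rw [rho0_d_smul, map_add, ofModel_d_smul, h.1, h.2, ofModel_d_smul, ← toU_even_odd,
        ← mul_smul, ← mul_smul, ← add_smul]
      congr 1; abel
    · rw [rho1_d_smul, map_add, map_neg, ofModel_d_smul, h.1, h.2, ofModel_d_smul, ← toU_odd_odd,
        ← mul_smul, ← mul_smul, ← neg_smul, ← add_smul]
      congr 1; abel

end Compare

/-! ### Linear vector fields and linear forms -/

/-- Vector fields with homogeneous linear coefficients. -/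
def IsLinField (X : evenPart) : Prop :=
  (∀ i, val0 (X.1 i) = 0) ∧ ∀ i j k, pd i (pd j (X.1 k)) = 0

/-- Closed two-forms with homogeneous linear coefficients. -/
def IsLinForm (w : oddPart) : Prop :=
  (∀ i j, val0 (w.1 i j) = 0) ∧ ∀ k l i j, pd k (pd l (w.1 i j)) = 0

theorem eq_C_of_pd_eq_zero (f : PS) (h : ∀ k, pd k f = 0) : f = MvPowerSeries.C (val0 f) := by
  refine MvPowerSeries.pderiv.ext (R := ℂ) (fun k => ?_) (by simp)
  rw [h k, MvPowerSeries.pderiv_C]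

theorem eq_sum_cform (w : oddPart) (h : ∀ k i j, pd k (w.1 i j) = 0) :
    w = (1 / 2 : ℂ) • ∑ i, ∑ j, val0 (w.1 i j) • cform (i, j) := by
  ext1; funext a b
  have h2 : ((1 / 2 : ℂ) • ∑ i, ∑ j, val0 (w.1 i j) • cform (i, j) : oddPart).1 a b =
      (1 / 2 : ℂ) • ∑ i, ∑ j, val0 (w.1 i j) • (cform (i, j)).1 a b := by
    simp only [Submodule.coe_smul, Submodule.coe_sum, Pi.smul_apply, Finset.sum_apply]
  rw [h2]
  have h3 : ∑ i, ∑ j, val0 (w.1 i j) • (cform (i, j)).1 a b =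
      MvPowerSeries.C (val0 (w.1 a b) - val0 (w.1 b a)) := by
    simp only [constForm_val, map_sub, smul_sub, Finset.sum_sub_distrib, ite_and]
    congr 1
    · rw [Finset.sum_eq_single a, Finset.sum_eq_single b] <;>
        simp +contextual [eq_comm, MvPowerSeries.smul_eq_C_mul]
    · rw [Finset.sum_eq_single b, Finset.sum_eq_single a] <;>
        simp +contextual [eq_comm, MvPowerSeries.smul_eq_C_mul]
  rw [h3, w.2.1 a b, map_neg, sub_neg_eq_add, ← two_mul, MvPowerSeries.smul_eq_C_mul, ← map_mul,
    eq_C_of_pd_eq_zero (w.1 a b) fun k => h k a b]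
  congr 1
  simp

theorem pd_lieDeriv_cform (X : evenPart) (hX : IsLinField X) (p : Fin 5 × Fin 5) (k i j : Fin 5) :
    pd k ((lieDeriv X (cform p)).1 i j) = 0 := by
  change pd k (∑ m, (X.1 m * pd m ((cform p).1 i j) + pd i (X.1 m) * (cform p).1 m j +
    pd j (X.1 m) * (cform p).1 i m)) = 0
  rw [map_sum]
  refine Finset.sum_eq_zero fun m _ => ?_
  simp only [constForm_val, MvPowerSeries.pderiv_C, map_add, Derivation.leibniz, hX.2, smul_zero,
    add_zero, mul_zero, map_zero]

theorem formBracket_cform_val (z : oddPart) (p : Fin 5 × Fin 5) (t : Fin 5) :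
    (formBracket z (cform p)).1 t =
      (1 / 2 : ℂ) • ∑ i, ∑ j, eps ![i, j, p.1, p.2, t] • z.1 i j := by
  rw [formBracket_val, pairSum_cform, smul_smul]
  norm_num

theorem IsLinForm.formBracket_cform {z : oddPart} (hz : IsLinForm z) (p : Fin 5 × Fin 5) :
    IsLinField (formBracket z (cform p)) := by
  refine ⟨fun i => ?_, fun i j k => ?_⟩
  · exact val0_formBracket _ _ hz.1 i
  · simp only [formBracket_cform_val, Derivation.map_smul, map_sum, map_zsmul, hz.2, smul_zero,
      Finset.sum_const_zero]

theorem eps_cycle_right (i j k l t : Fin 5) : eps ![i, j, t, k, l] = eps ![i, j, k, l, t] := by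
  have h := eps_comp ![i, j, k, l, t] (Equiv.swap 3 4 * Equiv.swap 2 3)
  have hs : Equiv.Perm.sign (Equiv.swap (3 : Fin 5) 4 * Equiv.swap 2 3) = 1 := by decide
  rw [hs, Units.val_one, one_mul] at h
  rw [← h]
  congr 1
  funext a
  fin_cases a <;> rfl

/-- Up to the factor ½ the sum is the total antisymmetrization of the derivatives of z, which
vanishes because z is closed. -/
theorem sum_pd_formBracket_cform (z : oddPart) (k i : Fin 5) :
    ∑ j, pd j ((formBracket z (cform (j, k))).1 i) = 0 := by
  have h := sum_eps_closed z k i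
  simp only [formBracket_cform_val, Derivation.map_smul, map_sum, map_zsmul, eps_cycle_right,
    ← Finset.smul_sum]
  rw [h, smul_zero]

theorem sum_pd_formBracket_cform' (z : oddPart) (j i : Fin 5) :
    ∑ k, pd k ((formBracket z (cform (j, k))).1 i) = 0 := by
  have h := sum_pd_formBracket_cform z j i
  have h2 : ∀ k, formBracket z (cform (j, k)) = -formBracket z (cform (k, j)) := fun k => by
    rw [show ((j, k) : Fin 5 × Fin 5) = (k, j).swap from rfl, cform_swap, ← formBracketₗ_apply,
      map_neg, formBracketₗ_apply]
  have h3 : ∀ k, pd k ((formBracket z (cform (j, k))).1 i) =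
      -pd k ((formBracket z (cform (k, j))).1 i) := fun k => by
    rw [h2, ← map_neg]; rfl
  simp only [h3, Finset.sum_neg_distrib, h, neg_zero]

theorem lieDeriv_cform_val (X : evenPart) (c : Fin 5 × Fin 5) (j k : Fin 5) :
    (lieDeriv X (cform c)).1 j k = ∑ i, pd j (X.1 i) * (cform c).1 i k +
      ∑ i, pd k (X.1 i) * (cform c).1 j i := by
  rw [← Finset.sum_add_distrib]
  change ∑ m, (X.1 m * pd m ((cform c).1 j k) + pd j (X.1 m) * (cform c).1 m k +
    pd k (X.1 m) * (cform c).1 j m) = _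
  refine Finset.sum_congr rfl fun i _ => ?_
  rw [constForm_val _ _ j k, MvPowerSeries.pderiv_C, mul_zero, zero_add]

/-- The trace of the operators `[[z, d_a], d_c]` against the coordinates `a` vanishes. -/
theorem sum_lieDeriv_formBracket_cform (z : oddPart) (c : Fin 5 × Fin 5) :
    ∑ a : Fin 5 × Fin 5, (lieDeriv (formBracket z (cform a)) (cform c)).1 a.1 a.2 = 0 := by
  simp only [lieDeriv_cform_val, Finset.sum_add_distrib, Fintype.sum_prod_type]
  have h1 : ∑ j, ∑ k, ∑ i, pd j ((formBracket z (cform (j, k))).1 i) * (cform c).1 i k = 0 := by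
    rw [Finset.sum_comm]
    refine Finset.sum_eq_zero fun k _ => ?_
    rw [Finset.sum_comm]
    refine Finset.sum_eq_zero fun i _ => ?_
    rw [← Finset.sum_mul, sum_pd_formBracket_cform, zero_mul]
  have h2 : ∑ j, ∑ k, ∑ i, pd k ((formBracket z (cform (j, k))).1 i) * (cform c).1 j i = 0 := by
    refine Finset.sum_eq_zero fun k _ => ?_
    rw [Finset.sum_comm]
    refine Finset.sum_eq_zero fun i _ => ?_
    rw [← Finset.sum_mul, sum_pd_formBracket_cform', zero_mul]
  rw [h1, h2, add_zero]

/-! ### Contractions on the model -/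

theorem Neg.contr_constPart_mul (a : Fin 5 × Fin 5) (w : oddPart) (u : Neg) :
    Neg.contr a (constPart w * u) = val0 (w.1 a.1 a.2) • u - constPart w * Neg.contr a u := by
  have h : ∑ i, ∑ j, val0 (w.1 i j) * Neg.pairing a (i, j) = 2 * val0 (w.1 a.1 a.2) := by
    have h2 : ∑ i, ∑ j, val0 (w.1 i j) * Neg.pairing a (i, j) =
        val0 (w.1 a.1 a.2) - val0 (w.1 a.2 a.1) := by
      rw [← Fintype.sum_prod_type' (fun i j => val0 (w.1 i j) * Neg.pairing a (i, j))]
      simp only [Neg.pairing, mul_sub, Finset.sum_sub_distrib, mul_ite, mul_one, mul_zero,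
        Prod.mk.eta, Finset.sum_ite_eq', Finset.mem_univ, if_true]
      rfl
    rw [h2, w.2.1 a.1 a.2, map_neg]; ring
  rw [constPart_apply]
  simp only [smul_mul_assoc, Finset.sum_mul, map_smul, map_sum, Neg.contr_d_mul, smul_sub,
    Finset.sum_sub_distrib, smul_smul, ← Finset.sum_smul, h]
  congr 2
  ring

theorem Neg.anti_constPart (w : oddPart) : Neg.anti (constPart w) = Complex.I • constPart w := by
  rw [constPart_apply]
  simp only [map_smul, map_sum, Neg.anti_d, Finset.smul_sum, smul_comm Complex.I]

section Model

variable {V : Type*} [AddCommGroup V] [Module ℂ V] [LieRingModule sl5 V] [LieModule ℂ sl5 V]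

theorem rho1_of_pd_eq_zero (w : oddPart) (h : ∀ k i j, pd k (w.1 i j) = 0) (m : Model V) :
    rho1 w m = constPart w • m := by
  conv_lhs => rw [eq_sum_cform w h]
  rw [constPart_apply]
  simp only [map_smul, map_sum, LinearMap.smul_apply, LinearMap.sum_apply, rho1_cform, smul_assoc,
    Finset.sum_smul]

/-- The matrix coefficients `[X, d_p]` of a linear vector field. -/
abbrev formPart (X : evenPart) (p : Fin 5 × Fin 5) : Neg := constPart (lieDeriv X (cform p))

theorem IsLinField.rho0_d_smul {X : evenPart} (hX : IsLinField X) (p : Fin 5 × Fin 5)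
    (m : Model V) : rho0 X (Neg.d p • m) = Neg.d p • rho0 X m + formPart X p • m := by
  rw [E510.rho0_d_smul, rho1_of_pd_eq_zero _ (pd_lieDeriv_cform X hX p)]

theorem IsLinField.rho0_one {X : evenPart} (hX : IsLinField X) (v : V) :
    rho0 X ((1 : Neg) ⊗ₜ v) = (1 : Neg) ⊗ₜ[ℂ] ⁅linearPart X, v⁆ := rho0_one_of_vanish X hX.1 v

theorem smul_tmul_eq (a b : Neg) (v : V) : a • (b ⊗ₜ[ℂ] v : Model V) = (a * b) ⊗ₜ v := rfl

theorem IsLinField.rho0_d_tmul {X : evenPart} (hX : IsLinField X) (p : Fin 5 × Fin 5) (v : V) :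
    rho0 X (Neg.d p ⊗ₜ v) = Neg.d p ⊗ₜ[ℂ] ⁅linearPart X, v⁆ + formPart X p ⊗ₜ[ℂ] v := by
  have h := hX.rho0_d_smul p ((1 : Neg) ⊗ₜ[ℂ] v)
  simpa only [hX.rho0_one, smul_tmul_eq, mul_one] using h

theorem IsLinField.rho0_d_mul_d_tmul {X : evenPart} (hX : IsLinField X) (p q : Fin 5 × Fin 5)
    (v : V) : rho0 X ((Neg.d p * Neg.d q) ⊗ₜ v) = (Neg.d p * Neg.d q) ⊗ₜ[ℂ] ⁅linearPart X, v⁆ +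
      (formPart X p * Neg.d q + Neg.d p * formPart X q) ⊗ₜ[ℂ] v := by
  rw [← smul_tmul_eq, hX.rho0_d_smul, hX.rho0_d_tmul, smul_add, smul_tmul_eq, smul_tmul_eq,
    smul_tmul_eq, TensorProduct.add_tmul]
  abel

theorem IsLinField.rho0_triple {X : evenPart} (hX : IsLinField X) (p q r : Fin 5 × Fin 5)
    (v : V) : rho0 X ((Neg.d p * Neg.d q * Neg.d r) ⊗ₜ v) =
      (Neg.d p * Neg.d q * Neg.d r) ⊗ₜ[ℂ] ⁅linearPart X, v⁆ +
      (formPart X p * Neg.d q * Neg.d r + Neg.d p * formPart X q * Neg.d r +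
        Neg.d p * Neg.d q * formPart X r) ⊗ₜ[ℂ] v := by
  rw [mul_assoc, ← smul_tmul_eq, hX.rho0_d_smul, hX.rho0_d_mul_d_tmul, smul_add, smul_tmul_eq,
    smul_tmul_eq, smul_tmul_eq]
  simp only [TensorProduct.add_tmul, mul_add, mul_assoc]
  abel

/-- Each passage of z across a d changes the sign and leaves the linear field [z, d] in its place;
that field then acts on the remaining factors as a derivation. The term in which z reaches 1 ⊗ v
vanishes, z having positive degree. -/
theorem IsLinForm.rho1_triple {z : oddPart} (hz : IsLinForm z) (p q r : Fin 5 × Fin 5)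
    (v : V) : rho1 z ((Neg.d p * Neg.d q * Neg.d r) ⊗ₜ v) =
      (Neg.d p * Neg.d q) ⊗ₜ[ℂ] ⁅linearPart (formBracket z (cform r)), v⁆ -
      (Neg.d p * Neg.d r) ⊗ₜ[ℂ] ⁅linearPart (formBracket z (cform q)), v⁆ +
      (Neg.d q * Neg.d r) ⊗ₜ[ℂ] ⁅linearPart (formBracket z (cform p)), v⁆ +
      (formPart (formBracket z (cform p)) q * Neg.d r +
        Neg.d q * formPart (formBracket z (cform p)) r -
        Neg.d p * formPart (formBracket z (cform q)) r) ⊗ₜ[ℂ] v := by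
  have e : (Neg.d p * Neg.d q * Neg.d r) ⊗ₜ[ℂ] v =
      Neg.d p • Neg.d q • Neg.d r • ((1 : Neg) ⊗ₜ[ℂ] v : Model V) := by
    simp only [smul_tmul_eq, mul_one, mul_assoc]
  rw [e, rho1_d_smul, rho1_d_smul, rho1_d_smul, rho1_one_of_vanish z hz.1,
    (hz.formBracket_cform r).rho0_one]
  simp only [smul_tmul_eq, mul_one, (hz.formBracket_cform q).rho0_d_tmul,
    (hz.formBracket_cform p).rho0_d_mul_d_tmul, smul_zero, neg_zero, zero_add, smul_add, smul_neg,
    TensorProduct.add_tmul, TensorProduct.sub_tmul]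
  abel

/-- The contraction on the model. -/
def contrM (a : Fin 5 × Fin 5) : Model V →ₗ[ℂ] Model V := (Neg.contr a).rTensor V

theorem contrM_tmul (a : Fin 5 × Fin 5) (u : Neg) (v : V) :
    contrM a (u ⊗ₜ v) = Neg.contr a u ⊗ₜ[ℂ] v := rfl

theorem contrM_d_smul (a p : Fin 5 × Fin 5) (m : Model V) :
    contrM a (Neg.d p • m) = Neg.pairing a p • m - Neg.d p • contrM a m := by
  induction m using TensorProduct.induction_on with
  | zero => simp
  | add x y hx hy => simp only [smul_add, map_add, hx, hy]; abel
  | tmul u v =>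
    rw [smul_tmul_eq, contrM_tmul, contrM_tmul, Neg.contr_d_mul, smul_tmul_eq,
      TensorProduct.sub_tmul]
    rfl

theorem contrM_constPart_smul (a : Fin 5 × Fin 5) (w : oddPart) (m : Model V) :
    contrM a (constPart w • m) = val0 (w.1 a.1 a.2) • m - constPart w • contrM a m := by
  induction m using TensorProduct.induction_on with
  | zero => simp
  | add x y hx hy => simp only [smul_add, map_add, hx, hy]; abel
  | tmul u v =>
    rw [smul_tmul_eq, contrM_tmul, contrM_tmul, Neg.contr_constPart_mul, smul_tmul_eq,
      TensorProduct.sub_tmul]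
    rfl

/-- The commutators of the contractions with the operators `[z, d_a]` add up to zero. -/
theorem IsLinForm.sum_contrM_comm {z : oddPart} (hz : IsLinForm z) (m : Model V) :
    ∑ a, (contrM a (rho0 (formBracket z (cform a)) m) -
      rho0 (formBracket z (cform a)) (contrM a m)) = 0 := by
  induction m using Model.induction with
  | one v =>
    refine Finset.sum_eq_zero fun a _ => ?_
    rw [(hz.formBracket_cform a).rho0_one, contrM_tmul, contrM_tmul, Neg.contr_one,
      TensorProduct.zero_tmul, TensorProduct.zero_tmul, map_zero, sub_zero]
  | add m m' h h' =>
    have h2 := congrArg₂ (· + ·) h h'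
    simp only [← Finset.sum_add_distrib, add_zero] at h2
    rw [← h2]
    refine Finset.sum_congr rfl fun a _ => ?_
    simp only [map_add]; abel
  | d_smul c m h =>
    -- The commutator of ι_a with X_a = [z, d_a] anticommutes with d_c up to a scalar, the
    -- coefficient at a of [X_a, d_c]. Summed over a, these scalars form the trace that vanishes for
    -- closed z.
    have e : ∀ a, contrM a (rho0 (formBracket z (cform a)) (Neg.d c • m)) -
        rho0 (formBracket z (cform a)) (contrM a (Neg.d c • m)) =
        val0 ((lieDeriv (formBracket z (cform a)) (cform c)).1 a.1 a.2) • m -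
        Neg.d c • (contrM a (rho0 (formBracket z (cform a)) m) -
          rho0 (formBracket z (cform a)) (contrM a m)) := by
      intro a
      have hX := hz.formBracket_cform a
      rw [hX.rho0_d_smul, map_add, contrM_d_smul, contrM_constPart_smul, contrM_d_smul, map_sub,
        map_smul, hX.rho0_d_smul, smul_sub]
      abel
    simp only [e, Finset.sum_sub_distrib, ← Finset.sum_smul, ← Finset.smul_sum]
    rw [← map_sum, sum_lieDeriv_formBracket_cform, map_zero, zero_smul, ← Finset.sum_sub_distrib, h,
      smul_zero, sub_zero]

/-- Evaluation of a functional on the second factor. -/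
def pairM (g : V →ₗ[ℂ] ℂ) : Model V →ₗ[ℂ] Neg :=
  (TensorProduct.rid ℂ Neg).toLinearMap ∘ₗ g.lTensor Neg

@[simp] theorem pairM_tmul (g : V →ₗ[ℂ] ℂ) (u : Neg) (v : V) : pairM g (u ⊗ₜ v) = g v • u := by
  simp [pairM]

/-- Expanding along a basis of `Neg`, the coefficients are functionals on V, and these are
determined by their values. This works in any dimension. -/
theorem eq_zero_of_pairM (m : Model (Module.Dual ℂ V))
    (h : ∀ v : V, pairM (Module.Dual.eval ℂ V v) m = 0) : m = 0 := by
  classical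
  let b := Module.Basis.ofVectorSpace ℂ Neg
  let e := TensorProduct.equivFinsuppOfBasisLeft (N := Module.Dual ℂ V) b
  refine e.injective ?_
  rw [map_zero]
  ext i v
  have h2 : ∀ m : Model (Module.Dual ℂ V), e m i v =
      b.coord i (pairM (Module.Dual.eval ℂ V v) m) := by
    intro m
    induction m using TensorProduct.induction_on with
    | zero => simp
    | add x y hx hy => simp only [map_add, Finsupp.add_apply, LinearMap.add_apply, hx, hy]
    | tmul u f =>
      simp [e, mul_comm]
  rw [h2, h]; simp

/-! ### Duality for singular vectors of degree three -/

/-- The span of the products of three odd generators. -/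
def cubic : Submodule ℂ Neg :=
  Submodule.span ℂ {u | ∃ p q r, u = Neg.d p * Neg.d q * Neg.d r}

/-- A sum over ordered pairs meets d_p twice, as d_p and as -d_{p.swap}. This is the origin of the
factor ½ in `IsLinForm.pairM_rho1`. -/
theorem sum_pairing_smul {M : Type*} [AddCommGroup M] [Module ℂ M] (p : Fin 5 × Fin 5)
    (g : oddPart →ₗ[ℂ] M) : ∑ a, Neg.pairing a p • g (cform a) = (2 : ℂ) • g (cform p) := by
  have h : ∀ a : Fin 5 × Fin 5, (p = a.swap) = (p.swap = a) := fun a => by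
    rw [eq_iff_iff]
    exact ⟨fun h => by rw [h, Prod.swap_swap], fun h => by rw [← h, Prod.swap_swap]⟩
  simp only [Neg.pairing, h, sub_smul, ite_smul, one_smul, zero_smul, Finset.sum_sub_distrib,
    Finset.sum_ite_eq, Finset.mem_univ, if_true]
  rw [cform_swap, map_neg]
  module

theorem Neg.anti_d_mul_d (p q : Fin 5 × Fin 5) :
    Neg.anti (Neg.d p * Neg.d q) = -(Neg.d q * Neg.d p) := by
  rw [Neg.anti_mul, Neg.anti_d, Neg.anti_d, smul_mul_smul_comm, Complex.I_mul_I, neg_one_smul]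

theorem Neg.anti_triple (p q r : Fin 5 × Fin 5) : Neg.anti (Neg.d p * Neg.d q * Neg.d r) =
    -Complex.I • (Neg.d r * Neg.d q * Neg.d p) := by
  rw [Neg.anti_mul, Neg.anti_d_mul_d, Neg.anti_d, mul_neg, smul_mul_assoc, mul_assoc, neg_smul]

variable {W : Type*} [AddCommGroup W] [Module ℂ W] [LieRingModule sl5 W] [LieModule ℂ sl5 W]

/-- On U(L₋) the field acts by a derivation preserving the span of the d_p, where `Neg.anti` is the
scalar i; hence the two commute. The dual action is minus the transpose, so the terms with X before
and after θ trade places between the two sides. Thus the defect of equivariance of the dual vector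
is the image of the defect of the original one. -/
theorem IsLinField.pairM_rho0 {X : evenPart} (hX : IsLinField X) {u : Neg} (hu : u ∈ cubic)
    (θ : V →ₗ[ℂ] W) (f : Module.Dual ℂ W) (v : V) :
    pairM (Module.Dual.eval ℂ V v) (rho0 X (Neg.anti u ⊗ₜ θ.dualMap f) -
      Neg.anti u ⊗ₜ θ.dualMap ⁅linearPart X, f⁆) =
    Neg.anti (pairM f (rho0 X (u ⊗ₜ θ v) - u ⊗ₜ θ ⁅linearPart X, v⁆)) := by
  induction hu using Submodule.span_induction with
  | mem u hu =>
    obtain ⟨p, q, r, rfl⟩ := hu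
    rw [Neg.anti_triple, ← TensorProduct.smul_tmul', ← TensorProduct.smul_tmul', map_smul,
      hX.rho0_triple, hX.rho0_triple]
    simp only [map_sub, map_add, map_smul, pairM_tmul, Neg.anti_mul, Neg.anti_d,
      Neg.anti_constPart, Module.Dual.eval_apply, LinearMap.dualMap_apply, Module.Dual.lie_apply]
    simp only [smul_mul_assoc, mul_smul_comm, smul_smul, mul_assoc, smul_add,
      smul_neg, neg_smul]
    simp only [Complex.I_mul_I]
    module
  | zero => simp
  | add u u' _ _ h h' =>
    simp only [map_add, TensorProduct.add_tmul, map_sub] at h h' ⊢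
    rw [add_sub_add_comm, add_sub_add_comm, h, h']
  | smul c u _ h =>
    have h2 := congrArg (c • ·) h
    simpa only [map_smul, map_sub, smul_sub, ← TensorProduct.smul_tmul'] using h2

/-- In z(u ⊗ θ v) the fields [z, d_p] act after θ, while on the dual side transposition makes them
act before θ. The sum over a converts one into the other: contraction removes a letter d_p from u,
and the difference replaces the action of [z, d_p] after θ by the action before θ. For singular Φ
both parts of the right side vanish after summation over the family. -/
theorem IsLinForm.pairM_rho1 {z : oddPart} (hz : IsLinForm z) {u : Neg} (hu : u ∈ cubic)
    (θ : V →ₗ[ℂ] W) (f : Module.Dual ℂ W) (v : V) :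
    pairM (Module.Dual.eval ℂ V v) (rho1 z (Neg.anti u ⊗ₜ θ.dualMap f)) =
    -Complex.I • Neg.anti (pairM f (rho1 z (u ⊗ₜ θ v) - (1 / 2 : ℂ) • ∑ a,
      (rho0 (formBracket z (cform a)) (contrM a (u ⊗ₜ θ v)) -
        contrM a (u ⊗ₜ θ ⁅linearPart (formBracket z (cform a)), v⁆)))) := by
  induction hu using Submodule.span_induction with
  | mem u hu =>
    obtain ⟨p, q, r, rfl⟩ := hu
    have hc : ∀ a (x : W), contrM a ((Neg.d p * Neg.d q * Neg.d r) ⊗ₜ[ℂ] x) =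
        Neg.pairing a p • (Neg.d q * Neg.d r) ⊗ₜ[ℂ] x -
        Neg.pairing a q • (Neg.d p * Neg.d r) ⊗ₜ[ℂ] x +
        Neg.pairing a r • (Neg.d p * Neg.d q) ⊗ₜ[ℂ] x := by
      intro a x
      have h : Neg.contr a (Neg.d p * Neg.d q * Neg.d r) = Neg.pairing a p • (Neg.d q * Neg.d r) -
          Neg.pairing a q • (Neg.d p * Neg.d r) + Neg.pairing a r • (Neg.d p * Neg.d q) := by
        rw [mul_assoc, Neg.contr_d_mul, Neg.contr_d_mul, ← mul_one (Neg.d r), Neg.contr_d_mul,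
          Neg.contr_one]
        simp only [mul_sub, mul_smul_comm, mul_one, mul_zero, sub_zero]
        abel
      rw [contrM_tmul, h]
      simp only [TensorProduct.add_tmul, TensorProduct.sub_tmul, TensorProduct.smul_tmul']
    -- The defect of equivariance of [z, w] at b ⊗ θ v. Being linear in the form w, it lets the sum
    -- over a collapse to the three letters of the word.
    let g : Neg → oddPart →ₗ[ℂ] Model W := fun b =>
      (rho0 (V := W)).flip (b ⊗ₜ θ v) ∘ₗ formBracketₗ z -
        TensorProduct.mk ℂ Neg W b ∘ₗ θ ∘ₗ (LieModule.toEnd ℂ sl5 V : sl5 →ₗ[ℂ] Module.End ℂ V).flip v ∘ₗ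
          linearPartₗ ∘ₗ formBracketₗ z
    have hg : ∀ b a, g b (cform a) = rho0 (formBracket z (cform a)) (b ⊗ₜ θ v) -
      b ⊗ₜ θ ⁅linearPart (formBracket z (cform a)), v⁆ := fun b a => rfl
    have e : ∑ a, (rho0 (formBracket z (cform a))
          (contrM a ((Neg.d p * Neg.d q * Neg.d r) ⊗ₜ θ v)) -
        contrM a ((Neg.d p * Neg.d q * Neg.d r) ⊗ₜ θ ⁅linearPart (formBracket z (cform a)), v⁆)) =
        (2 : ℂ) • (g (Neg.d q * Neg.d r) (cform p) - g (Neg.d p * Neg.d r) (cform q) +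
          g (Neg.d p * Neg.d q) (cform r)) := by
      rw [smul_add, smul_sub, ← sum_pairing_smul, ← sum_pairing_smul, ← sum_pairing_smul,
        ← Finset.sum_sub_distrib, ← Finset.sum_add_distrib]
      refine Finset.sum_congr rfl fun a _ => ?_
      simp only [hc, hg, map_add, map_sub, map_smul, smul_sub]
      abel
    rw [e, smul_smul, one_div_mul_cancel two_ne_zero, one_smul, hg, hg, hg,
      (hz.formBracket_cform p).rho0_d_mul_d_tmul, (hz.formBracket_cform q).rho0_d_mul_d_tmul,
      (hz.formBracket_cform r).rho0_d_mul_d_tmul, hz.rho1_triple, Neg.anti_triple,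
      ← TensorProduct.smul_tmul', map_smul, hz.rho1_triple]
    simp only [map_sub, map_add, map_smul, pairM_tmul, Neg.anti_mul, Neg.anti_d,
      Neg.anti_constPart, Module.Dual.eval_apply, LinearMap.dualMap_apply, Module.Dual.lie_apply]
    simp only [smul_mul_assoc, mul_smul_comm, smul_smul, smul_add, smul_sub, smul_neg,
      neg_smul, Complex.I_mul_I]
    module
  | zero => simp
  | add u u' _ _ h h' =>
    have h2 := congrArg₂ (· + ·) h h'
    simp only [map_add, map_sub, map_smul, TensorProduct.add_tmul, smul_add, smul_sub, map_sum,
      Finset.sum_add_distrib, Finset.sum_sub_distrib] at h2 ⊢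
    rw [h2]
    abel
  | smul c u _ h =>
    have h2 := congrArg (c • ·) h
    simpa only [map_smul, map_sub, smul_sub, ← TensorProduct.smul_tmul', map_sum,
      Finset.smul_sum, smul_smul, mul_comm c, mul_assoc] using h2

end Model

/-! ### Duality for families: linear fields and linear forms -/

section DualVector

variable {V : Type*} [AddCommGroup V] [Module ℂ V] [LieRingModule sl5 V] [LieModule ℂ sl5 V]
variable {W : Type*} [AddCommGroup W] [Module ℂ W] [LieRingModule sl5 W] [LieModule ℂ sl5 W]
variable {ι : Type*} [Fintype ι] (u : ι → Neg) (θ : ι → V →ₗ[ℂ] W)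

/-- The vector `∑ᵢ uᵢ ⊗ θᵢ(v)`. -/
def familyVec : V →ₗ[ℂ] Model W := ∑ i, TensorProduct.mk ℂ Neg W (u i) ∘ₗ θ i

theorem familyVec_apply (v : V) : familyVec u θ v = ∑ i, u i ⊗ₜ[ℂ] θ i v := by
  simp [familyVec]

/-- The vector `∑ᵢ uᵢ' ⊗ f ∘ θᵢ`, where `u ↦ u'` is the antiautomorphism `Neg.anti`. -/
abbrev dualVec : Module.Dual ℂ W →ₗ[ℂ] Model (Module.Dual ℂ V) :=
  familyVec (fun i => Neg.anti (u i)) fun i => (θ i).dualMap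

variable {u θ}

theorem IsLinField.rho0_dualVec {X : evenPart} (hX : IsLinField X) (hu : ∀ i, u i ∈ cubic)
    (h0 : ∀ v, rho0 X (familyVec u θ v) = familyVec u θ ⁅linearPart X, v⁆)
    (f : Module.Dual ℂ W) : rho0 X (dualVec u θ f) = dualVec u θ ⁅linearPart X, f⁆ := by
  rw [← sub_eq_zero]
  refine eq_zero_of_pairM _ fun v => ?_
  have h := fun i => hX.pairM_rho0 (hu i) (θ i) f v
  have h2 := Finset.sum_congr (rfl : (Finset.univ : Finset ι) = _) fun i _ => h i
  simp only [← map_sum, Finset.sum_sub_distrib, ← familyVec_apply, h0, sub_self, map_zero] at h2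
  exact h2

theorem IsLinForm.rho1_dualVec {z : oddPart} (hz : IsLinForm z) (hu : ∀ i, u i ∈ cubic)
    (h0 : ∀ X, IsLinField X → ∀ v, rho0 X (familyVec u θ v) = familyVec u θ ⁅linearPart X, v⁆)
    (h1 : ∀ v, rho1 z (familyVec u θ v) = 0) (f : Module.Dual ℂ W) :
    rho1 z (dualVec u θ f) = 0 := by
  refine eq_zero_of_pairM _ fun v => ?_
  have h := fun i => hz.pairM_rho1 (hu i) (θ i) f v
  have h2 := Finset.sum_congr (rfl : (Finset.univ : Finset ι) = _) fun i _ => h i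
  -- Equivariance of Φ under X_a = [z, d_a] replaces Φ(X_a v) by X_a Φ(v), so the correction becomes
  -- minus the sum of the commutators of ι_a and X_a on Φ(v), which is zero.
  have h3 : ∑ i, ∑ a, (rho0 (formBracket z (cform a)) (contrM a (u i ⊗ₜ θ i v)) -
      contrM a (u i ⊗ₜ θ i ⁅linearPart (formBracket z (cform a)), v⁆)) = 0 := by
    rw [Finset.sum_comm, ← neg_eq_zero, ← Finset.sum_neg_distrib,
      ← hz.sum_contrM_comm (familyVec u θ v)]
    refine Finset.sum_congr rfl fun a _ => ?_
    rw [Finset.sum_sub_distrib, h0 _ (hz.formBracket_cform a), familyVec_apply, familyVec_apply,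
      ← map_sum, ← map_sum, ← map_sum, neg_sub]
  simp only [← map_sum, ← Finset.smul_sum, Finset.sum_sub_distrib, ← familyVec_apply, h1] at h2
  simp only [Finset.sum_sub_distrib] at h3
  rw [h3] at h2
  simpa using h2

end DualVector

/-! ### Polynomial fields and forms -/

/-- The coordinate `xᵢ`. -/
abbrev coord (i : Fin 5) : PS := MvPowerSeries.X i

theorem pd_coord (i j : Fin 5) : pd i (coord j) = MvPowerSeries.C (if i = j then 1 else 0) := by
  by_cases h : i = j
  · subst h; simp
  · simp [h, MvPowerSeries.pderiv_X_of_ne, Ne.symm h]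

theorem val0_coord (i : Fin 5) : val0 (coord i) = 0 := by simp

/-- The differential of a one-form. -/
def dForm (α : Fin 5 → PS) : oddPart :=
  ⟨fun j k => pd j (α k) - pd k (α j), fun j k => by ring, fun i j k => by
    simp only [map_sub]
    rw [pd_comm i k, pd_comm i j, pd_comm j k (α i)]
    ring⟩

theorem dForm_val (α : Fin 5 → PS) (j k : Fin 5) : (dForm α).1 j k = pd j (α k) - pd k (α j) := rfl

theorem formBracket_dForm (α β : Fin 5 → PS) (t : Fin 5) :
    (formBracket (dForm α) (dForm β)).1 t =
      ∑ i, ∑ j, ∑ k, ∑ l, eps ![i, j, k, l, t] • (pd i (α j) * pd k (β l)) := by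
  have h1 : ∀ z : Fin 5 → Fin 5 → PS, pairSum (dForm α).1 z t =
      (2 : ℂ) • ∑ i, ∑ j, ∑ k, ∑ l, eps ![i, j, k, l, t] • (pd i (α j) * z k l) := by
    intro z
    have e : ∑ i, ∑ j, ∑ k, ∑ l, eps ![i, j, k, l, t] • (pd j (α i) * z k l) =
        -∑ i, ∑ j, ∑ k, ∑ l, eps ![i, j, k, l, t] • (pd i (α j) * z k l) := by
      rw [Finset.sum_comm]
      simp only [← Finset.sum_neg_distrib]
      refine Finset.sum_congr rfl fun i _ => Finset.sum_congr rfl fun j _ =>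
        Finset.sum_congr rfl fun k _ => Finset.sum_congr rfl fun l _ => ?_
      rw [eps_swap_first, neg_smul]
    simp only [pairSum, dForm_val, sub_mul, smul_sub, Finset.sum_sub_distrib]
    rw [e]; module
  have h2 : ∑ i, ∑ j, ∑ k, ∑ l, eps ![i, j, k, l, t] • (pd i (α j) * (dForm β).1 k l) =
      (2 : ℂ) • ∑ i, ∑ j, ∑ k, ∑ l, eps ![i, j, k, l, t] • (pd i (α j) * pd k (β l)) := by
    have e : ∑ i, ∑ j, ∑ k, ∑ l, eps ![i, j, k, l, t] • (pd i (α j) * pd l (β k)) =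
        -∑ i, ∑ j, ∑ k, ∑ l, eps ![i, j, k, l, t] • (pd i (α j) * pd k (β l)) := by
      simp only [← Finset.sum_neg_distrib]
      refine Finset.sum_congr rfl fun i _ => Finset.sum_congr rfl fun j _ => ?_
      rw [Finset.sum_comm]
      refine Finset.sum_congr rfl fun k _ => Finset.sum_congr rfl fun l _ => ?_
      rw [eps_swap_second, neg_smul]
    simp only [dForm_val, mul_sub, smul_sub, Finset.sum_sub_distrib]
    rw [e]; module
  rw [formBracket_val, h1, h2, smul_smul, smul_smul]
  norm_num

/-- The one-form `f dx_a`. -/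
abbrev oneForm (f : PS) (a : Fin 5) : Fin 5 → PS := Pi.single a f

theorem oneForm_apply (f : PS) (a i : Fin 5) :
    oneForm f a i = MvPowerSeries.C (if i = a then 1 else 0) * f := by
  by_cases h : i = a
  · subst h; simp [oneForm]
  · simp [oneForm, h]

/-- The vector field `f ∂_k`, if its divergence vanishes. -/
def field (f : PS) (k : Fin 5) (h : pd k f = 0) : evenPart :=
  ⟨Pi.single k f, by
    refine Finset.sum_eq_zero fun i _ => ?_
    by_cases hi : i = k
    · subst hi; simpa using h
    · simp [Pi.single_eq_of_ne hi]⟩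

theorem field_val (f : PS) (k : Fin 5) (h : pd k f = 0) (i : Fin 5) :
    (field f k h).1 i = MvPowerSeries.C (if i = k then 1 else 0) * f := oneForm_apply f k i

theorem pd_C_mul (i : Fin 5) (c : ℂ) (f : PS) :
    pd i (MvPowerSeries.C c * f) = MvPowerSeries.C c * pd i f := by
  rw [← MvPowerSeries.smul_eq_C_mul, ← MvPowerSeries.smul_eq_C_mul, Derivation.map_smul]

theorem pd_coord_mul (i a b : Fin 5) : pd i (coord a * coord b) =
    MvPowerSeries.C (if i = a then 1 else 0) * coord b +
      MvPowerSeries.C (if i = b then 1 else 0) * coord a := by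
  rw [Derivation.leibniz, pd_coord, pd_coord, smul_eq_mul, smul_eq_mul]
  ring

theorem pd_coord_mul_of_ne {i a b : Fin 5} (ha : i ≠ a) (hb : i ≠ b) :
    pd i (coord a * coord b) = 0 := by
  rw [pd_coord_mul]; simp [ha, hb]

theorem isLinForm_dForm_quadratic (c : ℂ) (a b l : Fin 5) :
    IsLinForm (dForm (oneForm (MvPowerSeries.C c * (coord a * coord b)) l)) := by
  refine ⟨fun i j => ?_, fun p q i j => ?_⟩
  · simp only [dForm_val, oneForm_apply, pd_C_mul, pd_coord_mul, map_sub, map_mul, map_add, val0_coord, mul_zero,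
      add_zero, sub_zero]
  · simp only [dForm_val, oneForm_apply, pd_C_mul, pd_coord_mul, map_sub, map_add, pd_coord, MvPowerSeries.pderiv_C,
      mul_zero, add_zero, sub_zero]

theorem formBracket_oneForm (f g : PS) (a c t : Fin 5) :
    (formBracket (dForm (oneForm f a)) (dForm (oneForm g c))).1 t =
      ∑ i, ∑ k, eps ![i, a, k, c, t] • (pd i f * pd k g) := by
  rw [formBracket_dForm]
  simp only [oneForm_apply, pd_C_mul]
  refine Finset.sum_congr rfl fun i _ => ?_
  rw [Finset.sum_eq_single a]
  · refine Finset.sum_congr rfl fun k _ => ?_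
    rw [Finset.sum_eq_single c]
    · simp
    · intro l _ hl; simp [hl]
    · simp
  · intro l _ hl; simp [hl]
  · simp

/-- `xᵢ² ∂_k` is up to sign a bracket of two linear forms. -/
theorem formBracket_dForm_quadratic (i a b c k : Fin 5) (hik : k ≠ i)
    (hinj : Function.Injective ![i, a, b, c, k]) :
    formBracket (dForm (oneForm (MvPowerSeries.C (1 / 2) * (coord i * coord i)) a))
      (dForm (oneForm (MvPowerSeries.C 1 * (coord i * coord b)) c)) =
    eps ![i, a, b, c, k] • field (coord i * coord i) k (pd_coord_mul_of_ne hik hik) := by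
  ext1; funext t
  -- The first form is xᵢ dxᵢ ∧ dx_a. Of the second, d(xᵢ x_b dx_c), only xᵢ dx_b ∧ dx_c
  -- contributes, because dxᵢ cannot be repeated.
  have h0 : eps ![i, a, i, c, t] = 0 := eps_of_not_injective _ fun h => by
    simpa using @h 0 2 rfl
  have h1 : (formBracket (dForm (oneForm (MvPowerSeries.C (1 / 2) * (coord i * coord i)) a))
      (dForm (oneForm (MvPowerSeries.C 1 * (coord i * coord b)) c))).1 t =
      eps ![i, a, b, c, t] • (coord i * coord i) := by
    rw [formBracket_oneForm, Finset.sum_eq_single i]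
    · have hb : b ≠ i := fun h => by
        have := @hinj 2 0 h
        simp at this
      rw [Finset.sum_eq_single b]
      · simp only [pd_C_mul, pd_coord_mul, if_true, if_neg hb, map_one, map_zero, one_mul, zero_mul,
          zero_add, ← two_mul]
        rw [← mul_assoc, show (2 : PS) = MvPowerSeries.C 2 from (map_ofNat _ _).symm, ← map_mul]
        norm_num
      · intro r _ hr
        by_cases hri : r = i
        · rw [hri, h0, zero_smul]
        · simp only [pd_C_mul, pd_coord_mul, if_neg hr, if_neg hri, map_zero, zero_mul, add_zero,
            mul_zero, smul_zero]
      · simp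
    · intro p _ hp
      simp only [pd_C_mul, pd_coord_mul, if_neg hp, map_zero, zero_mul, add_zero, mul_zero,
        smul_zero, Finset.sum_const_zero]
    · simp
  rw [h1]
  change _ = eps ![i, a, b, c, k] • (field (coord i * coord i) k _).1 t
  rw [field_val]
  by_cases h : t = k
  · subst h; simp
  · rw [eps_of_not_injective ![i, a, b, c, t]]
    · simp [h]
    · intro hinj'
      obtain ⟨s, hs⟩ := Finite.surjective_of_injective hinj t
      fin_cases s
      · have := @hinj' 0 4 hs; simp at this
      · have := @hinj' 1 4 hs; simp at this
      · have := @hinj' 2 4 hs; simp at this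
      · have := @hinj' 3 4 hs; simp at this
      · exact h hs.symm

theorem exists_injective_of_ne : ∀ i k : Fin 5, k ≠ i →
    ∃ a b c, Function.Injective ![i, a, b, c, k] := by
  have h : ∀ i k : Fin 5, k ≠ i → ∃ a b c, [i, a, b, c, k].Nodup := by decide
  intro i k hik
  obtain ⟨a, b, c, h⟩ := h i k hik
  exact ⟨a, b, c, List.nodup_ofFn.mp (by simpa [List.ofFn_succ] using h)⟩

theorem eps_smul_eps_smul {M : Type*} [AddCommGroup M] {f : Fin 5 → Fin 5}
    (hf : Function.Injective f) (m : M) : eps f • eps f • m = m := by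
  have h := eps_perm (Equiv.ofBijective f (Finite.injective_iff_bijective.mp hf))
  rw [Equiv.coe_ofBijective] at h
  rw [h, smul_smul, ← Units.val_mul, Int.units_mul_self, Units.val_one, one_smul]

/-! ### Orders of vanishing -/

/-- The series vanishes to the second order at the origin. -/
def Ord2 (f : PS) : Prop := val0 f = 0 ∧ ∀ i, val0 (pd i f) = 0

/-- The series vanishes to the third order at the origin. -/
def Ord3 (f : PS) : Prop := val0 f = 0 ∧ ∀ i, Ord2 (pd i f)

theorem val0_quadratic (p q a b : Fin 5) : val0 (pd p (pd q (coord a * coord b))) =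
    (if p = a ∧ q = b then 1 else 0) + if p = b ∧ q = a then 1 else 0 := by
  rw [pd_coord_mul, map_add, pd_C_mul, pd_C_mul, pd_coord, pd_coord]
  simp only [map_add, map_mul, MvPowerSeries.constantCoeff_C, ← ite_and, mul_ite, mul_one, mul_zero]
  rw [add_comm]
  
theorem sum_ite_three (F : Fin 5 → Fin 5 → Fin 5 → ℂ) (m s r : Fin 5) :
    ∑ k, ∑ i, ∑ a, F k i a * (if m = k ∧ s = i ∧ r = a then 1 else 0) = F m s r := by
  rw [Finset.sum_eq_single m, Finset.sum_eq_single s, Finset.sum_eq_single r] <;>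
    simp +contextual [eq_comm]

theorem ite_and_eq_mul (P Q : Prop) [Decidable P] [Decidable Q] :
    (if P ∧ Q then 1 else 0 : ℂ) = (if P then 1 else 0) * (if Q then 1 else 0) := by
  by_cases hP : P <;> simp [hP]

/-- A divergence free quadratic part as a combination of the quadratic parts of the fields
`2 x_a x_i ∂_k - δ_{ak} x_i² ∂_i`. -/
theorem sum_quadratic (q : Fin 5 → Fin 5 → Fin 5 → ℂ) (hq : ∀ k i j, q k i j = q k j i)
    (hdiv : ∀ i, ∑ k, q k k i = 0) (m r s : Fin 5) :
    ∑ k, ∑ i, ∑ a, (if i = k then 0 else 1 / 4 * (1 + if a = k then 1 else 0) * q k i a) *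
      (2 * (if m = k then 1 else 0) *
          ((if r = a ∧ s = i then 1 else 0) + if r = i ∧ s = a then 1 else 0) -
        (if a = k then 1 else 0) * (if m = i then 1 else 0) *
          ((if r = i ∧ s = i then 1 else 0) + if r = i ∧ s = i then 1 else 0)) = q m r s := by
  -- Here q is the array of second derivatives. For a ≠ k a monomial is reached from both (i, a) and
  -- (a, i); for a = k only once, since i = k is excluded. Hence the weight 1 + δ_{ak}.
  set F : Fin 5 → Fin 5 → Fin 5 → ℂ := fun k i a =>
    if i = k then 0 else 1 / 4 * (1 + if a = k then 1 else 0) * q k i a with hF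
  have h : ∀ k i a, F k i a * (2 * (if m = k then 1 else 0) *
          ((if r = a ∧ s = i then 1 else 0) + if r = i ∧ s = a then 1 else 0) -
        (if a = k then 1 else 0) * (if m = i then 1 else 0) *
          ((if r = i ∧ s = i then 1 else 0) + if r = i ∧ s = i then 1 else 0)) =
      2 * (F k i a * (if m = k ∧ s = i ∧ r = a then 1 else 0)) +
      2 * (F k i a * (if m = k ∧ r = i ∧ s = a then 1 else 0)) -
      2 * (if k = a then if m = i then (if r = i ∧ s = i then F k i a else 0) else 0 else 0) := by
    intro k i a
    have e : (if k = a then if m = i then (if r = i ∧ s = i then F k i a else 0) else 0 else 0) =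
        F k i a * ((if a = k then 1 else 0) * ((if m = i then 1 else 0) *
          (if r = i ∧ s = i then 1 else 0))) := by
      simp only [eq_comm (a := k) (b := a)]
      split_ifs <;> simp
    rw [e]
    simp only [ite_and_eq_mul]
    ring
  refine (Finset.sum_congr rfl fun k _ => Finset.sum_congr rfl fun i _ =>
    Finset.sum_congr rfl fun a _ => h k i a).trans ?_
  simp only [Finset.sum_add_distrib, Finset.sum_sub_distrib, ← Finset.mul_sum, sum_ite_three,
    Finset.sum_ite_eq, Finset.mem_univ, if_true]
  -- The coefficient of x_m² ∂_m is not matched directly, as i = k is excluded. It comes from the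
  -- correction terms -xᵢ² ∂ᵢ and equals the right value because the divergence vanishes.
  have h4 : ∑ k, F k m k = -(1 / 2) * q m m m := by
    have h5 : ∀ k, F k m k = 1 / 2 * q k k m - if m = k then 1 / 2 * q k k m else 0 := by
      intro k
      simp only [hF, if_true, hq k m k]
      split_ifs <;> ring
    simp only [h5, Finset.sum_sub_distrib, ← Finset.mul_sum, hdiv, Finset.sum_ite_eq,
      Finset.mem_univ, if_true]
    ring
  by_cases hr : r = m <;> by_cases hs : s = m
  · subst hr; subst hs
    simp only [and_self, if_true, h4]
    simp [hF]
  · subst hr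
    simp only [hF, hs, if_false, and_false, Finset.sum_const_zero, if_true, hq r s r]
    ring
  · subst hs
    simp only [hF, hr, if_false, false_and, Finset.sum_const_zero, if_true, hq s s r]
    ring
  · simp only [hF, hr, hs, if_false, false_and, Finset.sum_const_zero, hq m s r]
    ring

/-! ### Elements vanishing to third order annihilate vectors of degree three -/

section Kill

variable {V : Type*} [AddCommGroup V] [Module ℂ V] [LieRingModule sl5 V] [LieModule ℂ sl5 V]

theorem val0_pd_lieDeriv_cform (X : evenPart) (p : Fin 5 × Fin 5) (i j : Fin 5) :
    (lieDeriv X (cform p)).1 i j = ∑ m, (MvPowerSeries.C (((if m = p.1 ∧ j = p.2 then 1 else 0) -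
        (if m = p.2 ∧ j = p.1 then 1 else 0) : ℂ)) * pd i (X.1 m) +
      MvPowerSeries.C (((if i = p.1 ∧ m = p.2 then 1 else 0) -
        (if i = p.2 ∧ m = p.1 then 1 else 0) : ℂ)) * pd j (X.1 m)) := by
  rw [lieDeriv_cform_val, ← Finset.sum_add_distrib]
  refine Finset.sum_congr rfl fun m _ => ?_
  rw [constForm_val, constForm_val, mul_comm, mul_comm (pd j _)]

theorem linearPart_eq_zero {X : evenPart} (hX : ∀ i, Ord2 (X.1 i)) : linearPart X = 0 := by
  ext i j
  rw [linearPart_apply, (hX j).2]; rfl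

theorem rho0_one_of_ord2 {X : evenPart} (hX : ∀ i, Ord2 (X.1 i)) (v : V) :
    rho0 X ((1 : Neg) ⊗ₜ v) = 0 := by
  rw [rho0_one_of_vanish X fun i => (hX i).1, linearPart_eq_zero hX, zero_lie, TensorProduct.tmul_zero]

theorem val0_lieDeriv_cform {X : evenPart} (hX : ∀ i, Ord2 (X.1 i)) (p : Fin 5 × Fin 5)
    (i j : Fin 5) : val0 ((lieDeriv X (cform p)).1 i j) = 0 := by
  rw [val0_pd_lieDeriv_cform, map_sum]
  refine Finset.sum_eq_zero fun m _ => ?_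
  rw [map_add, map_mul, map_mul, (hX m).2, (hX m).2, mul_zero, mul_zero, add_zero]

theorem ord2_lieDeriv_cform {X : evenPart} (hX : ∀ i, Ord3 (X.1 i)) (p : Fin 5 × Fin 5)
    (i j : Fin 5) : Ord2 ((lieDeriv X (cform p)).1 i j) := by
  refine ⟨val0_lieDeriv_cform (fun i => ⟨(hX i).1, fun k => ((hX i).2 k).1⟩) p i j, fun k => ?_⟩
  rw [val0_pd_lieDeriv_cform, map_sum, map_sum]
  refine Finset.sum_eq_zero fun m _ => ?_
  rw [map_add, map_add, pd_C_mul, pd_C_mul, map_mul, map_mul, ((hX m).2 i).2, ((hX m).2 j).2,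
    mul_zero, mul_zero, add_zero]

theorem ord2_formBracket_cform {w : oddPart} (hw : ∀ i j, Ord2 (w.1 i j)) (p : Fin 5 × Fin 5)
    (i : Fin 5) : Ord2 ((formBracket w (cform p)).1 i) := by
  refine ⟨val0_formBracket _ _ (fun i j => (hw i j).1) i, fun k => ?_⟩
  simp only [formBracket_cform_val, Derivation.map_smul, map_sum, map_zsmul,
    MvPowerSeries.constantCoeff_smul, (hw _ _).2, smul_zero, Finset.sum_const_zero]

theorem ord3_formBracket_cform {w : oddPart} (hw : ∀ i j, Ord3 (w.1 i j)) (p : Fin 5 × Fin 5)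
    (i : Fin 5) : Ord3 ((formBracket w (cform p)).1 i) := by
  refine ⟨val0_formBracket _ _ (fun i j => (hw i j).1) i, fun k => ⟨?_, fun l => ?_⟩⟩
  · simp only [formBracket_cform_val, Derivation.map_smul, map_sum, map_zsmul,
      MvPowerSeries.constantCoeff_smul, ((hw _ _).2 _).1, smul_zero, Finset.sum_const_zero]
  · simp only [formBracket_cform_val, Derivation.map_smul, map_sum, map_zsmul,
      MvPowerSeries.constantCoeff_smul, ((hw _ _).2 _).2, smul_zero, Finset.sum_const_zero]

theorem Ord3.ord2 {f : PS} (hf : Ord3 f) : Ord2 f := ⟨hf.1, fun k => (hf.2 k).1⟩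

/-- Fields of positive degree annihilate vectors of degree one. -/
theorem rho0_d_one_of_ord2 {X : evenPart} (hX : ∀ i, Ord2 (X.1 i)) (p : Fin 5 × Fin 5) (v : V) :
    rho0 X (Neg.d p • ((1 : Neg) ⊗ₜ[ℂ] v : Model V)) = 0 := by
  rw [rho0_d_smul, rho0_one_of_ord2 hX, smul_zero, zero_add,
    rho1_one_of_vanish _ (val0_lieDeriv_cform hX p)]

theorem rho1_d_one_of_ord2 {w : oddPart} (hw : ∀ i j, Ord2 (w.1 i j)) (p : Fin 5 × Fin 5) (v : V) :
    rho1 w (Neg.d p • ((1 : Neg) ⊗ₜ[ℂ] v : Model V)) = 0 := by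
  rw [rho1_d_smul, rho1_one_of_vanish _ fun i j => (hw i j).1, smul_zero, neg_zero, zero_add,
    rho0_one_of_ord2 (ord2_formBracket_cform hw p)]

theorem rho0_d_d_one_of_ord3 {X : evenPart} (hX : ∀ i, Ord3 (X.1 i)) (p q : Fin 5 × Fin 5) (v : V) :
    rho0 X (Neg.d p • Neg.d q • ((1 : Neg) ⊗ₜ[ℂ] v : Model V)) = 0 := by
  rw [rho0_d_smul, rho0_d_one_of_ord2 fun i => (hX i).ord2, smul_zero, zero_add,
    rho1_d_one_of_ord2 (ord2_lieDeriv_cform hX p)]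

theorem rho1_d_d_one_of_ord2 {w : oddPart} (hw : ∀ i j, Ord2 (w.1 i j)) (p q : Fin 5 × Fin 5)
    (v : V) : rho1 w (Neg.d p • Neg.d q • ((1 : Neg) ⊗ₜ[ℂ] v : Model V)) = 0 := by
  rw [rho1_d_smul, rho1_d_one_of_ord2 hw, smul_zero, neg_zero, zero_add,
    rho0_d_one_of_ord2 (ord2_formBracket_cform hw p)]

theorem rho0_triple_of_ord3 {X : evenPart} (hX : ∀ i, Ord3 (X.1 i)) (p q r : Fin 5 × Fin 5) (v : V) :
    rho0 X (Neg.d p • Neg.d q • Neg.d r • ((1 : Neg) ⊗ₜ[ℂ] v : Model V)) = 0 := by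
  rw [rho0_d_smul, rho0_d_d_one_of_ord3 hX, smul_zero, zero_add,
    rho1_d_d_one_of_ord2 (ord2_lieDeriv_cform hX p)]

theorem rho1_triple_of_ord3 {w : oddPart} (hw : ∀ i j, Ord3 (w.1 i j)) (p q r : Fin 5 × Fin 5)
    (v : V) : rho1 w (Neg.d p • Neg.d q • Neg.d r • ((1 : Neg) ⊗ₜ[ℂ] v : Model V)) = 0 := by
  rw [rho1_d_smul, rho1_d_d_one_of_ord2 fun i j => (hw i j).ord2, smul_zero, neg_zero, zero_add,
    rho0_d_d_one_of_ord3 (ord3_formBracket_cform hw p)]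

/-- In the grading with deg ∂_t = -2 and deg d_p = -1, fields and forms vanishing to third order
have components only in degrees at least 4 and 5, too high for vectors of degree -3. Each crossing
of a d_p lowers the required order of vanishing step by step. -/
theorem rho_cubic {u : Neg} (hu : u ∈ cubic) (v : V) :
    (∀ X : evenPart, (∀ i, Ord3 (X.1 i)) → rho0 X (u ⊗ₜ v) = 0) ∧
    (∀ w : oddPart, (∀ i j, Ord3 (w.1 i j)) → rho1 w (u ⊗ₜ v) = 0) := by
  induction hu using Submodule.span_induction with
  | mem u hu =>
    obtain ⟨p, q, r, rfl⟩ := hu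
    have e : (Neg.d p * Neg.d q * Neg.d r) ⊗ₜ[ℂ] v =
        Neg.d p • Neg.d q • Neg.d r • ((1 : Neg) ⊗ₜ[ℂ] v : Model V) := by
      simp only [smul_tmul_eq, mul_one, mul_assoc]
    rw [e]
    exact ⟨fun X hX => rho0_triple_of_ord3 hX p q r v, fun w hw => rho1_triple_of_ord3 hw p q r v⟩
  | zero => simp
  | add u u' _ _ h h' =>
    simp only [TensorProduct.add_tmul, map_add]
    exact ⟨fun X hX => by rw [h.1 X hX, h'.1 X hX, add_zero],
      fun w hw => by rw [h.2 w hw, h'.2 w hw, add_zero]⟩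
  | smul c u _ h =>
    simp only [← TensorProduct.smul_tmul', map_smul]
    exact ⟨fun X hX => by rw [h.1 X hX, smul_zero], fun w hw => by rw [h.2 w hw, smul_zero]⟩

theorem anti_mem_cubic {u : Neg} (hu : u ∈ cubic) : Neg.anti u ∈ cubic := by
  induction hu using Submodule.span_induction with
  | mem u hu =>
    obtain ⟨p, q, r, rfl⟩ := hu
    rw [Neg.anti_triple]
    exact Submodule.smul_mem _ _ (Submodule.subset_span ⟨r, q, p, rfl⟩)
  | zero => simp
  | add u u' _ _ h h' => rw [map_add]; exact add_mem h h'
  | smul c u _ h => rw [map_smul]; exact Submodule.smul_mem _ _ h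

end Kill

section Generation

/-! ### Pairs of subspaces closed under the bracket -/

/-- A pair of subspaces of the even and the odd part of `L`, closed under the bracket. -/
structure IsSubalgebra (G0 : Submodule ℂ evenPart) (G1 : Submodule ℂ oddPart) : Prop where
  even_even : ∀ X ∈ G0, ∀ Y ∈ G0, vectorBracket X Y ∈ G0
  even_odd : ∀ X ∈ G0, ∀ w ∈ G1, lieDeriv X w ∈ G1
  odd_odd : ∀ w ∈ G1, ∀ z ∈ G1, formBracket w z ∈ G0
  linear_even : ∀ X, IsLinField X → X ∈ G0
  linear_odd : ∀ w, IsLinForm w → w ∈ G1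
  ord3_even : ∀ X : evenPart, (∀ i, Ord3 (X.1 i)) → X ∈ G0
  ord3_odd : ∀ w : oddPart, (∀ i j, Ord3 (w.1 i j)) → w ∈ G1

variable {G0 : Submodule ℂ evenPart} {G1 : Submodule ℂ oddPart}

/-- Besides i and k there are exactly three indices left, as many as are needed to write xᵢ² ∂_k as
a bracket of two linear forms up to sign. -/
theorem IsSubalgebra.square_mem (h : IsSubalgebra G0 G1) {i k : Fin 5} (hik : k ≠ i) :
    field (coord i * coord i) k (pd_coord_mul_of_ne hik hik) ∈ G0 := by
  obtain ⟨a, b, c, hinj⟩ := exists_injective_of_ne i k hik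
  rw [← eps_smul_eps_smul hinj (field _ _ _), ← formBracket_dForm_quadratic i a b c k hik hinj]
  exact zsmul_mem (h.odd_odd _ (h.linear_odd _ (isLinForm_dForm_quadratic ..)) _
    (h.linear_odd _ (isLinForm_dForm_quadratic ..))) _

theorem sum_C_ite_mul (g : Fin 5 → PS) (k : Fin 5) :
    ∑ m, MvPowerSeries.C (if m = k then 1 else 0) * g m = g k := by
  rw [Finset.sum_eq_single k]
  · simp
  · intro b _ hb; simp [hb]
  · simp

/-- The coefficients of the field `2 x_a x_i ∂_k - δ_{ak} x_i² ∂_i`. -/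
def quadCoeff (a i k m : Fin 5) : PS :=
  MvPowerSeries.C (2 * if m = k then 1 else 0) * (coord a * coord i) -
    MvPowerSeries.C ((if a = k then 1 else 0) * if m = i then 1 else 0) * (coord i * coord i)

theorem C_two : (MvPowerSeries.C (2 : ℂ) : PS) = 2 := map_ofNat _ _

/-- The field `2 x_a x_i ∂_k - δ_{ak} x_i² ∂_i`, where `i ≠ k`. -/
def quadField (a i k : Fin 5) (hik : k ≠ i) : evenPart :=
  ⟨quadCoeff a i k, by
    change ∑ m, pd m (_ - _) = 0
    simp only [map_sub, pd_C_mul, Finset.sum_sub_distrib, map_mul, mul_assoc, ← Finset.mul_sum,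
      sum_C_ite_mul]
    simp only [pd_coord_mul, if_neg hik, if_true, map_zero, map_one, C_two, eq_comm (a := k) (b := a)]
    ring⟩

theorem IsSubalgebra.quadField_mem (h : IsSubalgebra G0 G1) (a i k : Fin 5) (hik : k ≠ i) :
    quadField a i k hik ∈ G0 := by
  by_cases ha : a = i
  · subst ha
    have e : quadField a a k hik =
        (2 : ℂ) • field (coord a * coord a) k (pd_coord_mul_of_ne hik hik) := by
      ext1; funext m
      change quadCoeff a a k m = (2 : ℂ) • (field _ _ _).1 m
      rw [field_val, MvPowerSeries.smul_eq_C_mul, quadCoeff]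
      simp only [if_neg hik.symm, map_mul, map_zero, C_two]
      ring
    rw [e]
    exact Submodule.smul_mem _ _ (h.square_mem hik)
  · have hlin : pd i (coord a) = 0 := by rw [pd_coord]; simp [Ne.symm ha]
    have hX : IsLinField (field (coord a) i hlin) := by
      refine ⟨fun m => ?_, fun p q m => ?_⟩
      · rw [field_val, map_mul, val0_coord, mul_zero]
      · rw [field_val, pd_C_mul, pd_coord, pd_C_mul, MvPowerSeries.pderiv_C, mul_zero]
    -- For a ≠ i the bracket of the linear field x_a ∂ᵢ with xᵢ² ∂_k is 2 x_a xᵢ ∂_k - δ_{ak} xᵢ²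
    -- ∂ᵢ.
    have e : quadField a i k hik = vectorBracket (field (coord a) i hlin)
        (field (coord i * coord i) k (pd_coord_mul_of_ne hik hik)) := by
      ext1; funext m
      change quadCoeff a i k m =
        ∑ j, ((field (coord a) i _).1 j * pd j ((field (coord i * coord i) k _).1 m) -
          (field (coord i * coord i) k _).1 j * pd j ((field (coord a) i _).1 m))
      simp only [field_val, pd_C_mul, Finset.sum_sub_distrib, pd_coord_mul, pd_coord, mul_assoc,
        sum_C_ite_mul, quadCoeff, map_mul, C_two, if_true, map_one, eq_comm (a := k) (b := a)]
      ring
    rw [e]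
    exact h.even_even _ (h.linear_even _ hX) _ (h.square_mem hik)

theorem val0_C_mul (c : ℂ) (f : PS) : val0 (MvPowerSeries.C c * f) = c * val0 f := by
  rw [map_mul, MvPowerSeries.constantCoeff_C]

theorem val0_quadCoeff (a i k m : Fin 5) : val0 (quadCoeff a i k m) = 0 := by
  simp only [quadCoeff, map_sub, map_mul, val0_coord, mul_zero, sub_zero]

theorem val0_pd_quadCoeff (a i k m r : Fin 5) : val0 (pd r (quadCoeff a i k m)) = 0 := by
  simp only [quadCoeff, map_sub, pd_C_mul, pd_coord_mul]
  simp only [map_add, map_mul, val0_coord, mul_zero, sub_zero, add_zero]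

theorem val0_pd_pd_quadCoeff (a i k m r s : Fin 5) : val0 (pd r (pd s (quadCoeff a i k m))) =
    2 * (if m = k then 1 else 0) *
          ((if r = a ∧ s = i then 1 else 0) + if r = i ∧ s = a then 1 else 0) -
        (if a = k then 1 else 0) * (if m = i then 1 else 0) *
          ((if r = i ∧ s = i then 1 else 0) + if r = i ∧ s = i then 1 else 0) := by
  simp only [quadCoeff, map_sub, pd_C_mul]
  rw [val0_C_mul, val0_C_mul, val0_quadratic, val0_quadratic]

/-- The combination of the fields `quadField` given by `sum_quadratic` has the same second
derivatives at the origin as X, so the difference vanishes to third order. -/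
theorem IsSubalgebra.mem_of_ord2 (h : IsSubalgebra G0 G1) {X : evenPart}
    (hX : ∀ i, Ord2 (X.1 i)) : X ∈ G0 := by
  let q : Fin 5 → Fin 5 → Fin 5 → ℂ := fun k i a => val0 (pd i (pd a (X.1 k)))
  have hq : ∀ k i j, q k i j = q k j i := fun k i j => by simp only [q]; rw [pd_comm]
  have hdiv : ∀ i, ∑ k, q k k i = 0 := by
    intro i
    have hX' : ∑ k, pd k (X.1 k) = 0 := X.2
    have h2 := congrArg (fun f => val0 (pd i f)) hX'
    simp only [map_sum, map_zero] at h2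
    rw [← h2]
    exact Finset.sum_congr rfl fun k _ => hq k k i
  let Y : Fin 5 → Fin 5 → Fin 5 → evenPart := fun k i a => if hik : i = k then 0 else
    (1 / 4 * (1 + if a = k then 1 else 0) * q k i a) • quadField a i k (Ne.symm hik)
  have hY : ∀ k i a m, (Y k i a).1 m =
      (if i = k then 0 else 1 / 4 * (1 + if a = k then 1 else 0) * q k i a) •
        quadCoeff a i k m := by
    intro k i a m
    by_cases hik : i = k
    · simp only [Y, dif_pos hik, if_pos hik, zero_smul]; rfl
    · simp only [Y, dif_neg hik, if_neg hik]; rfl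
  have hsum : ∀ m, (∑ k, ∑ i, ∑ a, Y k i a).1 m = ∑ k, ∑ i, ∑ a,
      (if i = k then 0 else 1 / 4 * (1 + if a = k then 1 else 0) * q k i a) •
        quadCoeff a i k m := by
    intro m
    simp only [Submodule.coe_sum, Finset.sum_apply, hY]
  have hmem : ∑ k, ∑ i, ∑ a, Y k i a ∈ G0 := by
    refine sum_mem fun k _ => sum_mem fun i _ => sum_mem fun a _ => ?_
    by_cases hik : i = k
    · simp only [Y, dif_pos hik]; exact zero_mem _
    · simp only [Y, dif_neg hik]; exact Submodule.smul_mem _ _ (h.quadField_mem ..)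
  have hsub : X - ∑ k, ∑ i, ∑ a, Y k i a ∈ G0 := by
    refine h.ord3_even _ fun m => ?_
    change Ord3 (X.1 m - (∑ k, ∑ i, ∑ a, Y k i a).1 m)
    rw [hsum]
    refine ⟨?_, fun s => ⟨?_, fun r => ?_⟩⟩
    · simp only [map_sub, map_sum, MvPowerSeries.constantCoeff_smul, val0_quadCoeff, smul_zero,
        Finset.sum_const_zero, (hX m).1, sub_zero]
    · simp only [map_sub, map_sum, Derivation.map_smul, MvPowerSeries.constantCoeff_smul,
        val0_pd_quadCoeff, smul_zero, Finset.sum_const_zero, (hX m).2, sub_zero]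
    · simp only [map_sub, map_sum, Derivation.map_smul, MvPowerSeries.constantCoeff_smul,
        val0_pd_pd_quadCoeff, smul_eq_mul]
      rw [sum_quadratic q hq hdiv m r s, sub_self]
  simpa using add_mem hsub hmem

theorem IsSubalgebra.mem_even (h : IsSubalgebra G0 G1) {X : evenPart}
    (hX : ∀ i, val0 (X.1 i) = 0) : X ∈ G0 := by
  -- The linear part of X. Its divergence is the constant term of the divergence of X, hence zero.
  let Y : evenPart := ⟨fun j => ∑ i, MvPowerSeries.C (val0 (pd i (X.1 j))) * coord i, by
    change ∑ j, pd j (∑ i, MvPowerSeries.C (val0 (pd i (X.1 j))) * coord i) = 0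
    have h1 : ∀ j, pd j (∑ i, MvPowerSeries.C (val0 (pd i (X.1 j))) * coord i) =
        MvPowerSeries.C (val0 (pd j (X.1 j))) := by
      intro j
      rw [map_sum, Finset.sum_eq_single j]
      · rw [pd_C_mul, pd_coord]; simp
      · intro i _ hi; rw [pd_C_mul, pd_coord]; simp [Ne.symm hi]
      · simp
    have hX' : ∑ k, pd k (X.1 k) = 0 := X.2
    simp only [h1, ← map_sum, hX', map_zero]⟩
  have hYv : ∀ j, Y.1 j = ∑ i, MvPowerSeries.C (val0 (pd i (X.1 j))) * coord i := fun j => rfl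
  have hYd : ∀ k j, pd k (Y.1 j) = MvPowerSeries.C (val0 (pd k (X.1 j))) := by
    intro k j
    rw [hYv, map_sum, Finset.sum_eq_single k]
    · rw [pd_C_mul, pd_coord]; simp
    · intro i _ hi; rw [pd_C_mul, pd_coord]; simp [Ne.symm hi]
    · simp
  have hY0 : ∀ j, val0 (Y.1 j) = 0 := by
    intro j
    rw [hYv, map_sum]
    refine Finset.sum_eq_zero fun i _ => ?_
    rw [map_mul, val0_coord, mul_zero]
  have hY : Y ∈ G0 := h.linear_even _ ⟨hY0, fun i j k => by rw [hYd, MvPowerSeries.pderiv_C]⟩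
  have hXY : X - Y ∈ G0 := by
    refine h.mem_of_ord2 fun i => ⟨?_, fun k => ?_⟩
    · change val0 (X.1 i - Y.1 i) = 0
      rw [map_sub, hX, hY0, sub_zero]
    · change val0 (pd k (X.1 i - Y.1 i)) = 0
      rw [map_sub, map_sub, hYd, MvPowerSeries.constantCoeff_C, sub_self]
  simpa using add_mem hXY hY

end Generation

/-! ### Closed two-forms with quadratic coefficients -/

section Generation

/-- The monomial `x_p x_q x_i`. -/
abbrev cubicCoord (p q i : Fin 5) : PS := coord p * coord q * coord i

theorem pd_cubicCoord (a p q i : Fin 5) : pd a (cubicCoord p q i) =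
    MvPowerSeries.C (if a = p then 1 else 0) * (coord q * coord i) +
    MvPowerSeries.C (if a = q then 1 else 0) * (coord p * coord i) +
    MvPowerSeries.C (if a = i then 1 else 0) * (coord p * coord q) := by
  rw [Derivation.leibniz, pd_coord_mul, pd_coord, smul_eq_mul, smul_eq_mul]
  ring

theorem val0_pd_cubicCoord (a p q i : Fin 5) : val0 (pd a (cubicCoord p q i)) = 0 := by
  rw [pd_cubicCoord]
  simp only [map_add, map_mul, val0_coord, mul_zero, add_zero]

theorem val0_pd_pd_cubicCoord (r a p q i : Fin 5) : val0 (pd r (pd a (cubicCoord p q i))) = 0 := by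
  rw [pd_cubicCoord]
  simp only [map_add, pd_C_mul, pd_coord_mul]
  simp only [map_add, map_mul, val0_coord, mul_zero, add_zero]

theorem sum_cubicCoord (c : Fin 5 → Fin 5 → Fin 5 → ℂ) (r s a : Fin 5) :
    ∑ p, ∑ q, ∑ i, c p q i * val0 (pd r (pd s (pd a (cubicCoord p q i)))) =
      c a r s + c a s r + (c r a s + c s a r) + (c r s a + c s r a) := by
  have h : ∀ p q i, c p q i * val0 (pd r (pd s (pd a (cubicCoord p q i)))) =
      c p q i * (if a = p ∧ r = q ∧ s = i then 1 else 0) +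
      c p q i * (if a = p ∧ s = q ∧ r = i then 1 else 0) +
      (c p q i * (if r = p ∧ a = q ∧ s = i then 1 else 0) +
      c p q i * (if s = p ∧ a = q ∧ r = i then 1 else 0)) +
      (c p q i * (if r = p ∧ s = q ∧ a = i then 1 else 0) +
      c p q i * (if s = p ∧ r = q ∧ a = i then 1 else 0)) := by
    intro p q i
    rw [pd_cubicCoord]
    simp only [map_add, pd_C_mul]
    simp only [val0_C_mul, val0_quadratic, ite_and_eq_mul]
    ring
  simp only [h, Finset.sum_add_distrib, sum_ite_three]

variable {G0 : Submodule ℂ evenPart} {G1 : Submodule ℂ oddPart}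

theorem lieDeriv_dForm (X : evenPart) (α : Fin 5 → PS) :
    lieDeriv X (dForm α) = dForm (contract X.1 (dForm α).1) := by
  ext1; funext j k
  rw [lieDeriv_eq_contract, dForm_val]

theorem exists_ne_four (a b c l : Fin 5) : ∃ p, p ≠ a ∧ p ≠ b ∧ p ≠ c ∧ p ≠ l := by
  have h : ∃ p, p ∉ ({a, b, c, l} : Finset (Fin 5)) := by
    by_contra! h
    have h2 : ({a, b, c, l} : Finset (Fin 5)) = Finset.univ := Finset.eq_univ_of_forall h
    have h3 := Finset.card_le_four (a := a) (b := b) (c := c) (d := l)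
    rw [h2] at h3
    simp at h3
  simpa using h

/-- By Cartan's formula the form is the bracket of a field X with w = x_c dx_c ∧ dx_l. Here X is x_a
x_b ∂_c, made divergence free by a multiple of ∂_p. As p differs from c and l, the correction
contracts w to zero, and as p differs from a and b, it has the required divergence. -/
theorem IsSubalgebra.dForm_mem_of_ne (h : IsSubalgebra G0 G1) (a b c l : Fin 5) (hcl : l ≠ c) :
    dForm (oneForm (cubicCoord a b c) l) ∈ G1 := by
  obtain ⟨p, hpa, hpb, hpc, hpl⟩ := exists_ne_four a b c l
  let X : evenPart := ⟨fun m => MvPowerSeries.C (if m = c then 1 else 0) * (coord a * coord b) -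
      MvPowerSeries.C (if m = p then 1 else 0) * (coord p * pd c (coord a * coord b)), by
    change ∑ m, pd m (_ - _) = 0
    simp only [map_sub, pd_C_mul, Finset.sum_sub_distrib, sum_C_ite_mul]
    rw [Derivation.leibniz (pd p) (coord p), pd_comm, pd_coord_mul_of_ne hpa hpb, map_zero,
      smul_zero, pd_coord, if_pos rfl, map_one, smul_eq_mul, mul_one, zero_add, sub_self]⟩
  have hXv : ∀ m, X.1 m = MvPowerSeries.C (if m = c then 1 else 0) * (coord a * coord b) -
      MvPowerSeries.C (if m = p then 1 else 0) * (coord p * pd c (coord a * coord b)) := fun m => rfl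
  have hX : X ∈ G0 := by
    refine h.mem_even fun m => ?_
    rw [hXv]
    simp only [map_sub, map_mul, val0_coord, mul_zero, zero_mul, sub_zero]
  obtain ⟨f, hf⟩ : ∃ f, f = MvPowerSeries.C (1 / 2) * (coord c * coord c) := ⟨_, rfl⟩
  obtain ⟨w, hw⟩ : ∃ w, w = dForm (oneForm f l) := ⟨_, rfl⟩
  have hw' : w ∈ G1 := by rw [hw, hf]; exact h.linear_odd _ (isLinForm_dForm_quadratic ..)
  have e : oneForm (cubicCoord a b c) l = contract X.1 w.1 := by
    funext m
    have h1 : ∀ t, w.1 t m = MvPowerSeries.C (if t = c then 1 else 0) *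
          (coord c * MvPowerSeries.C (if m = l then 1 else 0)) -
        MvPowerSeries.C (if t = l then 1 else 0) * (coord c * MvPowerSeries.C (if m = c then 1 else 0)) := by
      intro t
      have h2 : ∀ i, pd i f = MvPowerSeries.C (if i = c then 1 else 0) * coord c := by
        intro i
        rw [hf, pd_C_mul, pd_coord_mul, ← two_mul, ← C_two, ← mul_assoc, ← map_mul]
        norm_num
      rw [hw, dForm_val, oneForm_apply, oneForm_apply, pd_C_mul, pd_C_mul, h2, h2]
      ring
    have h3 : ∀ t, X.1 t * w.1 t m = MvPowerSeries.C (if t = c then 1 else 0) *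
          (X.1 t * (coord c * MvPowerSeries.C (if m = l then 1 else 0))) -
        MvPowerSeries.C (if t = l then 1 else 0) *
          (X.1 t * (coord c * MvPowerSeries.C (if m = c then 1 else 0))) := by
      intro t; rw [h1]; ring
    rw [contract]
    simp only [h3, Finset.sum_sub_distrib, sum_C_ite_mul]
    rw [hXv, hXv, oneForm_apply, if_pos rfl, if_neg hpc.symm, if_neg hcl, if_neg hpl.symm, map_one, map_zero]
    ring
  rw [e, hw, ← lieDeriv_dForm, ← hw]
  exact h.even_odd _ hX _ hw'

theorem dForm_cube (l : Fin 5) : dForm (oneForm (cubicCoord l l l) l) = 0 := by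
  ext1; funext j k
  rw [dForm_val, oneForm_apply, oneForm_apply, pd_C_mul, pd_C_mul, pd_cubicCoord, pd_cubicCoord]
  change _ = (0 : PS)
  ring

/-- Any factor of the monomial with index other than l may play the role of x_c. Only x_l³ dx_l
remains, and it is closed. -/
theorem IsSubalgebra.dForm_mem (h : IsSubalgebra G0 G1) (a b c l : Fin 5) :
    dForm (oneForm (cubicCoord a b c) l) ∈ G1 := by
  by_cases hc : l = c
  · by_cases ha : l = a
    · by_cases hb : l = b
      · subst hc; subst ha; subst hb
        rw [dForm_cube]; exact zero_mem _
      · have e : cubicCoord a b c = cubicCoord a c b := by simp only [cubicCoord]; ring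
        rw [e]; exact h.dForm_mem_of_ne a c b l hb
    · have e : cubicCoord a b c = cubicCoord c b a := by simp only [cubicCoord]; ring
      rw [e]; exact h.dForm_mem_of_ne c b a l ha
  · exact h.dForm_mem_of_ne a b c l hc

theorem val0_pd_dForm_cubic (p q i l a b : Fin 5) :
    val0 ((dForm (oneForm (cubicCoord p q i) l)).1 a b) = 0 := by
  rw [dForm_val, oneForm_apply, oneForm_apply, pd_C_mul, pd_C_mul, map_sub, val0_C_mul, val0_C_mul,
    val0_pd_cubicCoord, val0_pd_cubicCoord, mul_zero, mul_zero, sub_zero]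

theorem val0_pd_pd_dForm_cubic (p q i l a b r : Fin 5) :
    val0 (pd r ((dForm (oneForm (cubicCoord p q i) l)).1 a b)) = 0 := by
  rw [dForm_val, oneForm_apply, oneForm_apply, pd_C_mul, pd_C_mul, map_sub, pd_C_mul, pd_C_mul,
    map_sub, val0_C_mul, val0_C_mul, val0_pd_pd_cubicCoord, val0_pd_pd_cubicCoord, mul_zero,
    mul_zero, sub_zero]

theorem val0_pd_pd_pd_dForm_cubic (p q i l a b r s : Fin 5) :
    val0 (pd r (pd s ((dForm (oneForm (cubicCoord p q i) l)).1 a b))) =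
      (if b = l then 1 else 0) * val0 (pd r (pd s (pd a (cubicCoord p q i)))) -
      (if a = l then 1 else 0) * val0 (pd r (pd s (pd b (cubicCoord p q i)))) := by
  rw [dForm_val, oneForm_apply, oneForm_apply, pd_C_mul, pd_C_mul, map_sub, pd_C_mul, pd_C_mul,
    map_sub, pd_C_mul, pd_C_mul, map_sub, val0_C_mul, val0_C_mul]

theorem IsSubalgebra.mem_odd_of_ord2 (h : IsSubalgebra G0 G1) {w : oddPart}
    (hw : ∀ i j, Ord2 (w.1 i j)) : w ∈ G1 := by
  let c : Fin 5 → Fin 5 → Fin 5 → Fin 5 → ℂ := fun l p q i => val0 (pd p (pd q (w.1 i l)))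
  have hcomm : ∀ l p q i, c l p q i = c l q p i := fun l p q i => by simp only [c]; rw [pd_comm]
  have hskew : ∀ l p q i, c l p q i = -c i p q l := fun l p q i => by
    simp only [c]; rw [w.2.1 l i, map_neg, map_neg, map_neg]
  have hclosed : ∀ r i j k, c k r i j + c i r j k + c j r k i = 0 := fun r i j k => by
    have h2 := congrArg (fun f => val0 (pd r f)) (w.2.2 i j k)
    simpa only [map_add, map_zero] using h2
  -- The Poincaré homotopy: with the Euler field E, a closed form with quadratic coefficients is ¼ d
  -- ι_E w. The factor 1/8 is this ¼ times the ½ of the Taylor expansion.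
  let z : oddPart := ∑ l, ∑ p, ∑ q, ∑ i, (1 / 8 * c l p q i) • dForm (oneForm (cubicCoord p q i) l)
  have hz : z ∈ G1 := sum_mem fun l _ => sum_mem fun p _ => sum_mem fun q _ => sum_mem fun i _ =>
    Submodule.smul_mem _ _ (h.dForm_mem p q i l)
  have hzv : ∀ a b, z.1 a b = ∑ l, ∑ p, ∑ q, ∑ i,
      (1 / 8 * c l p q i) • (dForm (oneForm (cubicCoord p q i) l)).1 a b := by
    intro a b
    simp only [z, Submodule.coe_sum, Finset.sum_apply]
    rfl
  have hsub : w - z ∈ G1 := by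
    refine h.ord3_odd _ fun a b => ?_
    change Ord3 (w.1 a b - z.1 a b)
    rw [hzv]
    refine ⟨?_, fun s => ⟨?_, fun r => ?_⟩⟩
    · simp only [map_sub, map_sum, MvPowerSeries.constantCoeff_smul, val0_pd_dForm_cubic, smul_zero,
        Finset.sum_const_zero, (hw a b).1, sub_zero]
    · simp only [map_sub, map_sum, Derivation.map_smul, MvPowerSeries.constantCoeff_smul,
        val0_pd_pd_dForm_cubic, smul_zero, Finset.sum_const_zero, (hw a b).2, sub_zero]
    · simp only [map_sub, map_sum, Derivation.map_smul, MvPowerSeries.constantCoeff_smul,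
        val0_pd_pd_pd_dForm_cubic, smul_eq_mul]
      have h1 : ∀ l a b, ∑ p, ∑ q, ∑ i, 1 / 8 * c l p q i *
          ((if b = l then 1 else 0) * val0 (pd r (pd s (pd a (cubicCoord p q i)))) -
          (if a = l then 1 else 0) * val0 (pd r (pd s (pd b (cubicCoord p q i))))) =
          (if b = l then 1 / 8 * (c l a r s + c l a s r + (c l r a s + c l s a r) +
            (c l r s a + c l s r a)) else 0) -
          (if a = l then 1 / 8 * (c l b r s + c l b s r + (c l r b s + c l s b r) +
            (c l r s b + c l s r b)) else 0) := by
        intro l a b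
        have h2 : ∀ p q i, 1 / 8 * c l p q i *
          ((if b = l then 1 else 0) * val0 (pd r (pd s (pd a (cubicCoord p q i)))) -
          (if a = l then 1 else 0) * val0 (pd r (pd s (pd b (cubicCoord p q i))))) =
          (if b = l then 1 / 8 else 0) * (c l p q i * val0 (pd r (pd s (pd a (cubicCoord p q i))))) -
          (if a = l then 1 / 8 else 0) * (c l p q i * val0 (pd r (pd s (pd b (cubicCoord p q i))))) := by
          intro p q i
          split_ifs <;> ring
        refine (Finset.sum_congr rfl fun p _ => Finset.sum_congr rfl fun q _ =>
          Finset.sum_congr rfl fun i _ => h2 p q i).trans ?_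
        simp only [Finset.sum_sub_distrib, ← Finset.mul_sum, sum_cubicCoord]
        simp only [ite_mul, zero_mul]
      simp only [h1, Finset.sum_sub_distrib, Finset.sum_ite_eq, Finset.mem_univ, if_true]
      change c b r s a - _ = 0
      have e1 := hskew b r s a
      have e2 := hclosed r s a b
      have e3 := hclosed s r a b
      have e4 := hskew s r a b
      have e5 := hskew r s a b
      rw [hcomm b a r s, hcomm b a s r, hcomm a b r s, hcomm a b s r, hcomm b s r a, hcomm a s r b]
      have e6 := hskew a r b s
      have e7 := hskew a s b r
      have e8 := hcomm b s r a
      linear_combination (1/4) * e1 + (1/4) * e2 + (1/4) * e3 - (1/4) * e4 - (1/4) * e5 - (1/4) * e8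
  simpa using add_mem hsub hz

theorem IsSubalgebra.mem_odd (h : IsSubalgebra G0 G1) {w : oddPart}
    (hw : ∀ i j, val0 (w.1 i j) = 0) : w ∈ G1 := by
  have hd : ∀ g : PS, ∀ k, pd k (∑ i, MvPowerSeries.C (val0 (pd i g)) * coord i) =
      MvPowerSeries.C (val0 (pd k g)) := by
    intro g k
    rw [map_sum, Finset.sum_eq_single k]
    · rw [pd_C_mul, pd_coord]; simp
    · intro i _ hi; rw [pd_C_mul, pd_coord]; simp [Ne.symm hi]
    · simp
  let Y : oddPart := ⟨fun a b => ∑ i, MvPowerSeries.C (val0 (pd i (w.1 a b))) * coord i, by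
    refine ⟨fun a b => ?_, fun i j k => ?_⟩
    · simp only [w.2.1 a b, map_neg, neg_mul, Finset.sum_neg_distrib]
    · simp only [hd, ← map_add, w.2.2, map_zero]⟩
  have hYv : ∀ a b, Y.1 a b = ∑ i, MvPowerSeries.C (val0 (pd i (w.1 a b))) * coord i := fun a b => rfl
  have hYd : ∀ k a b, pd k (Y.1 a b) = MvPowerSeries.C (val0 (pd k (w.1 a b))) :=
    fun k a b => hd (w.1 a b) k
  have hY0 : ∀ a b, val0 (Y.1 a b) = 0 := by
    intro a b
    rw [hYv, map_sum]
    refine Finset.sum_eq_zero fun i _ => ?_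
    rw [map_mul, val0_coord, mul_zero]
  have hY : Y ∈ G1 := h.linear_odd _ ⟨hY0, fun k l i j => by rw [hYd, MvPowerSeries.pderiv_C]⟩
  have hXY : w - Y ∈ G1 := by
    refine h.mem_odd_of_ord2 fun a b => ⟨?_, fun k => ?_⟩
    · change val0 (w.1 a b - Y.1 a b) = 0
      rw [map_sub, hw, hY0, sub_zero]
    · change val0 (pd k (w.1 a b - Y.1 a b)) = 0
      rw [map_sub, map_sub, hYd, MvPowerSeries.constantCoeff_C, sub_self]
  simpa using add_mem hXY hY

end Generation

/-! ### Duality for families: all of L_{≥0} -/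

section DualVector

variable {V : Type*} [AddCommGroup V] [Module ℂ V] [LieRingModule sl5 V] [LieModule ℂ sl5 V]
variable {W : Type*} [AddCommGroup W] [Module ℂ W] [LieRingModule sl5 W] [LieModule ℂ sl5 W]

/-- The fields without constant term whose action on the vectors `Ψ(v)` is the prescribed one. -/
def evenStab (Ψ : V →ₗ[ℂ] Model W) : Submodule ℂ evenPart where
  carrier := {X | (∀ i, val0 (X.1 i) = 0) ∧ ∀ v, rho0 X (Ψ v) = Ψ ⁅linearPart X, v⁆}
  add_mem' := by
    rintro X Y ⟨hX, hX'⟩ ⟨hY, hY'⟩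
    refine ⟨fun i => ?_, fun v => ?_⟩
    · change val0 (X.1 i + Y.1 i) = 0
      rw [map_add, hX, hY, add_zero]
    · rw [show linearPart (X + Y) = linearPart X + linearPart Y from map_add linearPartₗ X Y,
        add_lie, map_add, map_add, LinearMap.add_apply, hX', hY']
  zero_mem' := by
    refine ⟨fun i => map_zero _, fun v => ?_⟩
    rw [show linearPart (0 : evenPart) = 0 from map_zero linearPartₗ, zero_lie, map_zero, map_zero,
      LinearMap.zero_apply]
  smul_mem' := by
    rintro c X ⟨hX, hX'⟩
    refine ⟨fun i => ?_, fun v => ?_⟩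
    · change val0 (c • X.1 i) = 0
      rw [MvPowerSeries.constantCoeff_smul, hX, smul_zero]
    · rw [show linearPart (c • X) = c • linearPart X from map_smul linearPartₗ c X,
        smul_lie, map_smul, map_smul, LinearMap.smul_apply, hX']

/-- The two-forms without constant term which annihilate the vectors `Ψ(v)`. -/
def oddStab (Ψ : V →ₗ[ℂ] Model W) : Submodule ℂ oddPart where
  carrier := {w | (∀ i j, val0 (w.1 i j) = 0) ∧ ∀ v, rho1 w (Ψ v) = 0}
  add_mem' := by
    rintro w z ⟨hw, hw'⟩ ⟨hz, hz'⟩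
    refine ⟨fun i j => ?_, fun v => ?_⟩
    · change val0 (w.1 i j + z.1 i j) = 0
      rw [map_add, hw, hz, add_zero]
    · rw [map_add, LinearMap.add_apply, hw', hz', add_zero]
  zero_mem' := ⟨fun i j => map_zero _, fun v => by rw [map_zero, LinearMap.zero_apply]⟩
  smul_mem' := by
    rintro c w ⟨hw, hw'⟩
    refine ⟨fun i j => ?_, fun v => ?_⟩
    · change val0 (c • w.1 i j) = 0
      rw [MvPowerSeries.constantCoeff_smul, hw, smul_zero]
    · rw [map_smul, LinearMap.smul_apply, hw', smul_zero]

/-- Elements acting in the prescribed way are closed under brackets because the operators satisfy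
the relations of L and the linear part respects brackets. The generation argument thus extends
singularity from linear elements to L_{≥0}. -/
theorem isSubalgebra_stab (Ψ : V →ₗ[ℂ] Model W)
    (linear_even : ∀ X, IsLinField X → ∀ v, rho0 X (Ψ v) = Ψ ⁅linearPart X, v⁆)
    (linear_odd : ∀ w, IsLinForm w → ∀ v, rho1 w (Ψ v) = 0)
    (ord3_even : ∀ X : evenPart, (∀ i, Ord3 (X.1 i)) → ∀ v, rho0 X (Ψ v) = 0)
    (ord3_odd : ∀ w : oddPart, (∀ i j, Ord3 (w.1 i j)) → ∀ v, rho1 w (Ψ v) = 0) :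
    IsSubalgebra (evenStab Ψ) (oddStab Ψ) where
  even_even := by
    rintro X ⟨hX, hX'⟩ Y ⟨hY, hY'⟩
    refine ⟨val0_vectorBracket X Y hX hY, fun v => ?_⟩
    rw [← (rho_relations (Ψ v)).1, hY', hX', hX', hY', linearPart_vectorBracket X Y hX hY, lie_lie,
      map_sub]
  even_odd := by
    rintro X ⟨hX, hX'⟩ w ⟨hw, hw'⟩
    refine ⟨val0_lieDeriv X w hX hw, fun v => ?_⟩
    rw [← (rho_relations (Ψ v)).2.1, hw', hX', hw', map_zero, sub_zero]
  odd_odd := by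
    rintro w ⟨hw, hw'⟩ z ⟨hz, hz'⟩
    refine ⟨val0_formBracket w z hw, fun v => ?_⟩
    rw [← (rho_relations (Ψ v)).2.2, hw', hz', map_zero, map_zero, add_zero,
      linearPart_formBracket w z hw hz, zero_lie, map_zero]
  linear_even X hX := ⟨hX.1, linear_even X hX⟩
  linear_odd w hw := ⟨hw.1, linear_odd w hw⟩
  ord3_even X hX := ⟨fun i => (hX i).1, fun v => by
    rw [ord3_even X hX, linearPart_eq_zero fun i => (hX i).ord2, zero_lie, map_zero]⟩
  ord3_odd w hw := ⟨fun i j => (hw i j).1, ord3_odd w hw⟩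

variable {ι : Type*} [Fintype ι] {u : ι → Neg} {θ : ι → V →ₗ[ℂ] W}

/-- If the vectors `Φ(v)` of degree three transform under `L_{≥0}` as `v` does, then the vectors
`Ψ(f)` transform as `f` does. -/
theorem dualVec_singular (hu : ∀ i, u i ∈ cubic)
    (h0 : ∀ X : evenPart, (∀ i, val0 (X.1 i) = 0) → ∀ v,
      rho0 X (familyVec u θ v) = familyVec u θ ⁅linearPart X, v⁆)
    (h1 : ∀ w : oddPart, (∀ i j, val0 (w.1 i j) = 0) → ∀ v, rho1 w (familyVec u θ v) = 0) :
    (∀ X : evenPart, (∀ i, val0 (X.1 i) = 0) → ∀ f,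
      rho0 X (dualVec u θ f) = dualVec u θ ⁅linearPart X, f⁆) ∧
    (∀ w : oddPart, (∀ i j, val0 (w.1 i j) = 0) → ∀ f, rho1 w (dualVec u θ f) = 0) := by
  have h := isSubalgebra_stab (dualVec u θ)
    (fun X hX => hX.rho0_dualVec hu (h0 X hX.1))
    (fun z hz => hz.rho1_dualVec hu (fun X hX => h0 X hX.1) (h1 z hz.1))
    (fun X hX f => by
      rw [familyVec_apply, map_sum]
      exact Finset.sum_eq_zero fun i _ => (rho_cubic (anti_mem_cubic (hu i)) _).1 X hX)
    (fun w hw f => by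
      rw [familyVec_apply, map_sum]
      exact Finset.sum_eq_zero fun i _ => (rho_cubic (anti_mem_cubic (hu i)) _).2 w hw)
  exact ⟨fun X hX => (h.mem_even hX).2, fun w hw => (h.mem_odd hw).2⟩

end DualVector

/-! ### The elements `ω_I` of degrees one and three -/

/-- Anticommutators of the d's are combinations of the ∂_t, which are central in U(L₋). -/
theorem Neg.antiCommutator_commute (p q r : Fin 5 × Fin 5) :
    (Neg.d p * Neg.d q + Neg.d q * Neg.d p) * Neg.d r =
      Neg.d r * (Neg.d p * Neg.d q + Neg.d q * Neg.d p) := by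
  rw [Neg.d_mul_d, Finset.sum_mul, Finset.mul_sum]
  refine Finset.sum_congr rfl fun t _ => ?_
  rw [smul_mul_assoc, mul_smul_comm, Neg.del_mul_d]

/-- The antisymmetrization of a product of three odd generators. -/
def Neg.omegaThree (p q r : Fin 5 × Fin 5) : Neg :=
  Neg.d p * Neg.d q * Neg.d r - (1 / 2 : ℂ) • ((Neg.d p * Neg.d q + Neg.d q * Neg.d p) * Neg.d r) +
    (1 / 2 : ℂ) • ((Neg.d p * Neg.d r + Neg.d r * Neg.d p) * Neg.d q) -
    (1 / 2 : ℂ) • ((Neg.d q * Neg.d r + Neg.d r * Neg.d q) * Neg.d p)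

theorem Neg.triple_mem_cubic (p q r : Fin 5 × Fin 5) : Neg.d p * Neg.d q * Neg.d r ∈ cubic :=
  Submodule.subset_span ⟨p, q, r, rfl⟩

theorem Neg.omegaThree_mem (p q r : Fin 5 × Fin 5) : Neg.omegaThree p q r ∈ cubic := by
  have h := Neg.triple_mem_cubic
  simp only [Neg.omegaThree, add_mul]
  exact sub_mem (add_mem (sub_mem (h _ _ _) (Submodule.smul_mem _ _ (add_mem (h _ _ _) (h _ _ _))))
    (Submodule.smul_mem _ _ (add_mem (h _ _ _) (h _ _ _))))
    (Submodule.smul_mem _ _ (add_mem (h _ _ _) (h _ _ _)))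

/-- As ∂_t is an anticommutator of two d's, these terms also lie in the span of cubic words, so both
sums of Φ are treated alike. -/
theorem Neg.del_mul_d_mem (t : Fin 5) (p : Fin 5 × Fin 5) : Neg.del t * Neg.d p ∈ cubic := by
  rw [Neg.del_eq, add_mul]
  exact add_mem (Neg.triple_mem_cubic _ _ _) (Neg.triple_mem_cubic _ _ _)

/-- Reversing three antisymmetrized letters gives the sign -1, and the antiautomorphism contributes
i³ = -i; the product is i. For ∂_t d_p the factor is instead (-1) · i = -i. -/
theorem Neg.anti_omegaThree (p q r : Fin 5 × Fin 5) :
    Neg.anti (Neg.omegaThree p q r) = Complex.I • Neg.omegaThree p q r := by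
  have h : Neg.d p * Neg.d q * Neg.d r + Neg.d r * Neg.d q * Neg.d p =
      (Neg.d p * Neg.d q + Neg.d q * Neg.d p) * Neg.d r -
      (Neg.d p * Neg.d r + Neg.d r * Neg.d p) * Neg.d q +
      (Neg.d q * Neg.d r + Neg.d r * Neg.d q) * Neg.d p := by
    rw [Neg.antiCommutator_commute p r q]
    noncomm_ring
  have h2 : ∀ a b c : Fin 5 × Fin 5, Neg.anti ((Neg.d a * Neg.d b + Neg.d b * Neg.d a) * Neg.d c) =
      -Complex.I • ((Neg.d a * Neg.d b + Neg.d b * Neg.d a) * Neg.d c) := by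
    intro a b c
    rw [Neg.anti_mul, map_add, Neg.anti_d_mul_d, Neg.anti_d_mul_d, Neg.anti_d,
      Neg.antiCommutator_commute, ← neg_add, add_comm, mul_neg, smul_mul_assoc, neg_smul]
  have h3 := eq_sub_of_add_eq' h
  rw [Neg.omegaThree, map_sub, map_add, map_sub, map_smul, map_smul, map_smul, h2, h2, h2,
    Neg.anti_triple, h3]
  module

instance Pair.decidableDisj {d : ℕ} (p q : Pair d) : Decidable (p.Disj q) := by
  unfold Pair.Disj; infer_instance

theorem SIF_three : SIF 3 = {∅, {⟨(0, 1), by decide⟩}, {⟨(0, 2), by decide⟩}, {⟨(1, 2), by decide⟩}} := by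
  have h : ∀ S : Finset (Pair 3), decide (∀ p ∈ S, ∀ q ∈ S, p ≠ q → p.Disj q) = true ↔
      (S = ∅ ∨ S = {⟨(0, 1), by decide⟩} ∨ S = {⟨(0, 2), by decide⟩} ∨ S = {⟨(1, 2), by decide⟩}) := by
    decide
  ext S
  simp only [SIF, Finset.mem_filter, Finset.mem_univ, true_and, Finset.mem_insert,
    Finset.mem_singleton, ← h S, decide_eq_true_eq]

theorem crossing_empty (d : ℕ) : crossing (∅ : Finset (Pair d)) = 0 := by simp [crossing]

theorem crossing_singleton {d : ℕ} (p : Pair d) : crossing ({p} : Finset (Pair d)) = 0 := by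
  simp [crossing, Pair.CrossesRight]

theorem DPair_eq {d : ℕ} (I : Seq d) (p : Pair d) :
    DPair I p = ((1 / 2 : ℂ) * (-1) ^ (p.1.1.val + p.1.2.val)) •
      (dd (I p.1.1) * dd (I p.1.2) + dd (I p.1.2) * dd (I p.1.1)) := by
  have h := congrArg Neg.toUminus (Neg.d_mul_d (I p.1.1) (I p.1.2))
  simp only [map_add, map_mul, map_sum, map_zsmul, Neg.toUminus_d, Neg.toUminus_del] at h
  rw [DPair, h]

/-- Three positions leave room for at most one pair, so no crossings occur. Counting positions from
0 instead of 1 does not change the parity of k + l; the signs for the pairs 01, 02, 12 are -, +, -.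
-/
theorem omega_three (I : Seq 3) :
    omega I = Neg.toUminus (Neg.omegaThree (I 0) (I 1) (I 2)) := by
  rw [omega, SIF_three, Finset.sum_insert, Finset.sum_insert, Finset.sum_insert,
    Finset.sum_singleton, crossing_empty, crossing_singleton, crossing_singleton,
    crossing_singleton]
  · simp [DSet, dRest, List.finRange_succ, Neg.omegaThree, DPair_eq]
    simp only [add_mul, neg_mul, smul_mul_assoc, mul_assoc, smul_add]
    module
  all_goals decide

theorem omega_one (I : Seq 1) : omega I = Neg.toUminus (Neg.d (I 0)) := by
  have : IsEmpty (Pair 1) := ⟨fun p => by have := p.2; omega⟩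
  have h : SIF 1 = {∅} := by
    ext S
    simp only [SIF, Finset.eq_empty_of_isEmpty S, Finset.mem_filter, Finset.mem_univ, true_and,
      Finset.mem_singleton, Finset.notMem_empty, false_imp_iff, implies_true]
  rw [omega, h, Finset.sum_singleton, crossing_empty, Neg.toUminus_d]
  simp [DSet, dRest, List.finRange_succ]

/-! ### Construction of the morphism -/

section Morphism

variable {V : Type*} [AddCommGroup V] [Module ℂ V] [LieRingModule sl5 V] [LieModule ℂ sl5 V]
variable {W : Type*} [AddCommGroup W] [Module ℂ W] [LieRingModule sl5 W] [LieModule ℂ sl5 W]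

/-- The universal property of the generalized Verma module. -/
theorem exists_hom (Ψ : V →ₗ[ℂ] Verma W)
    (h0 : ∀ X : evenPart, (∀ i, val0 (X.1 i) = 0) → ∀ v, toU (X, 0) • Ψ v = Ψ ⁅linearPart X, v⁆)
    (h1 : ∀ w : oddPart, (∀ i j, val0 (w.1 i j) = 0) → ∀ v, toU (0, w) • Ψ v = 0) :
    ∃ ψ : Verma V →ₗ[U] Verma W, ∀ u v, ψ (vtensor u v) = u • Ψ v := by
  let g : U ⊗[ℂ] V →ₗ[U] Verma W :=
    TensorProduct.AlgebraTensorModule.lift (LinearMap.toSpanSingleton U (V →ₗ[ℂ] Verma W) Ψ)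
  have hg : ∀ u v, g (u ⊗ₜ v) = u • Ψ v := fun u v => rfl
  have hker : vermaRelations V ≤ LinearMap.ker g := by
    refine Submodule.span_le.mpr ?_
    rintro _ (⟨u, X, v, hX, rfl⟩ | ⟨u, w, v, hw, rfl⟩)
    · change g _ = 0
      rw [map_sub, hg, hg, mul_smul, h0 X hX, sub_self]
    · change g _ = 0
      rw [hg, mul_smul, h1 w hw, smul_zero]
  exact ⟨(vermaRelations V).liftQ g hker, fun u v => rfl⟩

theorem hom_ext_vtensor {ψ ψ' : Verma V →ₗ[U] Verma W}
    (h : ∀ v, ψ (vtensor 1 v) = ψ' (vtensor 1 v)) : ψ = ψ' := by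
  refine LinearMap.ext fun m => ?_
  obtain ⟨x, rfl⟩ := (vermaRelations V).mkQ_surjective m
  induction x using TensorProduct.induction_on with
  | zero => simp
  | add x y hx hy => simp only [map_add, hx, hy]
  | tmul u v =>
    change ψ (vtensor u v) = ψ' (vtensor u v)
    rw [← mul_one u, ← smul_vtensor, map_smul, map_smul, h]

/-- The elements of `U₋` which occur in degree three. -/
def degreeThreeFamily : Orbit 3 ⊕ (Fin 5 × Orbit 1) → Neg :=
  Sum.elim (fun o => Neg.omegaThree (o.out 0) (o.out 1) (o.out 2))
    fun p => Neg.del p.1 * Neg.d (p.2.out 0)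

theorem degreeThreeFamily_mem (i) : degreeThreeFamily i ∈ cubic := by
  rcases i with o | p
  · exact Neg.omegaThree_mem _ _ _
  · exact Neg.del_mul_d_mem _ _

/-- The coefficients in `Hom(V,W)`. -/
def coeffFamily (θ : Seq 3 → (V →ₗ[ℂ] W)) (θ' : Fin 5 → Seq 1 → (V →ₗ[ℂ] W)) :
    Orbit 3 ⊕ (Fin 5 × Orbit 1) → V →ₗ[ℂ] W :=
  Sum.elim (fun o => θ o.out) fun p => θ' p.1 p.2.out

theorem evalAt_degreeThree (θ : Seq 3 → (V →ₗ[ℂ] W)) (θ' : Fin 5 → Seq 1 → (V →ₗ[ℂ] W)) (v : V) :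
    evalAt (degreeThree θ θ') v = ofModel (familyVec degreeThreeFamily (coeffFamily θ θ') v) := by
  rw [familyVec_apply, Fintype.sum_sum_type, Fintype.sum_prod_type]
  simp only [evalAt, degreeThree, map_add, map_sum, TensorProduct.map_tmul, omega_three, omega_one,
    degreeThreeFamily, coeffFamily, Sum.elim_inl, Sum.elim_inr, ofModel_tmul, map_mul,
    Neg.toUminus_del]
  rfl

theorem dualVec_degreeThree (θ : Seq 3 → (V →ₗ[ℂ] W)) (θ' : Fin 5 → Seq 1 → (V →ₗ[ℂ] W))
    (f : Module.Dual ℂ W) :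
    dualVec degreeThreeFamily (coeffFamily θ θ') f = Complex.I • familyVec degreeThreeFamily
      (coeffFamily (fun I => (θ I).dualMap) fun t I => (-(θ' t I)).dualMap) f := by
  rw [familyVec_apply, familyVec_apply, Finset.smul_sum]
  refine Finset.sum_congr rfl fun i _ => ?_
  rcases i with o | p
  · simp only [degreeThreeFamily, coeffFamily, Sum.elim_inl, Neg.anti_omegaThree]
    rfl
  · have e : (-(θ' p.1 p.2.out)).dualMap f = -(θ' p.1 p.2.out).dualMap f := by
      ext v; simp
    simp only [degreeThreeFamily, coeffFamily, Sum.elim_inr, Neg.anti_mul, Neg.anti_d, Neg.anti_del,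
      e, smul_mul_assoc, mul_neg, ← Neg.del_mul_d, smul_neg, TensorProduct.neg_tmul, TensorProduct.tmul_neg]
    rfl

theorem existsUnique_dual (θ : Seq 3 → (V →ₗ[ℂ] W)) (θ' : Fin 5 → Seq 1 → (V →ₗ[ℂ] W))
    (φ : Verma V →ₗ[U] Verma W) (hφ : IsAssociated φ (degreeThree θ θ')) :
    ∃! ψ : Verma (Module.Dual ℂ W) →ₗ[U] Verma (Module.Dual ℂ V),
      IsAssociated ψ (degreeThree (fun I => (θ I).dualMap) fun t I => (-(θ' t I)).dualMap) := by
  have hφ1 : ∀ v, φ (vtensor 1 v) = ofModel (familyVec degreeThreeFamily (coeffFamily θ θ') v) := by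
    intro v
    have h := hφ 1 v
    rw [evalAt_degreeThree] at h
    simpa using h
  have h0 : ∀ X : evenPart, (∀ i, val0 (X.1 i) = 0) → ∀ v,
      rho0 X (familyVec degreeThreeFamily (coeffFamily θ θ') v) =
        familyVec degreeThreeFamily (coeffFamily θ θ') ⁅linearPart X, v⁆ := by
    intro X hX v
    -- The U-linearity of φ gives the identity in M(W); it is transported to the model, where
    -- coefficients in U(L₋) can be compared.
    rw [← toModel_ofModel (familyVec _ _ ⁅linearPart X, v⁆), ← hφ1, ← vtensor_mul_even 1 X hX,
      one_mul, ← mul_one (toU _), ← smul_vtensor, map_smul, hφ1, toModel_smul, toModel_ofModel,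
      rhoU_even]
  have h1 : ∀ w : oddPart, (∀ i j, val0 (w.1 i j) = 0) → ∀ v,
      rho1 w (familyVec degreeThreeFamily (coeffFamily θ θ') v) = 0 := by
    intro w hw v
    have h := congrArg (fun m => toModel (φ m)) (vtensor_mul_odd (V := V) 1 w hw v)
    simp only [map_zero] at h
    rw [← h, one_mul, ← mul_one (toU _), ← smul_vtensor, map_smul, hφ1, toModel_smul,
      toModel_ofModel, rhoU_odd]
  obtain ⟨d0, d1⟩ := dualVec_singular degreeThreeFamily_mem h0 h1
  -- The dual family is i times the one defining Ψ, and the nonzero factor i is cancelled below.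
  simp only [dualVec_degreeThree, map_smul] at d0 d1
  obtain ⟨ψ, hψ⟩ := exists_hom (ofModel ∘ₗ familyVec degreeThreeFamily
      (coeffFamily (fun I => (θ I).dualMap) fun t I => (-(θ' t I)).dualMap))
    (fun X hX f => by
      rw [LinearMap.comp_apply, LinearMap.comp_apply, ← (ofModel_rho _).1,
        smul_right_injective _ Complex.I_ne_zero (d0 X hX f)])
    (fun w hw f => by
      rw [LinearMap.comp_apply, ← (ofModel_rho _).2,
        (smul_eq_zero.mp (d1 w hw f)).resolve_left Complex.I_ne_zero, map_zero])
  refine ⟨ψ, fun u f => ?_, fun ψ' hψ' => ?_⟩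
  · rw [hψ, evalAt_degreeThree]; rfl
  · refine hom_ext_vtensor fun f => ?_
    have h := hψ' 1 f
    rw [evalAt_degreeThree] at h
    rw [hψ]
    simpa using h

end Morphism

/-! ### Extremal vectors of highest weight modules -/

open LieAlgebra.SpecialLinear in
/-- The elementary matrix `E_{ij}`, `i ≠ j`. -/
abbrev rootVec (i j : Fin 5) (h : i ≠ j) : sl5 := single i j h 1

open LieAlgebra.SpecialLinear in
/-- The diagonal matrix `E_{ii} - E_{jj}`. -/
abbrev coroot (i j : Fin 5) : sl5 := singleSubSingle i j 1

open LieAlgebra.SpecialLinear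

theorem lie_coroot_rootVec (a b i j : Fin 5) (h : i ≠ j) :
    ⁅coroot a b, rootVec i j h⁆ = (((if a = i then 1 else 0) - (if a = j then 1 else 0) -
      ((if b = i then 1 else 0) - (if b = j then 1 else 0)) : ℂ)) • rootVec i j h := by
  refine Subtype.ext ?_
  rw [sl_bracket]
  change (Matrix.single a a 1 - Matrix.single b b 1) * Matrix.single i j 1 -
    Matrix.single i j 1 * (Matrix.single a a 1 - Matrix.single b b 1) =
    ((((if a = i then 1 else 0) - (if a = j then 1 else 0) -
      ((if b = i then 1 else 0) - (if b = j then 1 else 0)) : ℂ)) • Matrix.single i j (1 : ℂ) : Matrix (Fin 5) (Fin 5) ℂ)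
  have h1 : ∀ a : Fin 5, (Matrix.single a a 1 * Matrix.single i j 1 : Matrix (Fin 5) (Fin 5) ℂ) =
      (if a = i then 1 else 0 : ℂ) • Matrix.single i j 1 := by
    intro a
    by_cases ha : a = i
    · subst ha; simp
    · simp [ha]
  have h2 : ∀ a : Fin 5, (Matrix.single i j 1 * Matrix.single a a 1 : Matrix (Fin 5) (Fin 5) ℂ) =
      (if a = j then 1 else 0 : ℂ) • Matrix.single i j 1 := by
    intro a
    by_cases ha : a = j
    · subst ha; simp
    · simp [ha, Ne.symm ha]
  rw [sub_mul, mul_sub, h1, h1, h2, h2]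
  module

theorem lie_rootVec_rootVec {i j k : Fin 5} (hij : i ≠ j) (hjk : j ≠ k) (hik : i ≠ k) :
    ⁅rootVec i j hij, rootVec j k hjk⁆ = rootVec i k hik := by
  refine Subtype.ext ?_
  rw [sl_bracket]
  simp [Ne.symm hik]

theorem lie_rootVec_rootVec_of_ne {i j k l : Fin 5} (hij : i ≠ j) (hkl : k ≠ l) (hjk : j ≠ k)
    (hil : i ≠ l) : ⁅rootVec i j hij, rootVec k l hkl⁆ = 0 := by
  refine Subtype.ext ?_
  rw [sl_bracket]
  simp [hjk, Ne.symm hil]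

theorem isSl2Triple_rootVec {i j : Fin 5} (h : i ≠ j) :
    IsSl2Triple (coroot i j) (rootVec i j h) (rootVec j i h.symm) where
  h_ne_zero := fun h0 => by
    have := congrFun (congrFun (congrArg Subtype.val h0) i) i
    simp [Matrix.single_apply_of_ne, h.symm] at this
  lie_e_f := by
    refine Subtype.ext ?_
    rw [sl_bracket]
    simp
  lie_h_e_nsmul := by
    rw [lie_coroot_rootVec, if_pos rfl, if_neg h, if_neg h.symm, if_pos rfl,
      ← Nat.cast_smul_eq_nsmul ℂ]
    norm_num
  lie_h_f_nsmul := by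
    rw [lie_coroot_rootVec, if_neg h, if_pos rfl, if_pos rfl, if_neg h.symm,
      ← Nat.cast_smul_eq_nsmul ℂ]
    norm_num

section Extremal

variable {V : Type*} [AddCommGroup V] [Module ℂ V] [LieRingModule sl5 V] [LieModule ℂ sl5 V]

/-- A vector of weight `Λ` which is a highest weight vector for the order of the indices given by
the permutation `π`. -/
structure IsExtremal (Λ : Fin 5 → ℂ) (π : Equiv.Perm (Fin 5)) (v : V) : Prop where
  ne_zero : v ≠ 0
  raise : ∀ i j (h : i < j), ⁅rootVec (π i) (π j) (π.injective.ne h.ne), v⁆ = 0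
  weight : ∀ a b, ⁅coroot (π a) (π b), v⁆ = (Λ a - Λ b) • v

open LieModule

/-- A simple reflection permutes the positive roots other than its own simple root. -/
theorem swap_lt_swap : ∀ (k : Fin 4) (i j : Fin 5), i < j → ¬(i = k.castSucc ∧ j = k.succ) →
    Equiv.swap k.castSucc k.succ i < Equiv.swap k.castSucc k.succ j ∧
    ¬(Equiv.swap k.castSucc k.succ i = k.castSucc ∧ Equiv.swap k.castSucc k.succ j = k.succ) := by
  decide

/-- The vector v is primitive for the 𝔰𝔩₂ of the simple root (p, q) in the order given by π. With n
= Λ_p - Λ_q, the other end fⁿ v of its string is nonzero and is extremal for the reflected order. -/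
theorem IsExtremal.exists_mul_swap [FiniteDimensional ℂ V] {Λ : Fin 5 → ℂ} {π : Equiv.Perm (Fin 5)} {v : V}
    (hv : IsExtremal Λ π v) (k : Fin 4) (n : ℕ) (hn : Λ k.castSucc - Λ k.succ = n) :
    ∃ v' : V, IsExtremal Λ (π * Equiv.swap k.castSucc k.succ) v' := by
  obtain ⟨p, hp⟩ : ∃ p, p = k.castSucc := ⟨_, rfl⟩
  obtain ⟨q, hq⟩ : ∃ q, q = k.succ := ⟨_, rfl⟩
  rw [← hp, ← hq] at hn ⊢
  have hpq : p < q := by rw [hp, hq]; exact Fin.castSucc_lt_succ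
  have hbetween : ∀ a, a < q → a ≠ p → a < p := fun a h1 h2 => by
    rw [hp, hq] at *; exact lt_of_le_of_ne (Fin.le_castSucc_iff.mpr h1) h2
  have hbetween' : ∀ a, p < a → a ≠ q → q < a := fun a h1 h2 => by
    rw [hp, hq] at *; exact lt_of_le_of_ne (Fin.castSucc_lt_iff_succ_le.mp h1) h2.symm
  have hne : π p ≠ π q := π.injective.ne hpq.ne
  have t := isSl2Triple_rootVec hne
  have P : t.HasPrimitiveVectorWith v (n : ℂ) :=
    ⟨hv.ne_zero, by rw [hv.weight, hn], hv.raise p q hpq⟩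
  set f := rootVec (π q) (π p) hne.symm with hf
  have hsucc : ∀ m, (toEnd ℂ sl5 V f ^ (m + 1)) v = ⁅f, (toEnd ℂ sl5 V f ^ m) v⁆ := fun m => by
    rw [pow_succ', Module.End.mul_apply, toEnd_apply_apply]
  -- For a positive root other than the simple one, the bracket of its root vector with f is zero
  -- or, up to sign, again such a root vector, so induction on the power of f applies.
  have hraise : ∀ m a b (h : a < b), ¬(a = p ∧ b = q) →
      ⁅rootVec (π a) (π b) (π.injective.ne h.ne), (toEnd ℂ sl5 V f ^ m) v⁆ = 0 := by
    intro m
    induction m with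
    | zero => intro a b h _; simpa using hv.raise a b h
    | succ m ih =>
      intro a b h hab
      rw [hsucc, leibniz_lie, ih a b h hab, lie_zero, add_zero]
      by_cases hb : b = q
      · subst hb
        have ha : a < p := hbetween a h fun h2 => hab ⟨h2, rfl⟩
        rw [lie_rootVec_rootVec _ _ (π.injective.ne ha.ne)]
        exact ih a p ha fun h2 => ha.ne h2.1
      · by_cases ha : a = p
        · subst ha
          have hb' : q < b := hbetween' b h hb
          rw [← lie_skew, lie_rootVec_rootVec _ _ (π.injective.ne hb'.ne), neg_lie,
            ih q b hb' fun h2 => hpq.ne' h2.1, neg_zero]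
        · rw [lie_rootVec_rootVec_of_ne _ _ (π.injective.ne hb) (π.injective.ne ha), zero_lie]
  let χ : Fin 5 → ℂ := fun a => (if a = p then 1 else 0) - (if a = q then 1 else 0)
  have hweight : ∀ (m : ℕ) a b, ⁅coroot (π a) (π b), (toEnd ℂ sl5 V f ^ m) v⁆ =
      ((Λ a - m * χ a) - (Λ b - m * χ b)) • (toEnd ℂ sl5 V f ^ m) v := by
    intro m a b
    induction m with
    | zero => simpa using hv.weight a b
    | succ m ih =>
      rw [hsucc, leibniz_lie, ih, lie_coroot_rootVec, smul_lie, lie_smul, ← hf]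
      simp only [π.injective.eq_iff, χ]
      push_cast
      module
  -- The weight Λ - nχ of fⁿ v is Λ with its entries at p and q exchanged, so in the reflected order
  -- it reads as Λ again.
  have hΛ : ∀ a, Λ (Equiv.swap p q a) - n * χ (Equiv.swap p q a) = Λ a := by
    intro a
    by_cases ha : a = p
    · subst ha
      rw [Equiv.swap_apply_left, ← hn]
      simp only [χ, if_true, if_neg hpq.ne']; ring
    · by_cases ha' : a = q
      · subst ha'
        rw [Equiv.swap_apply_right, ← hn]
        simp only [χ, if_true, if_neg hpq.ne]; ring
      · rw [Equiv.swap_apply_of_ne_of_ne ha ha']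
        simp only [χ, if_neg ha, if_neg ha']; ring
  refine ⟨(toEnd ℂ sl5 V f ^ n) v, ?_, ?_, ?_⟩
  · exact P.pow_toEnd_f_ne_zero_of_eq_nat rfl le_rfl
  · intro i j h
    by_cases hij : i = p ∧ j = q
    · obtain ⟨rfl, rfl⟩ := hij
      simp only [Equiv.Perm.mul_apply, Equiv.swap_apply_left, Equiv.swap_apply_right]
      rw [← hsucc]
      exact P.pow_toEnd_f_eq_zero_of_eq_nat rfl
    · have hswap := swap_lt_swap k i j h (by rwa [← hp, ← hq])
      rw [← hp, ← hq] at hswap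
      exact hraise n _ _ hswap.1 hswap.2
  · intro a b
    rw [Equiv.Perm.mul_apply, Equiv.Perm.mul_apply, hweight, hΛ, hΛ]

theorem IsExtremal.exists_perm [FiniteDimensional ℂ V] {Λ : Fin 5 → ℂ} {v : V}
    (hv : IsExtremal Λ 1 v) (lam : Fin 4 → ℕ) (hlam : ∀ k, Λ k.castSucc - Λ k.succ = lam k)
    (π : Equiv.Perm (Fin 5)) : ∃ v' : V, IsExtremal Λ π v' := by
  have hπ : π ∈ Submonoid.closure
      (Set.range fun k : Fin 4 => Equiv.swap k.castSucc k.succ) := by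
    rw [Equiv.Perm.mclosure_swap_castSucc_succ]; trivial
  induction hπ using Submonoid.closure_induction_right with
  | one => exact ⟨v, hv⟩
  | mul_right σ _ s hs ih =>
    obtain ⟨k, rfl⟩ := hs
    obtain ⟨v', hv'⟩ := ih
    exact hv'.exists_mul_swap k _ (hlam k)

end Extremal

/-! ### The dual of an irreducible module -/

open LieAlgebra.SpecialLinear LieModule

theorem sl5_induction {P : sl5 → Prop} (add : ∀ x y, P x → P y → P (x + y))
    (smul : ∀ (c : ℂ) x, P x → P (c • x)) (root : ∀ i j (h : i ≠ j), P (rootVec i j h))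
    (diag : ∀ i j, P (coroot i j)) (x : sl5) : P x := by
  have zero : P 0 := by simpa using smul 0 _ (diag 0 0)
  have hsum : ∀ {ι : Type} (s : Finset ι) (g : ι → sl5), (∀ i ∈ s, P (g i)) → P (∑ i ∈ s, g i) := by
    intro ι s g hg
    induction s using Finset.cons_induction with
    | empty => simpa using zero
    | cons a s ha ih =>
      rw [Finset.sum_cons]
      exact add _ _ (hg a (by simp)) (ih fun i hi => hg i (by simp [hi]))
  -- Diagonal entries are written with E_{ii} - E_{00}; the surplus collected at E_{00} is the
  -- trace, which vanishes.
  let g : Fin 5 → Fin 5 → sl5 := fun i j =>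
    if h : i = j then x.1 i i • coroot i 0 else x.1 i j • rootVec i j h
  have hx : x = ∑ i, ∑ j, g i j := by
    refine Subtype.ext ?_
    have hg : ∀ i j, (g i j).1 = Matrix.single i j (x.1 i j) -
        if i = j then Matrix.single 0 0 (x.1 i i) else 0 := by
      intro i j
      by_cases h : i = j
      · subst h; simp [g, smul_sub]
      · simp [g, h]
    have htr : ∑ i, x.1 i i = 0 := x.2
    have hs : (∑ i, ∑ j, g i j).1 = ∑ i, ∑ j, (g i j).1 := by
      simp only [AddSubmonoidClass.coe_finsetSum]
    rw [hs]
    simp only [hg, Finset.sum_sub_distrib, Finset.sum_ite_eq, Finset.mem_univ, if_true]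
    rw [← Matrix.matrix_eq_sum_single]
    have h0 : ∑ i, Matrix.single (0 : Fin 5) (0 : Fin 5) (x.1 i i) = 0 := by
      have h := map_sum (Matrix.singleLinearMap ℂ (0 : Fin 5) (0 : Fin 5)) (fun i => x.1 i i)
        Finset.univ
      rw [htr, map_zero] at h
      exact h.symm
    rw [h0, sub_zero]
  rw [hx]
  refine hsum _ _ fun i _ => hsum _ _ fun j _ => ?_
  by_cases h : i = j
  · simp only [g, dif_pos h]; exact smul _ _ (diag _ _)
  · simp only [g, dif_neg h]; exact smul _ _ (root _ _ h)

/-! ### Lowest weight vectors and the highest weight of the dual -/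

section Dual

variable {V : Type*} [AddCommGroup V] [Module ℂ V] [LieRingModule sl5 V] [LieModule ℂ sl5 V]

/-- A lowest weight vector of weight `-M`. -/
structure IsLowest (M : Fin 5 → ℂ) (u : V) : Prop where
  ne_zero : u ≠ 0
  lower : ∀ i j (h : i < j), ⁅rootVec j i h.ne', u⁆ = 0
  weight : ∀ a b, ⁅coroot a b, u⁆ = (M a - M b) • u

/-- An irreducible module is generated by a lowest weight vector under the raising operators. -/
theorem IsLowest.eq_top [IsIrreducible ℂ sl5 V] {M : Fin 5 → ℂ} {u : V} (hu : IsLowest M u)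
    (Q : Submodule ℂ V) (huQ : u ∈ Q)
    (hQ : ∀ i j (h : i < j), ∀ m ∈ Q, ⁅rootVec i j h.ne, m⁆ ∈ Q) : Q = ⊤ := by
  let S : Submodule ℂ V := sInf {Q | u ∈ Q ∧ ∀ i j (h : i < j), ∀ m ∈ Q, ⁅rootVec i j h.ne, m⁆ ∈ Q}
  have huS : u ∈ S := by
    rw [Submodule.mem_sInf]; exact fun Q hQ => hQ.1
  have hS : ∀ i j (h : i < j), ∀ m ∈ S, ⁅rootVec i j h.ne, m⁆ ∈ S := by
    intro i j h m hm
    rw [Submodule.mem_sInf] at hm ⊢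
    exact fun Q hQ => hQ.2 i j h m (hm Q hQ)
  -- The vectors of S which every x sends into S. By x(em) = [x, e]m + e(xm) this set is stable
  -- under raising operators, so minimality of S gives S ≤ R, and S is a submodule.
  let R : Submodule ℂ V :=
    { carrier := {m | m ∈ S ∧ ∀ x : sl5, ⁅x, m⁆ ∈ S}
      add_mem' := fun {a b} ha hb => ⟨add_mem ha.1 hb.1, fun x => by
        rw [lie_add]; exact add_mem (ha.2 x) (hb.2 x)⟩
      zero_mem' := ⟨zero_mem _, fun x => by rw [lie_zero]; exact zero_mem _⟩
      smul_mem' := fun c a ha => ⟨Submodule.smul_mem _ _ ha.1, fun x => by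
        rw [lie_smul]; exact Submodule.smul_mem _ _ (ha.2 x)⟩ }
  have hSR : S ≤ R := by
    refine sInf_le ⟨⟨huS, fun x => ?_⟩, fun i j h m hm => ⟨hS i j h m hm.1, fun x => ?_⟩⟩
    · induction x using sl5_induction with
      | add x y hx hy => rw [add_lie]; exact add_mem hx hy
      | smul c x hx => rw [smul_lie]; exact Submodule.smul_mem _ _ hx
      | root i j h =>
        rcases lt_or_gt_of_ne h with h | h
        · exact hS i j h u huS
        · rw [hu.lower j i h]; exact zero_mem _
      | diag i j => rw [hu.weight]; exact Submodule.smul_mem _ _ huS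
    · rw [leibniz_lie]
      exact add_mem (hm.2 _) (hS i j h _ (hm.2 x))
  let N : LieSubmodule ℂ sl5 V := { S with lie_mem := fun {x m} hm => (hSR hm).2 x }
  have hN : N = ⊤ := by
    refine (IsSimpleOrder.eq_bot_or_eq_top N).resolve_left fun h => hu.ne_zero ?_
    have : u ∈ N := huS
    rw [h] at this
    simpa using this
  rw [eq_top_iff]
  intro m _
  have hm : m ∈ N := by rw [hN]; trivial
  have hm' : m ∈ S := hm
  rw [Submodule.mem_sInf] at hm'
  exact hm' Q ⟨huQ, hQ⟩

/-- The grading element `diag(2, 1, 0, -1, -2)`. -/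
def gradingElt : sl5 := (2 : ℂ) • coroot 0 4 + coroot 1 3

/-- The eigenvalue j - i is written as a natural number plus one, to match the indexing of
`upperPart`; the truncated subtraction is harmless since i < j. -/
theorem lie_gradingElt_rootVec (i j : Fin 5) (h : i < j) :
    ⁅gradingElt, rootVec i j h.ne⁆ = (((j.1 - i.1 - 1 : ℕ) : ℂ) + 1) • rootVec i j h.ne := by
  rw [gradingElt, add_lie, smul_lie, lie_coroot_rootVec, lie_coroot_rootVec, smul_smul, ← add_smul]
  congr 1
  fin_cases i <;> fin_cases j <;> first | exact absurd h (by decide) | (simp; try norm_num)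

theorem lie_coroot_gradingElt (a b : Fin 5) : ⁅coroot a b, gradingElt⁆ = 0 := by
  have key : ∀ c d : Fin 5, ⁅coroot a b, coroot c d⁆ = 0 := by
    intro c d
    refine Subtype.ext ?_
    rw [sl_bracket, val_singleSubSingle, val_singleSubSingle]
    simp only [← Matrix.diagonal_single, Matrix.diagonal_sub, Matrix.diagonal_mul_diagonal]
    simp [mul_comm]
  rw [gradingElt, lie_add, lie_smul, key, key, smul_zero, add_zero]

/-- The sum of the eigenspaces of the grading element strictly above `c`. -/
def upperPart (V : Type*) [AddCommGroup V] [Module ℂ V] [LieRingModule sl5 V]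
    [LieModule ℂ sl5 V] (c : ℂ) : Submodule ℂ V :=
  ⨆ k : ℕ, (toEnd ℂ sl5 V gradingElt).eigenspace (c + (k + 1))

theorem lie_mem_eigenspace (i j : Fin 5) (h : i < j) (c : ℂ) {m : V}
    (hm : m ∈ (toEnd ℂ sl5 V gradingElt).eigenspace c) :
    ⁅rootVec i j h.ne, m⁆ ∈
      (toEnd ℂ sl5 V gradingElt).eigenspace (c + (((j.1 - i.1 - 1 : ℕ) : ℂ) + 1)) := by
  rw [Module.End.mem_eigenspace_iff, toEnd_apply_apply] at hm ⊢
  rw [leibniz_lie, hm, lie_gradingElt_rootVec i j h, smul_lie, lie_smul]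
  module

theorem lie_rootVec_mem_upperPart (i j : Fin 5) (h : i < j) {c : ℂ} {m : V}
    (hm : m ∈ upperPart V c) : ⁅rootVec i j h.ne, m⁆ ∈ upperPart V c := by
  induction hm using Submodule.iSup_induction' with
  | mem k m hm =>
    refine Submodule.mem_iSup_of_mem (k + (j.1 - i.1 - 1) + 1) ?_
    have := lie_mem_eigenspace i j h _ hm
    convert this using 2
    push_cast; ring
  | zero => rw [lie_zero]; exact zero_mem _
  | add a b _ _ ha hb => rw [lie_add]; exact add_mem ha hb

theorem lie_coroot_mem_upperPart (a b : Fin 5) {c : ℂ} {m : V}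
    (hm : m ∈ upperPart V c) : ⁅coroot a b, m⁆ ∈ upperPart V c := by
  induction hm using Submodule.iSup_induction' with
  | mem k m hm =>
    refine Submodule.mem_iSup_of_mem k ?_
    rw [Module.End.mem_eigenspace_iff, toEnd_apply_apply] at hm ⊢
    rw [leibniz_lie, hm, ← lie_skew, lie_coroot_gradingElt, neg_zero, zero_lie, lie_smul, zero_add]
  | zero => rw [lie_zero]; exact zero_mem _
  | add a b _ _ ha hb => rw [lie_add]; exact add_mem ha hb

/-- The functional dual to a lowest weight vector is a highest weight vector of the dual. -/
theorem IsLowest.exists_highest [IsIrreducible ℂ sl5 V] {M : Fin 5 → ℂ} {u : V}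
    (hu : IsLowest M u) : ∃ f : Module.Dual ℂ V, f ≠ 0 ∧
      (∀ (i j : Fin 5) (h : i < j), ⁅rootVec i j h.ne, f⁆ = 0) ∧
      ∀ a b, ⁅coroot a b, f⁆ = (M b - M a) • f := by
  obtain ⟨c, hc⟩ : ∃ c : ℂ, u ∈ (toEnd ℂ sl5 V gradingElt).eigenspace c := by
    refine ⟨2 * (M 0 - M 4) + (M 1 - M 3), ?_⟩
    rw [Module.End.mem_eigenspace_iff, toEnd_apply_apply, gradingElt, add_lie, smul_lie, hu.weight,
      hu.weight]
    module
  -- Eigenspaces for different eigenvalues are independent, and every summand of the upper part has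
  -- an eigenvalue different from c.
  have huT : u ∉ upperPart V c := by
    intro h
    have hle : upperPart V c ≤ ⨆ d, ⨆ _ : d ≠ c, (toEnd ℂ sl5 V gradingElt).eigenspace d := by
      refine iSup_le fun k => le_iSup₂_of_le (c + (k + 1)) ?_ le_rfl
      intro h
      have h1 : (k : ℂ) + 1 = 0 := by linear_combination h
      exact Nat.cast_add_one_ne_zero k h1
    exact hu.ne_zero ((Submodule.disjoint_def.1
      ((toEnd ℂ sl5 V gradingElt).eigenspaces_iSupIndep c)) u hc (hle h))
  have hru : ∀ i j (h : i < j), ⁅rootVec i j h.ne, u⁆ ∈ upperPart V c := fun i j h =>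
    Submodule.mem_iSup_of_mem _ (lie_mem_eigenspace i j h c hc)
  -- The line through u plus the upper part is stable under raising operators and contains u, so it
  -- is all of V. A functional killing the upper part is thus determined by its value at u.
  have hdec : ∀ m : V, ∃ (s : ℂ), ∃ t ∈ upperPart V c, m = s • u + t := by
    have htop : Submodule.span ℂ {u} ⊔ upperPart V c = ⊤ := by
      refine hu.eq_top _ (Submodule.mem_sup_left (Submodule.mem_span_singleton_self u)) ?_
      intro i j h m hm
      obtain ⟨y, hy, t, ht, rfl⟩ := Submodule.mem_sup.1 hm
      obtain ⟨s, rfl⟩ := Submodule.mem_span_singleton.1 hy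
      rw [lie_add, lie_smul]
      exact Submodule.mem_sup_right (add_mem (Submodule.smul_mem _ _ (hru i j h))
        (lie_rootVec_mem_upperPart i j h ht))
    intro m
    have hm : m ∈ Submodule.span ℂ {u} ⊔ upperPart V c := by rw [htop]; trivial
    obtain ⟨y, hy, t, ht, rfl⟩ := Submodule.mem_sup.1 hm
    obtain ⟨s, rfl⟩ := Submodule.mem_span_singleton.1 hy
    exact ⟨s, t, ht, rfl⟩
  obtain ⟨f, hfu, hf⟩ := Submodule.exists_le_ker_of_notMem huT
  have hf0 : ∀ t ∈ upperPart V c, f t = 0 := fun t ht => hf ht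
  refine ⟨f, fun h => hfu (by rw [h]; rfl), ?_, ?_⟩
  · intro i j h
    ext m
    obtain ⟨s, t, ht, rfl⟩ := hdec m
    rw [Module.Dual.lie_apply, lie_add, lie_smul, map_add, map_smul, hf0 _ (hru i j h),
      hf0 _ (lie_rootVec_mem_upperPart i j h ht)]
    simp
  · intro a b
    ext m
    obtain ⟨s, t, ht, rfl⟩ := hdec m
    rw [Module.Dual.lie_apply, lie_add, lie_smul, map_add, map_smul, hu.weight,
      hf0 _ (lie_coroot_mem_upperPart a b ht), LinearMap.smul_apply, map_add, hf0 _ ht, map_smul,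
      map_smul]
    simp only [smul_eq_mul]
    ring

/-- The common kernel in V of a submodule of the dual is a submodule of V. In finite dimension a
subspace of the dual is recovered from its common kernel, so only 0 and the whole dual occur. -/
theorem isIrreducible_dual [FiniteDimensional ℂ V] [IsIrreducible ℂ sl5 V] :
    IsIrreducible ℂ sl5 (Module.Dual ℂ V) := by
  have : Nontrivial V := LieModule.nontrivial_of_isIrreducible ℂ sl5 V
  refine IsIrreducible.mk fun N hN => ?_
  let A : LieSubmodule ℂ sl5 V :=
    { N.toSubmodule.dualCoannihilator with
      lie_mem := fun {x m} hm => by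
        have hm' : m ∈ N.toSubmodule.dualCoannihilator := hm
        change ⁅x, m⁆ ∈ N.toSubmodule.dualCoannihilator
        rw [Submodule.mem_dualCoannihilator] at hm' ⊢
        intro f hf
        have := hm' _ (N.lie_mem (x := x) hf)
        rwa [Module.Dual.lie_apply, neg_eq_zero] at this }
  have hA : A = ⊥ := by
    refine (IsSimpleOrder.eq_bot_or_eq_top A).resolve_right fun h => hN ?_
    rw [LieSubmodule.eq_bot_iff]
    intro f hf
    ext m
    have hm : m ∈ A := by rw [h]; trivial
    exact (Submodule.mem_dualCoannihilator m).1 hm f hf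
  have hA' : N.toSubmodule.dualCoannihilator = ⊥ := by
    have := congrArg LieSubmodule.toSubmodule hA
    exact this
  rw [← LieSubmodule.toSubmodule_inj, ← Subspace.dualCoannihilator_dualAnnihilator_eq
    (W := N.toSubmodule), hA', Submodule.dualAnnihilator_bot]
  rfl

theorem IsF.dual {lam : Fin 4 → ℕ} (h : IsF lam V) : IsF (starWeight lam) (Module.Dual ℂ V) := by
  have := h.finite
  have := h.irreducible
  obtain ⟨v, hv0, hv, hk⟩ := h.highest
  -- Coordinates of the weight on diagonal matrices, normalized by Λ₀ = 0; only their differences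
  -- matter on 𝔰𝔩₅.
  obtain ⟨Λ, hΛ⟩ : ∃ Λ : Fin 5 → ℂ, ∀ k : Fin 4, Λ k.castSucc - Λ k.succ = lam k := by
    refine ⟨![0, -lam 0, -lam 0 - lam 1, -lam 0 - lam 1 - lam 2,
      -lam 0 - lam 1 - lam 2 - lam 3], fun k => ?_⟩
    fin_cases k <;> simp
  have h0 : ∀ a, ⁅coroot 0 a, v⁆ = (Λ 0 - Λ a) • v := by
    intro a
    induction a using Fin.induction with
    | zero =>
      have h : coroot 0 0 = 0 := Subtype.ext (sub_self _)
      rw [h, zero_lie, sub_self, zero_smul]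
    | succ k ih =>
      have h : coroot 0 k.succ = coroot 0 k.castSucc + coroot k.castSucc k.succ :=
        (singleSubSingle_add_singleSubSingle _ _ _ _).symm
      rw [h, add_lie, ih, hk, ← hΛ k]
      module
  have hext : IsExtremal Λ 1 v := by
    refine ⟨hv0, fun i j h => hv i j h, fun a b => ?_⟩
    change ⁅coroot a b, v⁆ = _
    have h : coroot a b = coroot 0 b - coroot 0 a :=
      (singleSubSingle_sub_singleSubSingle _ _ _ _).symm
    rw [h, sub_lie, h0, h0]
    module
  -- An extremal vector for the reversed order is a lowest weight vector. Reversal, combined with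
  -- the sign of the dual action, turns (a,b,c,d) into (d,c,b,a).
  obtain ⟨u, hu⟩ := hext.exists_perm lam hΛ Fin.revPerm
  have hlow : IsLowest (fun a => Λ a.rev) u := by
    refine ⟨hu.ne_zero, fun i j h => ?_, fun a b => ?_⟩
    · simpa using hu.raise j.rev i.rev (Fin.rev_lt_rev.2 h)
    · simpa using hu.weight a.rev b.rev
  obtain ⟨f, hf0, hf, hw⟩ := hlow.exists_highest
  refine ⟨inferInstance, isIrreducible_dual, f, hf0, hf, fun k => ?_⟩
  rw [hw, Fin.rev_succ, Fin.rev_castSucc, hΛ]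
  rfl

end Dual

end E510

end

theorem mainTheorem10
    (V : Type*) [AddCommGroup V] [Module ℂ V] [LieRingModule E510.sl5 V] [LieModule ℂ E510.sl5 V]
    (W : Type*) [AddCommGroup W] [Module ℂ W] [LieRingModule E510.sl5 W] [LieModule ℂ E510.sl5 W]
    (θ : E510.Seq 3 → (V →ₗ[ℂ] W)) (θ' : Fin 5 → E510.Seq 1 → (V →ₗ[ℂ] W))
    (φ : E510.Verma V →ₗ[E510.U] E510.Verma W)
    (hφ : E510.IsAssociated φ (E510.degreeThree θ θ')) :
    (∃! ψ : E510.Verma (Module.Dual ℂ W) →ₗ[E510.U] E510.Verma (Module.Dual ℂ V),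
      E510.IsAssociated ψ
        (E510.degreeThree (fun I => (θ I).dualMap) (fun t I => (-(θ' t I)).dualMap))) ∧
    ∀ lam mu : Fin 4 → ℕ, E510.IsF lam V → E510.IsF mu W →
      E510.IsF (E510.starWeight lam) (Module.Dual ℂ V) ∧
      E510.IsF (E510.starWeight mu) (Module.Dual ℂ W) :=
  ⟨E510.existsUnique_dual θ θ' φ hφ, fun _ _ hV hW => ⟨hV.dual, hW.dual⟩⟩
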